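/- Let $0<\alpha<1$ and $0<T<\infty$. There is a constant $C_{\alpha,T}>0$, depending only on $\alpha$ and $T$, such that the following holds for every $1\le d\le 3$, every convex $d$-polytope $\Omega\subset\mathbb R^d$ (open, non-empty) and every $0\le\beta\le1$. *Notation.* Let $(\phi_i)_{i\in\mathbb N}\subset H_0^1(\Omega)$ be an orthonormal basis of $L^2(\Omega)$ with $-\Delta\phi_i=\lambda_i\phi_i$, where $0<\lambda_0\le\lambda_1\le\cdots\to\infty$. For $\gamma\in\mathbb R$, $\dot H^\gamma(\Omega)$ is the Hilbert space of formal series $\sum_i c_i\phi_i$ with $\|\sum_i c_i\phi_i\|_{\dot H^\gamma(\Omega)}^2:=\sum_i\lambda_i^\gamma c_i^2<\infty$, and $\langle\sum_i c_i\phi_i,\sum_i d_i\phi_i\rangle_{\dot H^\gamma(\Omega)}:=\sum_i c_id_i$ is the duality pairing of $\dot H^{-\gamma}(\Omega)$ with $\dot H^\gamma(\Omega)$. For a separable Hilbert space $X$ with orthonormal basis $(e_i)$, and $0<s\le 1$, $H^s(0,T;X)$ is the space of all $v\in L^2(0,T;X)$ with $\|v\|_{H^s(0,T;X)}^2:=\sum_i\|(v,e_i)_X\|_{H^s(0,T)}^2<\infty$,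 where $\|w\|_{H^s(0,T)}^2=\|w\|_{L^2(0,T)}^2+\int_0^T\!\!\int_0^T\frac{|w(t)-w(r)|^2}{|t-r|^{1+2s}}\,dr\,dt$ for $0<s<1$ and $\|w\|_{H^1(0,T)}^2=\|w\|_{L^2(0,T)}^2+\|w'\|_{L^2(0,T)}^2$. For $\gamma>0$ put $(I_{0+}^\gamma v)(t)=\frac1{\Gamma(\gamma)}\int_0^t(t-s)^{\gamma-1}v(s)\,ds$ and $(I_{T-}^\gamma v)(t)=\frac1{\Gamma(\gamma)}\int_t^T(s-t)^{\gamma-1}v(s)\,ds$, and for $0<\gamma<1$ put $D_{0+}^\gamma=\frac{d}{dt}I_{0+}^{1-\gamma}$, with the derivative in the sense of distributions on $(0,T)$. Let $W=H^{\alpha/2}(0,T;L^2(\Omega))\cap L^2(0,T;\dot H^1(\Omega))$. For $f\in L^2(0,T;\dot H^{-\beta}(\Omega))$, a *weak solution* of $\partial_tu-\partial_t^{1-\alpha}\Delta u=f$ in $\Omega\times(0,T)$, $u=0$ on $\partial\Omega\times(0,T)$, $u(\cdot,0)=0$, is a function $u\in W$ such that $$\langle D_{0+}^\alpha u,v\rangle_{H^{\alpha/2}(0,T;L^2(\Omega))}+\int_0^T\!\!\int_\Omega\nabla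 u\cdot\nabla v\,dx\,dt=\int_0^T\langle f(t),(I_{T-}^{1-\alpha}v)(t)\rangle_{\dot H^\beta(\Omega)}\,dt\qquad\text{for all }v\in W;$$ here $D_{0+}^\alpha u$ is the element of the dual of $H^{\alpha/2}(0,T;L^2(\Omega))$ that extends the distribution $D_{0+}^\alpha u$. **Theorem.** Let $f\in L^2(0,T;\dot H^{-\beta}(\Omega))$. There is exactly one weak solution $u$ (up to equality almost everywhere), and it has the following properties. 1. $u\in H^1(0,T;\dot H^{-\beta}(\Omega))\cap H^{1-\alpha/2}(0,T;\dot H^{1-\beta}(\Omega))\cap H^{1-\alpha}(0,T;\dot H^{2-\beta}(\Omega))$ and $$\|u\|_{H^1(0,T;\dot H^{-\beta}(\Omega))}+\|u\|_{H^{1-\alpha/2}(0,T;\dot H^{1-\beta}(\Omega))}+\|u\|_{H^{1-\alpha}(0,T;\dot H^{2-\beta}(\Omega))}\le C_{\alpha,T}\|f\|_{L^2(0,T;\dot H^{-\beta}(\Omega))}.$$ 2. $u$ has a representative in $C([0,T];\dot H^{-\beta}(\Omega))$, and $u(0)=0$ for it. 3. $u'\in L^2(0,T;\dot H^{-\beta}(\Omega))$,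 $D_{0+}^{1-\alpha}u\in L^2(0,T;\dot H^{2-\beta}(\Omega))$, and $$\int_0^T\langle u',v\rangle_{\dot H^\beta(\Omega)}\,dt+\int_0^T\langle\nabla D_{0+}^{1-\alpha}u,\nabla v\rangle_\Omega\,dt=\int_0^T\langle f,v\rangle_{\dot H^\beta(\Omega)}\,dt\qquad\text{for all }v\in L^2(0,T;\dot H^\beta(\Omega)).$$ For $w\in\dot H^{2-\beta}(\Omega)$ and $v=\sum_id_i\phi_i\in\dot H^\beta(\Omega)$ the term $\langle\nabla w,\nabla v\rangle_\Omega$ means $\sum_id_i\int_\Omega\nabla w\cdot\nabla\phi_i\,dx$; for $v\in L^2(0,T;\dot H^1(\Omega))$ the identity also holds with $\langle\nabla w,\nabla v\rangle_\Omega=\int_\Omega\nabla w\cdot\nabla v\,dx$. 4. If $\beta=0$, then $u'-D_{0+}^{1-\alpha}\Delta u=f$ in $L^2(0,T;L^2(\Omega))$, where $\Delta u\in L^2(0,T;L^2(\Omega))$ is the distributional Laplacian in $\Omega$ and $u'$, $D_{0+}^{1-\alpha}\Delta u$ lie in $L^2(0,T;L^2(\Omega))$. -/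

import Mathlib

open MeasureTheory Set Filter Topology
open scoped ENNReal NNReal ContDiff RealInnerProductSpace

noncomputable section

/-! ## Domain, test functions, Dirichlet eigenbasis -/

/-- `Ω` is an open convex polytope: the non-empty interior of the convex hull of finitely many
points. -/
def IsOpenConvexPolytope {d : ℕ} (Ω : Set (EuclideanSpace ℝ (Fin d))) : Prop :=
  Ω.Nonempty ∧ ∃ s : Finset (EuclideanSpace ℝ (Fin d)), Ω = interior (convexHull ℝ (s : Set _))

/-- `ψ ∈ C_c^∞(U)`. -/
def IsTestFun {E : Type*} [NormedAddCommGroup E] [NormedSpace ℝ E] (U : Set E) (ψ : E → ℝ) :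
    Prop :=
  ContDiff ℝ ∞ ψ ∧ HasCompactSupport ψ ∧ tsupport ψ ⊆ U

/-- The real Hilbert space `L²(Ω)`. -/
abbrev L2 {d : ℕ} (Ω : Set (EuclideanSpace ℝ (Fin d))) : Type :=
  Lp ℝ 2 (volume.restrict Ω)

/-- The real Hilbert space `L²(Ω; ℝ^d)`. -/
abbrev L2Vec {d : ℕ} (Ω : Set (EuclideanSpace ℝ (Fin d))) : Type :=
  Lp (EuclideanSpace ℝ (Fin d)) 2 (volume.restrict Ω)

/-- `G ∈ L²(Ω; ℝ^d)` is the weak gradient of `w ∈ L²(Ω)`. -/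
def HasWeakGrad {d : ℕ} (Ω : Set (EuclideanSpace ℝ (Fin d))) (w : L2 Ω) (G : L2Vec Ω) : Prop :=
  ∀ ψ : EuclideanSpace ℝ (Fin d) → ℝ, IsTestFun Ω ψ →
    ∫ x in Ω, w x • gradient ψ x = -∫ x in Ω, ψ x • G x

open Classical in
/-- The weak gradient `∇ w`, for `w ∈ H¹(Ω)` (and `0` if `w` has no weak gradient in `L²`). -/
def weakGrad {d : ℕ} (Ω : Set (EuclideanSpace ℝ (Fin d))) (w : L2 Ω) : L2Vec Ω :=
  if h : ∃ G : L2Vec Ω, HasWeakGrad Ω w G then h.choose else 0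

/-- `w ∈ H_0^1(Ω)`: `w` lies in the closure of `C_c^∞(Ω)` in `H¹(Ω)`. -/
def MemH10 {d : ℕ} (Ω : Set (EuclideanSpace ℝ (Fin d))) (w : L2 Ω) : Prop :=
  ∃ G : L2Vec Ω, HasWeakGrad Ω w G ∧
    ∃ ψ : ℕ → EuclideanSpace ℝ (Fin d) → ℝ, (∀ n, IsTestFun Ω (ψ n)) ∧
      Tendsto (fun n => eLpNorm (fun x => ψ n x - w x) 2 (volume.restrict Ω)) atTop (𝓝 0) ∧
      Tendsto (fun n => eLpNorm (fun x => gradient (ψ n) x - G x) 2 (volume.restrict Ω))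
        atTop (𝓝 0)

/-- `g ∈ L²(Ω)` is the Laplacian `Δ w` of `w ∈ L²(Ω)` in the sense of distributions. -/
def HasWeakLaplacian {d : ℕ} (Ω : Set (EuclideanSpace ℝ (Fin d))) (w g : L2 Ω) : Prop :=
  ∀ ψ : EuclideanSpace ℝ (Fin d) → ℝ, IsTestFun Ω ψ →
    ∫ x in Ω, w x * Laplacian.laplacian ψ x = ∫ x in Ω, g x * ψ x

/-- An orthonormal basis `(φ_i)` of `L²(Ω)` with `φ_i ∈ H_0^1(Ω)`, `-Δ φ_i = λ_i φ_i`, where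
`0 < λ_0 ≤ λ_1 ≤ ⋯ → ∞`. -/
structure DirichletEigenbasis {d : ℕ} (Ω : Set (EuclideanSpace ℝ (Fin d))) where
  φ : HilbertBasis ℕ ℝ (L2 Ω)
  lam : ℕ → ℝ
  memH10 : ∀ i, MemH10 Ω (φ i)
  eigen : ∀ i, HasWeakLaplacian Ω (φ i) (-(lam i • φ i))
  lam_pos : ∀ i, 0 < lam i
  lam_mono : Monotone lam
  lam_tendsto : Tendsto lam atTop atTop

/-! ## The spaces `Ḣ^γ(Ω)` -/

namespace DirichletEigenbasis

variable {d : ℕ} {Ω : Set (EuclideanSpace ℝ (Fin d))} (B : DirichletEigenbasis Ω)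

/-- The Hilbert space `Ḣ^γ(Ω)` of the formal series `∑ c_i φ_i` with `∑ λ_i^γ c_i² < ∞`.
An element is stored through its coordinates `λ_i^(γ/2) c_i ∈ ℓ²` with respect to the orthonormal
basis `λ_i^(-γ/2) φ_i`; the coefficients `c_i` are given by `DotH.coef` below, see
`DotH.norm_sq_eq` and `DotH.exists_coef_eq`. -/
@[nolint unusedArguments]
def DotH (_B : DirichletEigenbasis Ω) (_γ : ℝ) : Type := lp (fun _ : ℕ => ℝ) 2

instance (γ : ℝ) : NormedAddCommGroup (B.DotH γ) :=
  inferInstanceAs (NormedAddCommGroup (lp (fun _ : ℕ => ℝ) 2))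

instance (γ : ℝ) : InnerProductSpace ℝ (B.DotH γ) :=
  inferInstanceAs (InnerProductSpace ℝ (lp (fun _ : ℕ => ℝ) 2))

instance (γ : ℝ) : CompleteSpace (B.DotH γ) :=
  inferInstanceAs (CompleteSpace (lp (fun _ : ℕ => ℝ) 2))

/-- The orthonormal basis `λ_i^(-γ/2) φ_i` of `Ḣ^γ(Ω)`, see `DotH.coef_dotBasis`. -/
def dotBasis (γ : ℝ) : HilbertBasis ℕ ℝ (B.DotH γ) :=
  HilbertBasis.ofRepr (LinearIsometryEquiv.refl ℝ (lp (fun _ : ℕ => ℝ) 2))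

variable {B}

/-- The coefficient `c_i` of `x = ∑ c_i φ_i ∈ Ḣ^γ(Ω)`. -/
def DotH.coef {γ : ℝ} (x : B.DotH γ) (i : ℕ) : ℝ :=
  B.lam i ^ (-γ / 2) * (B.dotBasis γ).repr x i

/-- The element `∑ c_i φ_i` of `L²(Ω)`, for `x = ∑ c_i φ_i ∈ Ḣ^γ(Ω)` with `γ ≥ 0`. -/
def DotH.toL2 {γ : ℝ} (x : B.DotH γ) : L2 Ω := ∑' i, x.coef i • B.φ i

variable (B)

/-- The coefficient `c_i = (w, φ_i)` of `w = ∑ c_i φ_i ∈ L²(Ω)`. -/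
def coefL2 (w : L2 Ω) (i : ℕ) : ℝ := ⟪B.φ i, w⟫

variable {B}

theorem DotH.lam_rpow_mul_coef_sq {γ : ℝ} (x : B.DotH γ) (i : ℕ) :
    B.lam i ^ γ * x.coef i ^ 2 = ((B.dotBasis γ).repr x i) ^ 2 := by
  have h := B.lam_pos i
  have h2 : (B.lam i ^ (-γ / 2)) ^ 2 = B.lam i ^ (-γ) := by
    rw [← Real.rpow_natCast, ← Real.rpow_mul h.le]; congr 1; push_cast; ring
  rw [DotH.coef, mul_pow, h2, ← mul_assoc, ← Real.rpow_add h]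
  simp

theorem DotH.hasSum_norm_sq {γ : ℝ} (x : B.DotH γ) :
    HasSum (fun i => B.lam i ^ γ * x.coef i ^ 2) (‖x‖ ^ 2) := by
  simp_rw [DotH.lam_rpow_mul_coef_sq]
  have h := lp.hasSum_norm (p := 2) (by norm_num) ((B.dotBasis γ).repr x)
  simpa using h

/-- `‖∑ c_i φ_i‖² = ∑ λ_i^γ c_i²`. -/
theorem DotH.norm_sq_eq {γ : ℝ} (x : B.DotH γ) :
    ‖x‖ ^ 2 = ∑' i, B.lam i ^ γ * x.coef i ^ 2 := x.hasSum_norm_sq.tsum_eq.symm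

/-- Every series `∑ c_i φ_i` with `∑ λ_i^γ c_i² < ∞` is an element of `Ḣ^γ(Ω)`. -/
theorem DotH.exists_coef_eq (γ : ℝ) (c : ℕ → ℝ) (hc : Summable fun i => B.lam i ^ γ * c i ^ 2) :
    ∃ x : B.DotH γ, x.coef = c := by
  have key : ∀ i, (B.lam i ^ (γ / 2) * c i) ^ 2 = B.lam i ^ γ * c i ^ 2 := fun i => by
    rw [mul_pow, ← Real.rpow_natCast, ← Real.rpow_mul (B.lam_pos i).le]; congr 2; push_cast; ring
  have hm : Memℓp (fun i => B.lam i ^ (γ / 2) * c i) 2 := by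
    apply memℓp_gen
    have h2 : ∀ i, ‖B.lam i ^ (γ / 2) * c i‖ ^ (2 : ℝ≥0∞).toReal = B.lam i ^ γ * c i ^ 2 :=
      fun i => by simp only [ENNReal.toReal_ofNat, Real.rpow_ofNat, Real.norm_eq_abs, sq_abs, key]
    exact (summable_congr h2).mpr hc
  refine ⟨(B.dotBasis γ).repr.symm ⟨_, hm⟩, funext fun i => ?_⟩
  rw [DotH.coef, LinearIsometryEquiv.apply_symm_apply]
  change B.lam i ^ (-γ / 2) * (B.lam i ^ (γ / 2) * c i) = c i
  rw [← mul_assoc, ← Real.rpow_add (B.lam_pos i)]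
  simp [neg_div]

theorem DotH.coef_injective (γ : ℝ) :
    Function.Injective (fun x : B.DotH γ => x.coef) := by
  intro x y h
  apply (B.dotBasis γ).repr.injective
  ext i
  have := congrFun h i
  simp only [DotH.coef] at this
  exact mul_left_cancel₀ (Real.rpow_pos_of_pos (B.lam_pos i) _).ne' this

theorem DotH.coef_dotBasis (γ : ℝ) (i j : ℕ) :
    DotH.coef (B.dotBasis γ i) j = if j = i then B.lam i ^ (-γ / 2) else 0 := by
  rw [DotH.coef, HilbertBasis.repr_self, lp.single_apply]
  by_cases h : j = i
  · subst h; simp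
  · simp [h]

end DirichletEigenbasis

/-- The pairing `⟨∑ c_i φ_i, ∑ d_i φ_i⟩ = ∑ c_i d_i` of formal series. -/
def seriesPairing (c d : ℕ → ℝ) : ℝ := ∑' i, c i * d i

/-! ## Calculus in time on `(0,T)` -/

/-- `L²(0,T;X)`. -/
def MemL2 {X : Type*} [NormedAddCommGroup X] (T : ℝ) (v : ℝ → X) : Prop :=
  MemLp v 2 (volume.restrict (Ioo 0 T))

/-- The distributional derivative of `v` on `(0,T)` is `g`; both are Bochner integrable. -/
def HasTimeDeriv {X : Type*} [NormedAddCommGroup X] [NormedSpace ℝ X] (T : ℝ) (v g : ℝ → X) :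
    Prop :=
  IntegrableOn v (Ioo 0 T) ∧ IntegrableOn g (Ioo 0 T) ∧
    ∀ ψ : ℝ → ℝ, IsTestFun (Ioo 0 T) ψ →
      ∫ t in Ioo 0 T, deriv ψ t • v t = -∫ t in Ioo 0 T, ψ t • g t

/-- The left Riemann–Liouville integral
`(I_{0+}^γ v)(t) = Γ(γ)⁻¹ ∫_0^t (t-s)^(γ-1) v(s) ds`. -/
def rlIntLeft {X : Type*} [NormedAddCommGroup X] [NormedSpace ℝ X] (γ : ℝ) (v : ℝ → X) (t : ℝ) :
    X :=
  (Real.Gamma γ)⁻¹ • ∫ s in Ioo 0 t, (t - s) ^ (γ - 1) • v s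

/-- The right Riemann–Liouville integral
`(I_{T-}^γ v)(t) = Γ(γ)⁻¹ ∫_t^T (s-t)^(γ-1) v(s) ds`. -/
def rlIntRight {X : Type*} [NormedAddCommGroup X] [NormedSpace ℝ X] (γ T : ℝ) (v : ℝ → X)
    (t : ℝ) : X :=
  (Real.Gamma γ)⁻¹ • ∫ s in Ioo t T, (s - t) ^ (γ - 1) • v s

/-- `D_{0+}^γ v = g` for `0 < γ < 1`, where `D_{0+}^γ = D I_{0+}^{1-γ}` with `D` the
distributional derivative. -/
def HasRLDeriv {X : Type*} [NormedAddCommGroup X] [NormedSpace ℝ X] (γ T : ℝ) (v g : ℝ → X) :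
    Prop :=
  HasTimeDeriv T (rlIntLeft (1 - γ) v) g

/-- The square of the norm of the Sobolev space `H^s(0,T)` of real functions, for `0 < s ≤ 1`:
the Sobolev–Slobodeckij norm for `0 < s < 1`, and `‖w‖² + ‖w'‖²` for `s = 1`
(`∞` if `w` has no weak derivative). -/
def sobolevNormSq (s T : ℝ) (w : ℝ → ℝ) : ℝ≥0∞ :=
  (∫⁻ t in Ioo 0 T, ‖w t‖ₑ ^ 2) +
    if s < 1 then
      ∫⁻ t in Ioo 0 T, ∫⁻ r in Ioo 0 T, ‖w t - w r‖ₑ ^ 2 / ENNReal.ofReal (|t - r| ^ (1 + 2 * s))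
    else
      ⨅ (g : ℝ → ℝ) (_ : HasTimeDeriv T w g), ∫⁻ t in Ioo 0 T, ‖g t‖ₑ ^ 2

/-- The norm of `H^s(0,T;X)`, for `0 < s ≤ 1` and a Hilbert space `X` with orthonormal basis `e`:
`(∑_i ‖(v, e_i)_X‖²_{H^s(0,T)})^(1/2)`. -/
def sobolevNorm {X : Type*} [NormedAddCommGroup X] [InnerProductSpace ℝ X]
    (e : HilbertBasis ℕ ℝ X) (s T : ℝ) (v : ℝ → X) : ℝ≥0∞ :=
  (∑' i, sobolevNormSq s T (fun t => ⟪e i, v t⟫)) ^ (1 / 2 : ℝ)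

/-- `v ∈ H^s(0,T;X)`. -/
def MemSobolev {X : Type*} [NormedAddCommGroup X] [InnerProductSpace ℝ X]
    (e : HilbertBasis ℕ ℝ X) (s T : ℝ) (v : ℝ → X) : Prop :=
  MemL2 T v ∧ sobolevNorm e s T v < ⊤

/-- The functional `ℓ` is `D_{0+}^α u ∈ H^{α/2}(0,T;X)^*`: it is linear and bounded on
`H^{α/2}(0,T;X)` and extends the distribution `D I_{0+}^{1-α} u`. (For `0 < α < 1` the span of
the functions `ψ x`, with `ψ ∈ C_c^∞(0,T)` and `x ∈ X`, is dense in `H^{α/2}(0,T;X)`.) -/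
structure IsDualRLDeriv {X : Type*} [NormedAddCommGroup X] [InnerProductSpace ℝ X]
    (e : HilbertBasis ℕ ℝ X) (α T : ℝ) (u : ℝ → X) (ℓ : (ℝ → X) → ℝ) : Prop where
  linear : ∀ v w : ℝ → X, MemSobolev e (α / 2) T v → MemSobolev e (α / 2) T w → ∀ a b : ℝ,
    ℓ (fun t => a • v t + b • w t) = a * ℓ v + b * ℓ w
  bounded : ∃ K : ℝ≥0, ∀ v : ℝ → X, MemSobolev e (α / 2) T v →
    ENNReal.ofReal |ℓ v| ≤ K * sobolevNorm e (α / 2) T v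
  extends_distribution : ∀ (ψ : ℝ → ℝ) (x : X), IsTestFun (Ioo 0 T) ψ →
    ℓ (fun t => ψ t • x) = -∫ t in Ioo 0 T, deriv ψ t * ⟪rlIntLeft (1 - α) u t, x⟫

/-! ## Weak solutions -/

section WeakSolution

variable {d : ℕ} {Ω : Set (EuclideanSpace ℝ (Fin d))} (B : DirichletEigenbasis Ω)

/-- For almost every `t ∈ (0,T)`, `u(t) ∈ L²(Ω)` and `v(t) ∈ Ḣ^γ(Ω)` are the same series
`∑ c_i φ_i`. -/
def Represents {γ : ℝ} (T : ℝ) (v : ℝ → B.DotH γ) (u : ℝ → L2 Ω) : Prop :=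
  ∀ᵐ t ∂(volume.restrict (Ioo 0 T)), (v t).coef = B.coefL2 (u t)

/-- The space `W = H^{α/2}(0,T;L²(Ω)) ∩ L²(0,T;Ḣ¹(Ω))`. -/
def MemW (α T : ℝ) (u : ℝ → L2 Ω) : Prop :=
  MemSobolev B.φ (α / 2) T u ∧ ∃ v : ℝ → B.DotH 1, MemL2 T v ∧ Represents B T v u

/-- `u` is a weak solution (with `u_0 = 0`) for the source term `f`: `u ∈ W` and
`⟨D_{0+}^α u, v⟩ + ⟨∇u, ∇v⟩_{Ω×(0,T)} = ⟨f, I_{T-}^{1-α} v⟩` for all `v ∈ W`. -/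
def IsWeakSolution (α T : ℝ) {γ : ℝ} (f : ℝ → B.DotH γ) (u : ℝ → L2 Ω) : Prop :=
  MemW B α T u ∧ ∃ ℓ : (ℝ → L2 Ω) → ℝ, IsDualRLDeriv B.φ α T u ℓ ∧
    ∀ v : ℝ → L2 Ω, MemW B α T v →
      ℓ v + ∫ t in Ioo 0 T, ⟪weakGrad Ω (u t), weakGrad Ω (v t)⟫ =
        ∫ t in Ioo 0 T, seriesPairing (f t).coef (B.coefL2 (rlIntRight (1 - α) T v t))

variable {B}

/-- `⟨∇x, ∇y⟩_Ω` for `x ∈ Ḣ^γ(Ω)`, `γ ≥ 1`, and `y = ∑ d_i φ_i ∈ Ḣ^δ(Ω)`, `δ ≥ 2 - γ`,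
understood as `∑ d_i ⟨∇x, ∇φ_i⟩_Ω` since `∇y` need not be a function. -/
def gradPairing {γ δ : ℝ} (x : B.DotH γ) (y : B.DotH δ) : ℝ :=
  ∑' i, y.coef i * ⟪weakGrad Ω x.toL2, weakGrad Ω (B.φ i)⟫

end WeakSolution

end

/-! Expand in the eigenbasis. Let f_i be the coordinates of f in the orthonormal basis of Ḣ^{-β},
and write the i-th coefficient of u as λ_i^{β/2} I^1 w_i, where I^γ is the left Riemann–Liouville
integral. The problem then decouples into the scalar Volterra equations w_i + λ_i I^α w_i = f_i on
(0,T) (`SolvesMode`). Everything reduces to estimates for one such equation that are uniform in λ_i,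
followed by summation over i.

Multiplication by e^{-t} and extension by zero turn I^γ into convolution with e^{-t} t^{γ-1}/Γ(γ),
whose Fourier symbol is z^{-γ} with z = 1 + 2πiξ (`realFourier_gammaKernel`). As Re z = 1, the
symbol stays in a sector, so for 0 < γ ≤ 1 the quadratic form of the convolution dominates cos(γπ/2)
∫ |z|^{-γ} |Ĝ|² (`MemL12.coercive`). Hence 1 + λ I^α is invertible by Lax–Milgram, and testing the
equation with its solution bounds, by the norm of f alone, the norm of w, the energy λ ∫ |z|^{-α}
|Ŵ|² of the damped w, and λ² ‖I^α w‖². These three bounds are the three terms of the regularity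
estimate: w is the derivative of I^1 w; the H^{1-α/2} norm of I^1 w is controlled by the energy,
because Gagliardo seminorms can be read off the Fourier transform (`MemL12.gagliardo_univ_eq`); and
I^1 w = I^{1-α} I^α w controls the H^{1-α} norm. The powers of λ_i match the weights of Ḣ^{-β},
Ḣ^{1-β}, Ḣ^{2-β} exactly, so no spectral quantity enters the constant.

The link with weak solutions rests on the fractional Hardy inequality, available because α/2 < 1/2.
It makes extension by zero bounded from H^{α/2}(0,T) to H^{α/2}(ℝ), so that D^α I^1 w = I^{1-α} w
defines a bounded functional (`SolvesMode.lam_mul_sq_integral_le`) and the assembled series is a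
weak solution. For uniqueness, testing with ψ φ_i shows only that I^{1-α} y + λ I^1 y is constant,
for y the difference of two solutions of a mode. Hardy makes this expression integrable against
dt/t, so the constant is zero, and coercivity of I^{1-α} gives y = 0 (`SolvesMode.unique`). Thus
every weak solution has the modes I^1 w_i, and its regularity can be read off them. -/

noncomputable section

/-! ## The Fourier transform on `L¹ ∩ L²` -/

section FourierL2

open scoped FourierTransform SchwartzMap ComplexConjugate

/-- Both transforms have the same integral against every compactly supported smooth g: the L²
transform through its agreement with the transform of tempered distributions, the integral one
through Fubini. In both cases the transform is moved onto g. -/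
theorem fourier_toLp_ae_eq {f : ℝ → ℂ} (h1 : Integrable f) (h2 : MemLp f 2) :
    ((𝓕 (h2.toLp f) : Lp ℂ 2 (volume : Measure ℝ)) : ℝ → ℂ) =ᵐ[volume] 𝓕 f := by
  apply ae_eq_of_integral_contDiff_smul_eq
  · exact (Lp.memLp _).locallyIntegrable (by norm_num)
  · exact (VectorFourier.fourierIntegral_continuous Real.continuous_fourierChar
      (by exact continuous_inner) h1).locallyIntegrable
  · intro g hg hgs
    have hgc : ContDiff ℝ ∞ (fun x => (g x : ℂ)) := Complex.ofRealCLM.contDiff.comp hg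
    have hgsc : HasCompactSupport (fun x => (g x : ℂ)) :=
      hgs.comp_left (g := fun x : ℝ => (x : ℂ)) (by simp)
    set φ : 𝓢(ℝ, ℂ) := hgsc.toSchwartzMap hgc with hφ
    have e1 := congrArg (fun D : 𝓢'(ℝ, ℂ) => D φ)
      (Lp.fourier_toTemperedDistribution_eq (h2.toLp f))
    simp only [TemperedDistribution.fourier_apply, Lp.toTemperedDistribution_apply] at e1
    have e2 : ∫ x, (𝓕 φ) x • (h2.toLp f) x = ∫ x, (𝓕 φ) x • f x :=
      integral_congr_ae (by filter_upwards [h2.coeFn_toLp] with x hx; rw [hx])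
    have e3 := VectorFourier.integral_fourierIntegral_smul_eq_flip (μ := volume) (ν := volume)
      (f := φ) (g := f) (L := innerₗ ℝ) Real.continuous_fourierChar
      (by exact continuous_inner) φ.integrable h1
    rw [e2] at e1
    have e4 : ∫ x, g x • (𝓕 (h2.toLp f) : Lp ℂ 2 (volume : Measure ℝ)) x
        = ∫ x, φ x • (𝓕 (h2.toLp f) : Lp ℂ 2 (volume : Measure ℝ)) x := rfl
    have e5 : ∫ x, g x • 𝓕 f x = ∫ x, φ x • 𝓕 f x := rfl
    rw [e4, e5, ← e1]
    rw [flip_innerₗ] at e3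
    exact e3

/-- The real function `G` lies in `L¹(ℝ) ∩ L²(ℝ)`. -/
structure MemL12 (G : ℝ → ℝ) : Prop where
  int : Integrable G
  mem : MemLp G 2

/-- The Fourier transform of a real function. -/
def realFourier (G : ℝ → ℝ) : ℝ → ℂ := 𝓕 (fun t => (G t : ℂ))

namespace MemL12

variable {G H : ℝ → ℝ}

theorem sub (hG : MemL12 G) (hH : MemL12 H) : MemL12 (fun t => G t - H t) :=
  ⟨hG.int.sub hH.int, hG.mem.sub hH.mem⟩

theorem comp_add_right (hG : MemL12 G) (h : ℝ) : MemL12 (fun t => G (t + h)) :=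
  ⟨hG.int.comp_add_right h, hG.mem.comp_measurePreserving (measurePreserving_add_right volume h)⟩

theorem int_complex (hG : MemL12 G) : Integrable (fun t => (G t : ℂ)) := hG.int.ofReal

theorem mem_complex (hG : MemL12 G) : MemLp (fun t => (G t : ℂ)) 2 := hG.mem.ofReal

theorem realFourier_ae_eq (hG : MemL12 G) :
    ((𝓕 (hG.mem_complex.toLp _) : Lp ℂ 2 (volume : Measure ℝ)) : ℝ → ℂ) =ᵐ[volume]
      realFourier G :=
  fourier_toLp_ae_eq hG.int_complex hG.mem_complex

theorem realFourier_memLp (hG : MemL12 G) : MemLp (realFourier G) 2 :=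
  (memLp_congr_ae hG.realFourier_ae_eq).1 (Lp.memLp _)

theorem realFourier_continuous (hG : MemL12 G) : Continuous (realFourier G) :=
  VectorFourier.fourierIntegral_continuous Real.continuous_fourierChar
    (by exact continuous_inner) hG.int_complex

theorem parseval (hG : MemL12 G) (hH : MemL12 H) :
    ∫ ξ, realFourier G ξ * conj (realFourier H ξ) = ((∫ t, G t * H t : ℝ) : ℂ) := by
  have h := Lp.inner_fourier_eq (hH.mem_complex.toLp _) (hG.mem_complex.toLp _)
  rw [L2.inner_def, L2.inner_def] at h
  have e1 : ∫ ξ, realFourier G ξ * conj (realFourier H ξ) =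
      ∫ a, inner ℂ ((𝓕 (hH.mem_complex.toLp _) : Lp ℂ 2 (volume : Measure ℝ)) a)
        ((𝓕 (hG.mem_complex.toLp _) : Lp ℂ 2 (volume : Measure ℝ)) a) := by
    refine integral_congr_ae ?_
    filter_upwards [hG.realFourier_ae_eq, hH.realFourier_ae_eq] with ξ h1 h2
    rw [h1, h2, RCLike.inner_apply]
  rw [e1, h]
  refine Eq.trans ?_ (integral_ofReal (𝕜 := ℂ))
  refine integral_congr_ae ?_
  filter_upwards [hG.mem_complex.coeFn_toLp, hH.mem_complex.coeFn_toLp] with t h1 h2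
  rw [h1, h2, RCLike.inner_apply]
  simp

theorem plancherel (hG : MemL12 G) :
    ∫⁻ ξ, ‖realFourier G ξ‖ₑ ^ 2 = ∫⁻ t, ‖G t‖ₑ ^ 2 := by
  have h := Lp.norm_fourier_eq (hG.mem_complex.toLp _)
  have h2 : eLpNorm (realFourier G) 2 volume = eLpNorm (fun t => (G t : ℂ)) 2 volume := by
    rw [← eLpNorm_congr_ae hG.realFourier_ae_eq, ← Lp.enorm_def, ← ofReal_norm, h,
      ofReal_norm, Lp.enorm_def, eLpNorm_congr_ae hG.mem_complex.coeFn_toLp]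
  rw [eLpNorm_eq_lintegral_rpow_enorm_toReal (by norm_num) (by norm_num),
    eLpNorm_eq_lintegral_rpow_enorm_toReal (by norm_num) (by norm_num)] at h2
  have h3 := ENNReal.rpow_left_injective (by norm_num) h2
  simp only [ENNReal.toReal_ofNat, ENNReal.rpow_ofNat] at h3
  rw [h3]
  refine lintegral_congr fun t => ?_
  rw [← ofReal_norm, Complex.norm_real, ofReal_norm]

theorem realFourier_sub (hG : MemL12 G) (hH : MemL12 H) (ξ : ℝ) :
    realFourier (fun t => G t - H t) ξ = realFourier G ξ - realFourier H ξ := by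
  simp only [realFourier, Real.fourier_eq]
  rw [← integral_sub]
  · refine integral_congr_ae (ae_of_all _ fun t => ?_)
    simp [smul_sub]
  · exact (Real.fourierIntegral_convergent_iff ξ).2 hG.int_complex
  · exact (Real.fourierIntegral_convergent_iff ξ).2 hH.int_complex

theorem ae_eq_of_realFourier_eq (hG : MemL12 G) (hH : MemL12 H)
    (h : realFourier G =ᵐ[volume] realFourier H) : G =ᵐ[volume] H := by
  have h1 := (hG.sub hH).plancherel
  have h2 : ∫⁻ ξ, ‖realFourier (fun t => G t - H t) ξ‖ₑ ^ 2 = 0 := by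
    rw [lintegral_eq_zero_iff']
    · filter_upwards [h] with ξ hξ
      rw [hG.realFourier_sub hH, hξ]
      simp
    · exact ((hG.sub hH).realFourier_continuous.aemeasurable.enorm).pow_const _
  rw [h2, eq_comm, lintegral_eq_zero_iff' ((hG.sub hH).mem.1.enorm.pow_const _)] at h1
  filter_upwards [h1] with t ht
  simpa [sub_eq_zero] using ht

end MemL12

theorem realFourier_comp_add_right (G : ℝ → ℝ) (h ξ : ℝ) :
    realFourier (fun t => G (t + h)) ξ
      = Complex.exp ((2 * Real.pi * (h * ξ) : ℝ) * Complex.I) * realFourier G ξ := by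
  have e := VectorFourier.fourierIntegral_comp_add_right Real.fourierChar volume (innerₗ ℝ)
    (fun t => (G t : ℂ)) h
  have e2 := congrFun e ξ
  refine Eq.trans e2 ?_
  simp only [innerₗ_apply_apply, Circle.smul_def, Real.fourierChar_apply, smul_eq_mul]
  congr 4
  simp [mul_comm]

end FourierL2

/-! ## The exponentially damped Riemann–Liouville kernel -/

section GammaKernel

open scoped FourierTransform

/-- The kernel `e^{-t} t^{γ-1} / Γ(γ)` on `(0,∞)`. -/
def gammaKernel (γ : ℝ) : ℝ → ℝ :=
  (Ioi 0).indicator fun t => (Real.Gamma γ)⁻¹ * (Real.exp (-t) * t ^ (γ - 1))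

theorem gammaKernel_of_pos (γ : ℝ) {t : ℝ} (ht : 0 < t) :
    gammaKernel γ t = (Real.Gamma γ)⁻¹ * (Real.exp (-t) * t ^ (γ - 1)) :=
  indicator_of_mem (mem_Ioi.2 ht) _

theorem gammaKernel_of_nonpos (γ : ℝ) {t : ℝ} (ht : t ≤ 0) : gammaKernel γ t = 0 :=
  indicator_of_notMem (by simpa using ht) _

theorem gammaKernel_nonneg {γ : ℝ} (hγ : 0 < γ) (t : ℝ) : 0 ≤ gammaKernel γ t := by
  refine indicator_nonneg (fun t ht => ?_) t
  have := Real.Gamma_pos_of_pos hγ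
  have : (0 : ℝ) < t := ht
  positivity

theorem measurable_gammaKernel (γ : ℝ) : Measurable (gammaKernel γ) :=
  Measurable.indicator (by fun_prop) measurableSet_Ioi

theorem integrable_gammaKernel {γ : ℝ} (hγ : 0 < γ) : Integrable (gammaKernel γ) :=
  (integrable_indicator_iff measurableSet_Ioi).2
    ((Real.GammaIntegral_convergent hγ).const_mul _)

theorem integral_gammaKernel {γ : ℝ} (hγ : 0 < γ) : ∫ t, gammaKernel γ t = 1 := by
  rw [gammaKernel, integral_indicator measurableSet_Ioi, integral_const_mul,
    ← Real.Gamma_eq_integral hγ, inv_mul_cancel₀ (Real.Gamma_pos_of_pos hγ).ne']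

theorem lintegral_gammaKernel {γ : ℝ} (hγ : 0 < γ) :
    ∫⁻ t, ENNReal.ofReal (gammaKernel γ t) = 1 := by
  rw [← ofReal_integral_eq_lintegral_ofReal (integrable_gammaKernel hγ)
    (ae_of_all _ (gammaKernel_nonneg hγ)), integral_gammaKernel hγ, ENNReal.ofReal_one]

/-- Keeps the ξ-derivative of the Fourier transform inside the family of kernels. -/
theorem mul_gammaKernel {γ : ℝ} (hγ : 0 < γ) (t : ℝ) :
    t * gammaKernel γ t = γ * gammaKernel (γ + 1) t := by
  rcases le_or_gt t 0 with ht | ht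
  · simp [gammaKernel_of_nonpos _ ht]
  · rw [gammaKernel_of_pos _ ht, gammaKernel_of_pos _ ht, Real.Gamma_add_one hγ.ne',
      show γ + 1 - 1 = (γ - 1) + 1 by ring, Real.rpow_add_one ht.ne']
    have := (Real.Gamma_pos_of_pos hγ).ne'
    field_simp

/-- The Fourier symbol `1 + 2πiξ` of `1 + d/dt`. -/
def damped (ξ : ℝ) : ℂ := 1 + (2 * Real.pi * ξ : ℝ) * Complex.I

theorem damped_re (ξ : ℝ) : (damped ξ).re = 1 := by simp [damped]

theorem damped_im (ξ : ℝ) : (damped ξ).im = 2 * Real.pi * ξ := by simp [damped]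

theorem damped_ne_zero (ξ : ℝ) : damped ξ ≠ 0 := fun h => by
  simpa [h] using damped_re ξ

theorem damped_mem_slitPlane (ξ : ℝ) : damped ξ ∈ Complex.slitPlane :=
  Or.inl (by rw [damped_re]; exact one_pos)

theorem one_le_norm_damped (ξ : ℝ) : 1 ≤ ‖damped ξ‖ := by
  have := Complex.abs_re_le_norm (damped ξ)
  rwa [damped_re, abs_one] at this

theorem continuous_damped : Continuous damped := by unfold damped; fun_prop

theorem hasDerivAt_damped (ξ : ℝ) :
    HasDerivAt damped ((2 * Real.pi : ℝ) * Complex.I) ξ := by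
  have h : HasDerivAt (fun ξ : ℝ => ((2 * Real.pi * ξ : ℝ) : ℂ)) ((2 * Real.pi : ℝ) : ℂ) ξ := by
    have := ((hasDerivAt_id ξ).const_mul (2 * Real.pi)).ofReal_comp
    simpa using this
  exact (h.mul_const Complex.I).const_add 1

theorem realFourier_gammaKernel_eq_integral (γ ξ : ℝ) :
    realFourier (gammaKernel γ) ξ = ∫ t in Ioi (0 : ℝ),
      ((Real.Gamma γ)⁻¹ : ℝ) * (Complex.exp (-(damped ξ * t)) * ((t ^ (γ - 1) : ℝ) : ℂ)) := by
  rw [realFourier, Real.fourier_real_eq_integral_exp_smul, ← integral_indicator measurableSet_Ioi]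
  refine integral_congr_ae (ae_of_all _ fun t => ?_)
  simp only
  by_cases ht : t ∈ Ioi (0 : ℝ)
  · rw [indicator_of_mem ht, gammaKernel_of_pos _ ht]
    rw [smul_eq_mul, damped, show -((1 + (2 * Real.pi * ξ : ℝ) * Complex.I) * (t : ℂ))
      = (-2 * Real.pi * t * ξ) * Complex.I + -(t : ℂ) by push_cast; ring, Complex.exp_add]
    push_cast
    ring
  · rw [indicator_of_notMem ht, gammaKernel_of_nonpos _ (by simpa using ht)]
    simp

theorem norm_exp_damped (ξ t : ℝ) : ‖Complex.exp (-(damped ξ * t))‖ = Real.exp (-t) := by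
  rw [Complex.norm_exp]
  congr 1
  simp [damped]

/-- Integration by parts: with z the symbol, the difference of the two integrands is the derivative
of e^{-zt} t^γ / Γ(γ+1), which vanishes at 0 because γ > 0 and at infinity because Re z = 1. -/
theorem damped_mul_realFourier_gammaKernel {γ : ℝ} (hγ : 0 < γ) (ξ : ℝ) :
    damped ξ * realFourier (gammaKernel (γ + 1)) ξ = realFourier (gammaKernel γ) ξ := by
  have hΓ := Real.Gamma_pos_of_pos hγ
  have hint : ∀ a : ℝ, 0 < a → IntegrableOn (fun t : ℝ => ((Real.Gamma a)⁻¹ : ℝ) *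
      (Complex.exp (-(damped ξ * t)) * ((t ^ (a - 1) : ℝ) : ℂ))) (Ioi 0) := by
    intro a ha
    refine Integrable.const_mul ?_ _
    refine (Real.GammaIntegral_convergent ha).mono' ?_ ?_
    · refine AEStronglyMeasurable.mul ?_ ?_
      · exact Continuous.aestronglyMeasurable (by fun_prop)
      · exact (Complex.measurable_ofReal.comp (measurable_id.pow_const _)).aestronglyMeasurable
    · refine (ae_restrict_iff' measurableSet_Ioi).2 (ae_of_all _ fun t ht => ?_)
      rw [norm_mul, norm_exp_damped, Complex.norm_real, Real.norm_of_nonneg]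
      exact Real.rpow_nonneg (le_of_lt ht) _
  have key := integral_Ioi_of_hasDerivAt_of_tendsto (a := 0) (m := 0)
    (f := fun t : ℝ => ((Real.Gamma (γ + 1))⁻¹ : ℝ) *
      (Complex.exp (-(damped ξ * t)) * ((t ^ γ : ℝ) : ℂ)))
    (f' := fun t : ℝ => ((Real.Gamma γ)⁻¹ : ℝ) *
        (Complex.exp (-(damped ξ * t)) * ((t ^ (γ - 1) : ℝ) : ℂ)) -
      damped ξ * (((Real.Gamma (γ + 1))⁻¹ : ℝ) *
        (Complex.exp (-(damped ξ * t)) * ((t ^ (γ + 1 - 1) : ℝ) : ℂ)))) ?_ ?_ ?_ ?_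
  · rw [integral_sub (hint γ hγ) ((hint (γ + 1) (by linarith)).const_mul _),
      integral_const_mul (damped ξ), ← realFourier_gammaKernel_eq_integral,
      ← realFourier_gammaKernel_eq_integral] at key
    simp only [Complex.ofReal_zero, Real.zero_rpow hγ.ne', mul_zero, sub_zero] at key
    exact (sub_eq_zero.1 key).symm
  · refine Continuous.continuousWithinAt ?_
    have : Continuous fun t : ℝ => t ^ γ := Real.continuous_rpow_const hγ.le
    fun_prop
  · intro t ht
    have ht0 : (0 : ℝ) < t := ht
    have h1 : HasDerivAt (fun t : ℝ => Complex.exp (-(damped ξ * t)))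
        (Complex.exp (-(damped ξ * t)) * (-(damped ξ))) t := by
      have h := (((hasDerivAt_id t).ofReal_comp).const_mul (damped ξ)).neg.cexp
      simpa using h
    have h2 : HasDerivAt (fun t : ℝ => ((t ^ γ : ℝ) : ℂ)) ((γ * t ^ (γ - 1) : ℝ) : ℂ) t :=
      (Real.hasDerivAt_rpow_const (Or.inl ht0.ne')).ofReal_comp
    have h3 := (h1.mul h2).const_mul (((Real.Gamma (γ + 1))⁻¹ : ℝ) : ℂ)
    convert! h3 using 1
    rw [Real.Gamma_add_one hγ.ne', show γ + 1 - 1 = γ by ring]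
    have h4 : ((Real.Gamma γ : ℝ) : ℂ) ≠ 0 := by exact_mod_cast hΓ.ne'
    have h5 : (γ : ℂ) ≠ 0 := by exact_mod_cast hγ.ne'
    push_cast
    field_simp
    ring
  · exact (hint γ hγ).sub ((hint (γ + 1) (by linarith)).const_mul _)
  · rw [show (0 : ℂ) = ((Real.Gamma (γ + 1))⁻¹ : ℝ) * 0 by simp]
    refine Tendsto.const_mul _ ?_
    rw [tendsto_zero_iff_norm_tendsto_zero]
    have h := tendsto_rpow_mul_exp_neg_mul_atTop_nhds_zero γ 1 one_pos
    refine h.congr' ?_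
    filter_upwards [eventually_gt_atTop 0] with t ht
    rw [norm_mul, norm_exp_damped, Complex.norm_real, Real.norm_of_nonneg (by positivity)]
    rw [mul_comm]; simp

theorem hasDerivAt_realFourier_gammaKernel {γ : ℝ} (hγ : 0 < γ) (ξ : ℝ) :
    HasDerivAt (realFourier (gammaKernel γ))
      (-(2 * Real.pi : ℝ) * Complex.I * γ * realFourier (gammaKernel (γ + 1)) ξ) ξ := by
  have h := Real.hasDerivAt_fourier (f := fun t => (gammaKernel γ t : ℂ))
    (integrable_gammaKernel hγ).ofReal ?_ ξ
  · refine h.congr_deriv ?_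
    have : (fun x : ℝ => (-2 * (Real.pi : ℂ) * Complex.I * (x : ℂ)) • (gammaKernel γ x : ℂ)) =
        fun x : ℝ => (-2 * (Real.pi : ℂ) * Complex.I * γ) • (gammaKernel (γ + 1) x : ℂ) := by
      funext x
      have := congrArg (fun y : ℝ => (y : ℂ)) (mul_gammaKernel hγ x)
      push_cast at this
      simp only [smul_eq_mul]
      linear_combination (-2 * (Real.pi : ℂ) * Complex.I) * this
    rw [this, realFourier, Real.fourier_eq, Real.fourier_eq]
    simp_rw [smul_comm _ (-2 * (Real.pi : ℂ) * Complex.I * γ)]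
    rw [integral_smul]
    simp [smul_eq_mul]
  · have : (fun x : ℝ => x • (gammaKernel γ x : ℂ)) =
        fun x : ℝ => ((γ * gammaKernel (γ + 1) x : ℝ) : ℂ) := by
      funext x
      rw [← mul_gammaKernel hγ]
      simp
    rw [this]
    exact ((integrable_gammaKernel (by linarith : (0 : ℝ) < γ + 1)).const_mul γ).ofReal

/-- The derivative formula and the relation between the indices γ and γ+1 together say that z^γ
times the transform has zero derivative in ξ. Its constant value is found at ξ = 0, where z = 1 and
the transform is the total mass 1. This replaces a contour integral for the Gamma function. -/
theorem realFourier_gammaKernel {γ : ℝ} (hγ : 0 < γ) (ξ : ℝ) :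
    realFourier (gammaKernel γ) ξ = damped ξ ^ (-(γ : ℂ)) := by
  have hd : ∀ ξ, HasDerivAt (fun ξ => damped ξ ^ (γ : ℂ) * realFourier (gammaKernel γ) ξ) 0 ξ := by
    intro ξ
    have h1 : HasDerivAt (fun ξ => damped ξ ^ (γ : ℂ))
        ((γ : ℂ) * damped ξ ^ ((γ : ℂ) - 1) * ((2 * Real.pi : ℝ) * Complex.I)) ξ :=
      by
      have h := ((hasDerivAt_id (damped ξ)).cpow_const (c := (γ : ℂ))
        (damped_mem_slitPlane ξ)).comp ξ (hasDerivAt_damped ξ)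
      exact h.congr_deriv (by simp)
    convert! h1.mul (hasDerivAt_realFourier_gammaKernel hγ ξ) using 1
    rw [← damped_mul_realFourier_gammaKernel hγ, Complex.cpow_sub _ _ (damped_ne_zero ξ),
      Complex.cpow_one]
    have := damped_ne_zero ξ
    field_simp
    push_cast
    ring
  have h0 := is_const_of_deriv_eq_zero (fun ξ => (hd ξ).differentiableAt)
    (fun ξ => (hd ξ).deriv) ξ 0
  have h1 : realFourier (gammaKernel γ) 0 = 1 := by
    rw [realFourier, Real.fourier_eq]
    simp only [inner_zero_right, neg_zero, AddChar.map_zero_eq_one, one_smul]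
    have e : ∫ v, (gammaKernel γ v : ℂ) = ((∫ v, gammaKernel γ v : ℝ) : ℂ) := integral_ofReal
    rw [e, integral_gammaKernel hγ, Complex.ofReal_one]
  have h2 : damped 0 = 1 := by simp [damped]
  rw [h1, h2, Complex.one_cpow, mul_one] at h0
  rw [Complex.cpow_neg]
  exact eq_inv_of_mul_eq_one_right h0

end GammaKernel

/-! ## The damped fractional integral on the line -/

theorem sq_lintegral_mul_le {Z : Type*} [MeasurableSpace Z] {μ : Measure Z} {f g : Z → ℝ≥0∞}
    (hf : AEMeasurable f μ) (hg : AEMeasurable g μ) :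
    (∫⁻ z, f z * g z ∂μ) ^ 2 ≤ (∫⁻ z, f z ^ 2 ∂μ) * ∫⁻ z, g z ^ 2 ∂μ := by
  have h := ENNReal.lintegral_mul_le_Lp_mul_Lq μ Real.HolderConjugate.two_two hf hg
  have h2 := pow_le_pow_left' h 2
  rw [mul_pow, ← ENNReal.rpow_natCast (_ ^ (1 / 2 : ℝ)), ← ENNReal.rpow_mul,
    ← ENNReal.rpow_natCast (_ ^ (1 / 2 : ℝ)), ← ENNReal.rpow_mul] at h2
  simpa using h2

/-- Cauchy–Schwarz with the weight split as k^{1/2} · k^{1/2}; for k of mass one it is Jensen's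
inequality for the square. -/
theorem sq_lintegral_weight_mul_le {Z : Type*} [MeasurableSpace Z] {μ : Measure Z}
    {k g : Z → ℝ≥0∞} (hk : AEMeasurable k μ) (hg : AEMeasurable g μ) :
    (∫⁻ z, k z * g z ∂μ) ^ 2 ≤ (∫⁻ z, k z ∂μ) * ∫⁻ z, k z * g z ^ 2 ∂μ := by
  have hs : ∀ x : ℝ≥0∞, x ^ (1 / 2 : ℝ) * x ^ (1 / 2 : ℝ) = x := fun x => by
    rw [← ENNReal.rpow_add_of_nonneg _ _ (by norm_num) (by norm_num)]; norm_num
  have h := sq_lintegral_mul_le (hk.pow_const (1 / 2 : ℝ)) ((hk.pow_const (1 / 2 : ℝ)).mul hg)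
  have e : ∀ x y : ℝ≥0∞, (x ^ (1 / 2 : ℝ) * y) ^ 2 = x * y ^ 2 := fun x y => by
    rw [mul_pow, pow_two (x ^ _), hs]
  simpa only [Pi.mul_apply, ← mul_assoc, hs, e, pow_two (_ ^ (1 / 2 : ℝ))] using h

section ExpInt

variable {X : Type*} [NormedAddCommGroup X] [NormedSpace ℝ X]

/-- The convolution of `G` with the kernel `e^{-t} t^{γ-1} / Γ(γ)`. -/
def expInt (γ : ℝ) (G : ℝ → X) (t : ℝ) : X := ∫ s, gammaKernel γ (t - s) • G s

open scoped Convolution in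
theorem expInt_eq_convolution (γ : ℝ) (G : ℝ → X) :
    expInt γ G = (gammaKernel γ) ⋆[ContinuousLinearMap.lsmul ℝ ℝ, volume] G := by
  funext t
  rw [convolution_lsmul_swap]
  rfl

theorem integrable_expInt {γ : ℝ} (hγ : 0 < γ) {G : ℝ → X} (hG : Integrable G) :
    Integrable (expInt γ G) := by
  rw [expInt_eq_convolution]
  exact (integrable_gammaKernel hγ).integrable_convolution _ hG

theorem ae_integrable_expInt {γ : ℝ} (hγ : 0 < γ) {G : ℝ → X} (hG : Integrable G) :
    ∀ᵐ t, Integrable (fun s => gammaKernel γ (t - s) • G s) := by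
  filter_upwards [(integrable_gammaKernel hγ).ae_convolution_exists
    (ContinuousLinearMap.lsmul ℝ ℝ) hG] with t ht
  exact ht.integrable_swap

/-- Causality: the kernel vanishes on the negative half-line, so only the past of t matters. -/
theorem expInt_congr {γ t : ℝ} {G H : ℝ → X} (h : ∀ᵐ s, s < t → G s = H s) :
    expInt γ G t = expInt γ H t := by
  refine integral_congr_ae ?_
  filter_upwards [h] with s hs
  rcases lt_or_ge s t with h1 | h1
  · rw [hs h1]
  · rw [gammaKernel_of_nonpos _ (by linarith)]; simp

theorem enorm_expInt_le {γ : ℝ} (hγ : 0 < γ) (G : ℝ → X) (t : ℝ) :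
    ‖expInt γ G t‖ₑ ≤ ∫⁻ s, ENNReal.ofReal (gammaKernel γ (t - s)) * ‖G s‖ₑ := by
  refine (enorm_integral_le_lintegral_enorm _).trans (lintegral_mono fun s => ?_)
  rw [enorm_smul, Real.enorm_of_nonneg (gammaKernel_nonneg hγ _)]

end ExpInt

theorem measurable_gammaKernel_sub (γ : ℝ) :
    Measurable fun p : ℝ × ℝ => ENNReal.ofReal (gammaKernel γ (p.1 - p.2)) :=
  ((measurable_gammaKernel γ).comp (measurable_fst.sub measurable_snd)).ennreal_ofReal

/-- Young's inequality for a kernel of mass one: Jensen in s for fixed t, then Tonelli. -/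
theorem lintegral_gammaKernel_conv_sq_le {γ : ℝ} (hγ : 0 < γ) {g : ℝ → ℝ≥0∞} (hg : AEMeasurable g) :
    ∫⁻ t, (∫⁻ s, ENNReal.ofReal (gammaKernel γ (t - s)) * g s) ^ 2 ≤ ∫⁻ t, g t ^ 2 := by
  have hk := measurable_gammaKernel_sub γ
  have hkt : ∀ t, Measurable fun s => ENNReal.ofReal (gammaKernel γ (t - s)) := fun t =>
    hk.comp measurable_prodMk_left
  have hks : ∀ s, Measurable fun t => ENNReal.ofReal (gammaKernel γ (t - s)) := fun s =>
    hk.comp measurable_prodMk_right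
  calc _ ≤ ∫⁻ t, ∫⁻ s, ENNReal.ofReal (gammaKernel γ (t - s)) * g s ^ 2 := by
        refine lintegral_mono fun t => ?_
        refine (sq_lintegral_weight_mul_le (hkt t).aemeasurable hg).trans (le_of_eq ?_)
        rw [lintegral_sub_left_eq_self (fun s => ENNReal.ofReal (gammaKernel γ s)) t,
          lintegral_gammaKernel hγ, one_mul]
    _ = ∫⁻ s, ∫⁻ t, ENNReal.ofReal (gammaKernel γ (t - s)) * g s ^ 2 := by
        refine lintegral_lintegral_swap ?_
        exact AEMeasurable.mul hk.aemeasurable (g := fun p : ℝ × ℝ => g p.2 ^ 2)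
          (hg.comp_snd.pow_const _)
    _ = ∫⁻ s, g s ^ 2 := by
        refine lintegral_congr fun s => ?_
        rw [lintegral_mul_const _ (hks s),
          lintegral_sub_right_eq_self (fun t => ENNReal.ofReal (gammaKernel γ t)) s,
          lintegral_gammaKernel hγ, one_mul]

section ExpInt

variable {X : Type*} [NormedAddCommGroup X] [NormedSpace ℝ X]

theorem lintegral_expInt_sq_le {γ : ℝ} (hγ : 0 < γ) {G : ℝ → X} (hG : AEStronglyMeasurable G) :
    ∫⁻ t, ‖expInt γ G t‖ₑ ^ 2 ≤ ∫⁻ t, ‖G t‖ₑ ^ 2 :=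
  (lintegral_mono fun t => pow_le_pow_left' (enorm_expInt_le hγ G t) 2).trans
    (lintegral_gammaKernel_conv_sq_le hγ hG.enorm)

end ExpInt

theorem memLp_two_of_lintegral_lt_top {Z E : Type*} [MeasurableSpace Z] {μ : Measure Z}
    [NormedAddCommGroup E] {g : Z → E} (hg : AEStronglyMeasurable g μ)
    (h : ∫⁻ z, ‖g z‖ₑ ^ 2 ∂μ < ⊤) : MemLp g 2 μ := by
  refine ⟨hg, ?_⟩
  rw [eLpNorm_lt_top_iff_lintegral_rpow_enorm_lt_top (by norm_num) (by norm_num)]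
  simpa using h

theorem lintegral_lt_top_of_memLp_two {Z E : Type*} [MeasurableSpace Z] {μ : Measure Z}
    [NormedAddCommGroup E] {g : Z → E} (hg : MemLp g 2 μ) : ∫⁻ z, ‖g z‖ₑ ^ 2 ∂μ < ⊤ := by
  have := (eLpNorm_lt_top_iff_lintegral_rpow_enorm_lt_top (by norm_num) (by norm_num)).1 hg.2
  simpa using this

namespace MemL12

variable {G H : ℝ → ℝ}

theorem expInt {γ : ℝ} (hγ : 0 < γ) (hG : MemL12 G) : MemL12 (expInt γ G) :=
  ⟨integrable_expInt hγ hG.int, memLp_two_of_lintegral_lt_top (integrable_expInt hγ hG.int).1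
    ((lintegral_expInt_sq_le hγ hG.int.1).trans_lt (lintegral_lt_top_of_memLp_two hG.mem))⟩

open scoped Convolution in
theorem realFourier_expInt {γ : ℝ} (hγ : 0 < γ) (hG : MemL12 G) (ξ : ℝ) :
    realFourier (_root_.expInt γ G) ξ = damped ξ ^ (-(γ : ℂ)) * realFourier G ξ := by
  rw [← realFourier_gammaKernel hγ]
  refine Eq.trans ?_ (Real.fourier_mul_convolution_eq (integrable_gammaKernel hγ).ofReal
    hG.int_complex ξ)
  rw [realFourier]
  refine congrArg (fun F : ℝ → ℂ => FourierTransform.fourier F ξ) (funext fun t => ?_)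
  rw [convolution_eq_swap, _root_.expInt]
  refine Eq.trans (integral_ofReal (𝕜 := ℂ)).symm ?_
  simp

/-- The semigroup law on the Fourier side is z^{-a} z^{-b} = z^{-(a+b)}; no Beta integral is needed.
-/
theorem expInt_add {a b : ℝ} (ha : 0 < a) (hb : 0 < b) (hG : MemL12 G) :
    _root_.expInt a (_root_.expInt b G) =ᵐ[volume] _root_.expInt (a + b) G := by
  refine ae_eq_of_realFourier_eq ((hG.expInt hb).expInt ha) (hG.expInt (by positivity))
    (ae_of_all _ fun ξ => ?_)
  rw [realFourier_expInt ha (hG.expInt hb), realFourier_expInt hb hG,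
    realFourier_expInt (by positivity) hG, ← mul_assoc, ← Complex.cpow_add _ _ (damped_ne_zero ξ)]
  push_cast
  ring_nf

end MemL12

theorem norm_damped_cpow (γ ξ : ℝ) : ‖damped ξ ^ (-(γ : ℂ))‖ = ‖damped ξ‖ ^ (-γ) := by
  rw [← Complex.ofReal_neg, Complex.norm_cpow_real]

/-- Since Re z = 1, the argument of z is at most π/2 in absolute value. So the argument of z^{-γ} is
at most γπ/2, and the cosine decreases on [0, π]. -/
theorem le_re_damped_cpow {γ : ℝ} (h0 : 0 ≤ γ) (h1 : γ ≤ 1) (ξ : ℝ) :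
    Real.cos (γ * (Real.pi / 2)) * ‖damped ξ‖ ^ (-γ) ≤ (damped ξ ^ (-(γ : ℂ))).re := by
  have hz := damped_ne_zero ξ
  rw [← Complex.ofReal_neg, Complex.cpow_def_of_ne_zero hz, Complex.exp_re]
  have e1 : (Complex.log (damped ξ) * ((-γ : ℝ) : ℂ)).re = Real.log ‖damped ξ‖ * (-γ) := by
    rw [Complex.re_mul_ofReal, Complex.log_re]
  have e2 : (Complex.log (damped ξ) * ((-γ : ℝ) : ℂ)).im = -(γ * (damped ξ).arg) := by
    rw [Complex.im_mul_ofReal, Complex.log_im]; ring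
  rw [e1, e2, Real.cos_neg, ← Real.rpow_def_of_pos (norm_pos_iff.2 hz), mul_comm]
  gcongr
  have harg : |(damped ξ).arg| ≤ Real.pi / 2 :=
    Complex.abs_arg_le_pi_div_two_iff.2 (by rw [damped_re]; exact zero_le_one)
  rw [← Real.cos_abs (γ * (damped ξ).arg)]
  refine Real.cos_le_cos_of_nonneg_of_le_pi (abs_nonneg _) ?_ ?_
  · nlinarith [Real.pi_pos]
  · rw [abs_mul, abs_of_nonneg h0]
    gcongr

/-- The weighted integral `∫ |1 + 2πiξ|^{-γ} |Ĝ(ξ)|² dξ`. -/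
def dampedEnergy (γ : ℝ) (G : ℝ → ℝ) : ℝ := ∫ ξ, ‖damped ξ‖ ^ (-γ) * ‖realFourier G ξ‖ ^ 2

theorem dampedEnergy_nonneg (γ : ℝ) (G : ℝ → ℝ) : 0 ≤ dampedEnergy γ G :=
  integral_nonneg fun _ => by positivity

theorem measurable_norm_damped_rpow (γ : ℝ) : Measurable fun ξ => ‖damped ξ‖ ^ γ :=
  (continuous_damped.norm.measurable).pow_const _

namespace MemL12

variable {G H : ℝ → ℝ}

theorem integrable_dampedEnergy {γ : ℝ} (h0 : 0 ≤ γ) (hG : MemL12 G) :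
    Integrable fun ξ => ‖damped ξ‖ ^ (-γ) * ‖realFourier G ξ‖ ^ 2 := by
  refine Integrable.mono' (hG.realFourier_memLp.integrable_norm_pow (by norm_num)) ?_
    (ae_of_all _ fun ξ => ?_)
  · exact ((measurable_norm_damped_rpow _).mul
      ((hG.realFourier_continuous.norm.measurable).pow_const 2)).aestronglyMeasurable
  · rw [Real.norm_of_nonneg (by positivity)]
    exact mul_le_of_le_one_left (by positivity)
      (Real.rpow_le_one_of_one_le_of_nonpos (one_le_norm_damped ξ) (by linarith))

theorem integral_expInt_mul_eq {γ : ℝ} (hγ : 0 < γ) (hG : MemL12 G) (hH : MemL12 H) :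
    ((∫ t, _root_.expInt γ G t * H t : ℝ) : ℂ)
      = ∫ ξ, damped ξ ^ (-(γ : ℂ)) * (realFourier G ξ * starRingEnd ℂ (realFourier H ξ)) := by
  rw [← (hG.expInt hγ).parseval hH]
  simp_rw [hG.realFourier_expInt hγ, mul_assoc]

/-- By Parseval the left-over form is ∫ z^{-γ} |Ĝ|². It is real, so the integrand may be replaced by
its real part, to which the sector bound applies pointwise. -/
theorem coercive {γ : ℝ} (h0 : 0 < γ) (h1 : γ ≤ 1) (hG : MemL12 G) :
    Real.cos (γ * (Real.pi / 2)) * dampedEnergy γ G ≤ ∫ t, _root_.expInt γ G t * G t := by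
  have h := congrArg Complex.re (hG.integral_expInt_mul_eq h0 hG)
  rw [Complex.ofReal_re] at h
  have hint : Integrable fun ξ =>
      damped ξ ^ (-(γ : ℂ)) * (realFourier G ξ * starRingEnd ℂ (realFourier G ξ)) := by
    refine (hG.integrable_dampedEnergy h0.le).mono' ?_ (ae_of_all _ fun ξ => ?_)
    · refine (Measurable.mul ?_ ?_).aestronglyMeasurable
      · exact continuous_damped.measurable.pow_const _
      · exact hG.realFourier_continuous.measurable.mul
          (Complex.continuous_conj.comp hG.realFourier_continuous).measurable
    · rw [norm_mul, norm_damped_cpow, norm_mul, RCLike.norm_conj, pow_two]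
  rw [h, dampedEnergy, ← integral_const_mul]
  refine Eq.trans_ge (integral_re hint).symm ?_
  refine integral_mono ((hG.integrable_dampedEnergy h0.le).const_mul _) hint.re fun ξ => ?_
  simp only
  rw [Complex.mul_conj, Complex.normSq_eq_norm_sq, ← mul_assoc]
  refine (mul_le_mul_of_nonneg_right (le_re_damped_cpow h0.le h1 ξ) (by positivity)).trans ?_
  rw [RCLike.re_to_complex, Complex.re_mul_ofReal]

theorem ae_eq_zero_of_dampedEnergy {γ : ℝ} (h0 : 0 ≤ γ) (hG : MemL12 G)
    (h : dampedEnergy γ G ≤ 0) : G =ᵐ[volume] 0 := by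
  have h1 := (integral_eq_zero_iff_of_nonneg (fun ξ => by positivity)
    (hG.integrable_dampedEnergy h0)).1 (le_antisymm h (dampedEnergy_nonneg _ _))
  have hz : MemL12 (fun _ : ℝ => (0 : ℝ)) := ⟨integrable_zero _ _ _, MemLp.zero⟩
  refine hG.ae_eq_of_realFourier_eq hz ?_
  filter_upwards [h1] with ξ hξ
  have hpos : 0 < ‖damped ξ‖ ^ (-γ) := Real.rpow_pos_of_pos (norm_pos_iff.2 (damped_ne_zero ξ)) _
  have : realFourier G ξ = 0 := by simpa [hpos.ne'] using hξ
  rw [this, realFourier, Real.fourier_eq]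
  simp

end MemL12

/-! ## Gagliardo seminorms and the Fourier transform -/

theorem lintegral_of_even {f : ℝ → ℝ≥0∞} (hf : ∀ x, f (-x) = f x) :
    ∫⁻ x, f x = 2 * ∫⁻ x in Ioi 0, f x := by
  have h := (Measure.measurePreserving_neg (volume : Measure ℝ)).setLIntegral_comp_preimage_emb
    (MeasurableEquiv.neg ℝ).measurableEmbedding f (Ioi 0)
  have h2 : Neg.neg ⁻¹' (Ioi (0 : ℝ)) = Iio 0 := by ext; simp
  rw [h2] at h
  simp only [hf] at h
  rw [← lintegral_add_compl f (measurableSet_Ioi (a := (0 : ℝ))), compl_Ioi,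
    setLIntegral_congr Iio_ae_eq_Iic.symm, h, two_mul]

/-- `|e^{2πih} - 1|² / |h|^{1+2s}` -/
def gagliardoMultiplier (s h : ℝ) : ℝ≥0∞ :=
  ‖Complex.exp ((2 * Real.pi * h : ℝ) * Complex.I) - 1‖ₑ ^ 2 / ENNReal.ofReal (|h| ^ (1 + 2 * s))

/-- The constant `∫ |e^{2πih} - 1|² / |h|^{1+2s} dh`. -/
def gagliardoConst (s : ℝ) : ℝ≥0∞ := ∫⁻ h, gagliardoMultiplier s h

theorem measurable_gagliardoMultiplier (s : ℝ) : Measurable (gagliardoMultiplier s) := by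
  unfold gagliardoMultiplier
  refine Measurable.div ?_ ?_
  · exact (Continuous.measurable (by fun_prop)).enorm.pow_const 2
  · exact (measurable_norm.pow_const _).ennreal_ofReal

theorem ofReal_mul_rpow_le_div {x : ℝ≥0∞} {a p : ℝ} (ha : 0 < a) :
    x / ENNReal.ofReal (a ^ p) = x * ENNReal.ofReal (a ^ (-p)) := by
  rw [div_eq_mul_inv, ← ENNReal.ofReal_inv_of_pos (Real.rpow_pos_of_pos ha p),
    Real.rpow_neg ha.le]

/-- From |e^{ix} - 1| ≤ |x|; the resulting power is integrable at 0 when s < 1. -/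
theorem gagliardoMultiplier_le_small (s : ℝ) {h : ℝ} (hh : 0 < h) :
    gagliardoMultiplier s h ≤ ENNReal.ofReal ((2 * Real.pi) ^ 2 * h ^ (1 - 2 * s)) := by
  rw [gagliardoMultiplier, abs_of_pos hh, ofReal_mul_rpow_le_div hh]
  have h1 : ‖Complex.exp ((2 * Real.pi * h : ℝ) * Complex.I) - 1‖ₑ ≤
      ENNReal.ofReal (2 * Real.pi * h) := by
    have := Real.enorm_exp_I_mul_ofReal_sub_one_le (x := 2 * Real.pi * h)
    rw [mul_comm, ← Real.enorm_of_nonneg (by positivity)]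
    simpa using this
  calc _ ≤ ENNReal.ofReal (2 * Real.pi * h) ^ 2 * ENNReal.ofReal (h ^ (-(1 + 2 * s))) := by gcongr
    _ = _ := by
      rw [← ENNReal.ofReal_pow (by positivity), ← ENNReal.ofReal_mul (by positivity)]
      congr 1
      rw [mul_pow, mul_assoc, show h ^ 2 = h ^ (2 : ℝ) by norm_cast, ← Real.rpow_add hh]
      congr 2
      ring

/-- From |e^{ix} - 1| ≤ 2; the resulting power is integrable at infinity when s > 0. -/
theorem gagliardoMultiplier_le_large (s : ℝ) {h : ℝ} (hh : 0 < h) :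
    gagliardoMultiplier s h ≤ ENNReal.ofReal (4 * h ^ (-(1 + 2 * s))) := by
  rw [gagliardoMultiplier, abs_of_pos hh, ofReal_mul_rpow_le_div hh,
    ENNReal.ofReal_mul (by norm_num)]
  gcongr
  have h1 : ‖Complex.exp ((2 * Real.pi * h : ℝ) * Complex.I) - 1‖ ≤ 2 := by
    refine (norm_sub_le _ _).trans ?_
    rw [Complex.norm_exp_ofReal_mul_I, norm_one]; norm_num
  rw [← ofReal_norm, ← ENNReal.ofReal_pow (norm_nonneg _)]
  refine ENNReal.ofReal_le_ofReal ((pow_le_pow_left₀ (norm_nonneg _) h1 2).trans ?_)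
  norm_num

theorem gagliardoMultiplier_neg (s h : ℝ) : gagliardoMultiplier s (-h) = gagliardoMultiplier s h := by
  rw [gagliardoMultiplier, gagliardoMultiplier, abs_neg]
  congr 2
  have e : Complex.exp ((2 * Real.pi * (-h) : ℝ) * Complex.I) - 1 =
      starRingEnd ℂ (Complex.exp ((2 * Real.pi * h : ℝ) * Complex.I) - 1) := by
    rw [map_sub, map_one, ← Complex.exp_conj, map_mul, Complex.conj_ofReal, Complex.conj_I]
    push_cast
    ring_nf
  rw [e, ← ofReal_norm, RCLike.norm_conj, ofReal_norm]

theorem gagliardoConst_lt_top {s : ℝ} (h0 : 0 < s) (h1 : s < 1) : gagliardoConst s < ⊤ := by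
  rw [gagliardoConst, lintegral_of_even (gagliardoMultiplier_neg s)]
  refine ENNReal.mul_lt_top (by simp) ?_
  rw [← Ioc_union_Ioi_eq_Ioi (zero_le_one (α := ℝ))]
  refine (lintegral_union_le _ _ _).trans_lt (ENNReal.add_lt_top.2 ⟨?_, ?_⟩)
  · refine (setLIntegral_mono' measurableSet_Ioc fun h hh =>
      gagliardoMultiplier_le_small s hh.1).trans_lt ?_
    refine IntegrableOn.setLIntegral_lt_top ?_
    refine Integrable.const_mul ?_ _
    rw [← IntegrableOn, integrableOn_Ioc_iff_integrableOn_Ioo,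
      intervalIntegral.integrableOn_Ioo_rpow_iff one_pos]
    linarith
  · refine (setLIntegral_mono' measurableSet_Ioi fun h hh =>
      gagliardoMultiplier_le_large s (zero_lt_one.trans hh)).trans_lt ?_
    refine IntegrableOn.setLIntegral_lt_top ?_
    exact Integrable.const_mul (integrableOn_Ioi_rpow_of_lt (by linarith) one_pos) _

/-- The multiplier vanishes inside (0,1) nowhere, because e^{2πih} = 1 forces h to be an integer.
Non-vanishing allows division by the constant, which recovers Fourier weights from the Gagliardo
seminorm. -/
theorem gagliardoConst_ne_zero (s : ℝ) : gagliardoConst s ≠ 0 := by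
  rw [gagliardoConst, Ne, lintegral_eq_zero_iff (measurable_gagliardoMultiplier s)]
  intro h
  have h2 : ∀ᵐ x : ℝ, x ∉ Ioo (0 : ℝ) 1 := by
    filter_upwards [h] with x hx hx1
    simp only [gagliardoMultiplier, Pi.zero_apply, ENNReal.div_eq_zero_iff, ENNReal.ofReal_ne_top,
      or_false, ne_eq, OfNat.ofNat_ne_zero, not_false_eq_true, pow_eq_zero_iff, enorm_eq_zero] at hx
    rw [sub_eq_zero, Complex.exp_eq_one_iff] at hx
    obtain ⟨n, hn⟩ := hx
    have h3 := congrArg Complex.im hn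
    simp at h3
    have h4 : x = n := by
      have := Real.pi_pos
      nlinarith
    rw [h4] at hx1
    have h5 : (0 : ℤ) < n := by exact_mod_cast hx1.1
    have h6 : n < (1 : ℤ) := by exact_mod_cast hx1.2
    omega
  have h3 : volume (Ioo (0 : ℝ) 1) = 0 := by
    rw [ae_iff] at h2
    simpa only [not_not, ofPred_mem_eq] using h2
  simp at h3

theorem lintegral_comp_mul_left_real {f : ℝ → ℝ≥0∞} (hf : Measurable f) {a : ℝ} (ha : a ≠ 0) :
    ∫⁻ x, f (a * x) = ENNReal.ofReal |a⁻¹| * ∫⁻ x, f x := by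
  rw [← lintegral_map hf (measurable_const_mul a), Real.map_volume_mul_left ha,
    lintegral_smul_measure, smul_eq_mul]

/-- Homogeneity: the substitution h ↦ ξh produces the factor |ξ|^{1+2s} from the denominator and
|ξ|^{-1} from the measure. -/
theorem lintegral_gagliardoMultiplier_scaled {s : ℝ} (ξ : ℝ) (hξ : ξ ≠ 0) :
    ∫⁻ h, ‖Complex.exp ((2 * Real.pi * (h * ξ) : ℝ) * Complex.I) - 1‖ₑ ^ 2 /
      ENNReal.ofReal (|h| ^ (1 + 2 * s)) = ENNReal.ofReal (|ξ| ^ (2 * s)) * gagliardoConst s := by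
  have hξ' : 0 < |ξ| := abs_pos.2 hξ
  have h1 : ∀ h : ℝ, ‖Complex.exp ((2 * Real.pi * (h * ξ) : ℝ) * Complex.I) - 1‖ₑ ^ 2 /
      ENNReal.ofReal (|h| ^ (1 + 2 * s)) =
      ENNReal.ofReal (|ξ| ^ (1 + 2 * s)) * gagliardoMultiplier s (ξ * h) := by
    intro h
    have hp : 0 < |ξ| ^ (1 + 2 * s) := Real.rpow_pos_of_pos hξ' _
    rw [gagliardoMultiplier, abs_mul, Real.mul_rpow (abs_nonneg _) (abs_nonneg _), mul_comm h ξ,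
      ENNReal.ofReal_mul hp.le, ← mul_div_assoc, ENNReal.mul_div_mul_left]
    · simpa using hp
    · simp
  simp_rw [h1]
  have hm : Measurable fun h => gagliardoMultiplier s (ξ * h) :=
    (measurable_gagliardoMultiplier s).comp (measurable_const_mul ξ)
  rw [lintegral_const_mul _ hm,
    lintegral_comp_mul_left_real (measurable_gagliardoMultiplier s) hξ, ← mul_assoc,
    ← ENNReal.ofReal_mul (by positivity), gagliardoConst, abs_inv]
  congr 2
  rw [Real.rpow_add hξ', Real.rpow_one]
  field_simp

/-- The square of the Gagliardo seminorm on the set `A`. -/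
def gagliardo (s : ℝ) (A : Set ℝ) (V : ℝ → ℝ) : ℝ≥0∞ :=
  ∫⁻ t in A, ∫⁻ r in A, ‖V t - V r‖ₑ ^ 2 / ENNReal.ofReal (|t - r| ^ (1 + 2 * s))

theorem aemeasurable_gagliardo_integrand {V : ℝ → ℝ} {μ : Measure ℝ} [SFinite μ]
    (hV : AEStronglyMeasurable V μ) (s : ℝ) :
    AEMeasurable (fun p : ℝ × ℝ => ‖V p.1 - V p.2‖ₑ ^ 2 /
      ENNReal.ofReal (|p.1 - p.2| ^ (1 + 2 * s))) (μ.prod μ) := by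
  refine AEMeasurable.div ?_ ?_
  · exact ((hV.comp_fst.sub hV.comp_snd).enorm).pow_const 2
  · exact (((measurable_fst.sub measurable_snd).norm.pow_const _).ennreal_ofReal).aemeasurable

theorem gagliardo_univ_eq_translates {V : ℝ → ℝ} (hV : AEStronglyMeasurable V) (s : ℝ) :
    gagliardo s univ V =
      ∫⁻ h, (∫⁻ r, ‖V (r + h) - V r‖ₑ ^ 2) / ENNReal.ofReal (|h| ^ (1 + 2 * s)) := by
  rw [gagliardo, Measure.restrict_univ,
    lintegral_lintegral_swap (aemeasurable_gagliardo_integrand hV s)]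
  have e1 : ∀ r, ∫⁻ t, ‖V t - V r‖ₑ ^ 2 / ENNReal.ofReal (|t - r| ^ (1 + 2 * s)) =
      ∫⁻ h, ‖V (r + h) - V r‖ₑ ^ 2 / ENNReal.ofReal (|h| ^ (1 + 2 * s)) := by
    intro r
    rw [← lintegral_add_left_eq_self _ r]
    simp
  have hmp : AEStronglyMeasurable (fun p : ℝ × ℝ => V (p.1 + p.2)) (volume.prod volume) :=
    hV.comp_quasiMeasurePreserving (quasiMeasurePreserving_add volume volume)
  have hm1 : AEMeasurable (fun p : ℝ × ℝ => ‖V (p.1 + p.2) - V p.1‖ₑ ^ 2 /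
      ENNReal.ofReal (|p.2| ^ (1 + 2 * s))) (volume.prod volume) := by
    refine AEMeasurable.div ?_ ?_
    · exact ((hmp.sub hV.comp_fst).enorm).pow_const 2
    · exact ((measurable_snd.norm.pow_const _).ennreal_ofReal).aemeasurable
  rw [lintegral_congr e1, lintegral_lintegral_swap hm1]
  refine lintegral_congr fun h => ?_
  have hm2 : AEMeasurable (fun r => ‖V (r + h) - V r‖ₑ ^ 2) volume :=
    (((hV.comp_measurePreserving (measurePreserving_add_right volume h)).sub hV).enorm).pow_const 2
  simp_rw [div_eq_mul_inv]
  exact lintegral_mul_const'' _ hm2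

theorem MemL12.lintegral_translate_sub_sq {V : ℝ → ℝ} (hV : MemL12 V) (h : ℝ) :
    ∫⁻ r, ‖V (r + h) - V r‖ₑ ^ 2 = ∫⁻ ξ,
      ‖Complex.exp ((2 * Real.pi * (h * ξ) : ℝ) * Complex.I) - 1‖ₑ ^ 2 *
        ‖realFourier V ξ‖ₑ ^ 2 := by
  rw [← ((hV.comp_add_right h).sub hV).plancherel]
  refine lintegral_congr fun ξ => ?_
  rw [(hV.comp_add_right h).realFourier_sub hV, realFourier_comp_add_right, ← sub_one_mul,
    enorm_mul, mul_pow]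

/-- The seminorm is an integral over h of squared norms of V(· + h) - V. Plancherel turns each into
|e^{2πihξ} - 1|² against |V̂|², and Tonelli with scaling performs the h-integral. -/
theorem MemL12.gagliardo_univ_eq {V : ℝ → ℝ} (hV : MemL12 V) (s : ℝ) :
    gagliardo s univ V = gagliardoConst s *
      ∫⁻ ξ, ENNReal.ofReal (|ξ| ^ (2 * s)) * ‖realFourier V ξ‖ₑ ^ 2 := by
  have hF : Measurable fun ξ => ‖realFourier V ξ‖ₑ ^ 2 :=
    (hV.realFourier_continuous.measurable.enorm).pow_const 2
  have hn : Measurable (fun p : ℝ × ℝ =>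
      ‖Complex.exp ((2 * Real.pi * (p.1 * p.2) : ℝ) * Complex.I) - 1‖ₑ ^ 2) :=
    ((Continuous.measurable (by fun_prop)).enorm).pow_const 2
  have hm : Measurable (fun p : ℝ × ℝ =>
      ‖Complex.exp ((2 * Real.pi * (p.1 * p.2) : ℝ) * Complex.I) - 1‖ₑ ^ 2 /
        ENNReal.ofReal (|p.1| ^ (1 + 2 * s))) :=
    hn.div (measurable_fst.norm.pow_const _).ennreal_ofReal
  have e : ∀ h, (∫⁻ r, ‖V (r + h) - V r‖ₑ ^ 2) / ENNReal.ofReal (|h| ^ (1 + 2 * s)) =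
      ∫⁻ ξ, ‖Complex.exp ((2 * Real.pi * (h * ξ) : ℝ) * Complex.I) - 1‖ₑ ^ 2 /
        ENNReal.ofReal (|h| ^ (1 + 2 * s)) * ‖realFourier V ξ‖ₑ ^ 2 := by
    intro h
    have hm0 : Measurable fun ξ : ℝ =>
        ‖Complex.exp ((2 * Real.pi * (h * ξ) : ℝ) * Complex.I) - 1‖ₑ ^ 2 *
          ‖realFourier V ξ‖ₑ ^ 2 :=
      (hn.comp (measurable_prodMk_left (x := h))).mul hF
    rw [hV.lintegral_translate_sub_sq, div_eq_mul_inv, ← lintegral_mul_const _ hm0]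
    refine lintegral_congr fun ξ => ?_
    rw [div_eq_mul_inv, mul_right_comm]
  have hm3 : Measurable fun p : ℝ × ℝ =>
      ‖Complex.exp ((2 * Real.pi * (p.1 * p.2) : ℝ) * Complex.I) - 1‖ₑ ^ 2 /
        ENNReal.ofReal (|p.1| ^ (1 + 2 * s)) * ‖realFourier V p.2‖ₑ ^ 2 :=
    hm.mul (hF.comp measurable_snd)
  have hm4 : Measurable fun ξ : ℝ => ENNReal.ofReal (|ξ| ^ (2 * s)) * ‖realFourier V ξ‖ₑ ^ 2 :=
    ((measurable_norm.pow_const _).ennreal_ofReal).mul hF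
  rw [gagliardo_univ_eq_translates hV.mem.1, lintegral_congr e,
    lintegral_lintegral_swap hm3.aemeasurable, ← lintegral_const_mul _ hm4]
  refine lintegral_congr_ae ?_
  have h0 : ∀ᵐ ξ : ℝ, ξ ≠ 0 := by simp [ae_iff, measure_singleton]
  filter_upwards [h0] with ξ hξ
  have hm2 : Measurable fun x : ℝ =>
      ‖Complex.exp ((2 * Real.pi * (x * ξ) : ℝ) * Complex.I) - 1‖ₑ ^ 2 /
        ENNReal.ofReal (|x| ^ (1 + 2 * s)) :=
    ((Continuous.measurable (by fun_prop)).enorm.pow_const 2).div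
      (measurable_norm.pow_const _).ennreal_ofReal
  rw [lintegral_mul_const _ hm2, lintegral_gagliardoMultiplier_scaled ξ hξ,
    mul_comm (ENNReal.ofReal _) (gagliardoConst s), mul_assoc]

theorem gagliardo_mono_set (s : ℝ) {A B : Set ℝ} (h : A ⊆ B) (V : ℝ → ℝ) :
    gagliardo s A V ≤ gagliardo s B V :=
  lintegral_mono' (Measure.restrict_mono h le_rfl) fun _ =>
    lintegral_mono' (Measure.restrict_mono h le_rfl) le_rfl

theorem gagliardo_congr (s : ℝ) {A : Set ℝ} {V W : ℝ → ℝ}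
    (h : V =ᵐ[volume.restrict A] W) : gagliardo s A V = gagliardo s A W := by
  refine lintegral_congr_ae ?_
  filter_upwards [h] with t ht
  refine lintegral_congr_ae ?_
  filter_upwards [h] with r hr
  rw [ht, hr]

/-! ## The fractional Hardy inequality -/

/-- Young's inequality with a free parameter: the coefficient of b must be allowed arbitrarily close
to 1 for the absorption in the Hardy inequality. -/
theorem enorm_sq_le_of_sub {η : ℝ} (hη : 0 < η) (a b : ℝ) :
    ‖a‖ₑ ^ 2 ≤ ENNReal.ofReal (1 + η) * ‖b‖ₑ ^ 2 + ENNReal.ofReal (1 + η⁻¹) * ‖a - b‖ₑ ^ 2 := by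
  have hp : 0 < η⁻¹ := inv_pos.2 hη
  have key : a ^ 2 ≤ (1 + η) * b ^ 2 + (1 + η⁻¹) * (a - b) ^ 2 := by
    have : (1 + η) * b ^ 2 + (1 + η⁻¹) * (a - b) ^ 2 - a ^ 2 = η⁻¹ * (η * b - (a - b)) ^ 2 := by
      field_simp
      ring
    have h2 : 0 ≤ η⁻¹ * (η * b - (a - b)) ^ 2 := by positivity
    linarith
  have e : ∀ x : ℝ, ‖x‖ₑ ^ 2 = ENNReal.ofReal (x ^ 2) := fun x => by
    rw [← ofReal_norm, ← ENNReal.ofReal_pow (norm_nonneg _), Real.norm_eq_abs, sq_abs]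
  rw [e, e, e, ← ENNReal.ofReal_mul (by positivity), ← ENNReal.ofReal_mul (by positivity),
    ← ENNReal.ofReal_add (by positivity) (by positivity)]
  exact ENNReal.ofReal_le_ofReal key

theorem lintegral_Ioo_half_rpow {α r : ℝ} (h0 : 0 < α) (hr : 0 < r) :
    ∫⁻ t in Ioo (r / 2) r, ENNReal.ofReal (t ^ (-1 - α)) =
      ENNReal.ofReal ((2 ^ α - 1) / α * r ^ (-α)) := by
  have h1 : (0 : ℝ) ∉ uIcc (r / 2) r := by
    rw [uIcc_of_le (by linarith)]
    intro h
    linarith [h.1]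
  have hi : IntegrableOn (fun t : ℝ => t ^ (-1 - α)) (Ioo (r / 2) r) := by
    have := intervalIntegral.intervalIntegrable_rpow (μ := volume) (r := -1 - α) (Or.inr h1)
    rw [intervalIntegrable_iff_integrableOn_Ioo_of_le (by linarith)] at this
    exact this
  rw [← ofReal_integral_eq_lintegral_ofReal hi]
  · congr 1
    rw [← integral_Ioc_eq_integral_Ioo, ← intervalIntegral.integral_of_le (by linarith),
      integral_rpow (Or.inr ⟨by linarith, h1⟩), show -1 - α + 1 = -α by ring,
      Real.div_rpow hr.le (by norm_num), Real.rpow_neg (by norm_num : (0 : ℝ) ≤ 2)]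
    have := Real.rpow_pos_of_pos (by norm_num : (0 : ℝ) < 2) α
    field_simp
    ring
  · refine (ae_restrict_iff' measurableSet_Ioo).2 (ae_of_all _ fun t ht => ?_)
    have : 0 < t := by linarith [ht.1]
    simp only [Pi.zero_apply]
    positivity

/-- Strict Bernoulli, 2^α < 1 + α. This strictness is what makes the Hardy inequality for the
exponent α/2 < 1/2 work. -/
theorem hardyConst_lt_one {α : ℝ} (h0 : 0 < α) (h1 : α < 1) : ((2 : ℝ) ^ α - 1) / α < 1 := by
  rw [div_lt_one h0]
  have := rpow_one_add_lt_one_add_mul_self (s := 1) (by norm_num) (by norm_num) h0 h1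
  norm_num at this
  linarith

theorem hardyConst_pos {α : ℝ} (h0 : 0 < α) : 0 < ((2 : ℝ) ^ α - 1) / α := by
  have := Real.one_lt_rpow (by norm_num : (1 : ℝ) < 2) h0
  exact div_pos (by linarith) h0

theorem ennreal_absorb {H B : ℝ≥0∞} {θ : ℝ} (hθ : θ < 1) (h0 : 0 ≤ θ) (hH : H ≠ ⊤)
    (h : H ≤ B + ENNReal.ofReal θ * H) : H ≤ ENNReal.ofReal (1 - θ)⁻¹ * B := by
  have h1 : 0 < 1 - θ := by linarith
  have h2 : ENNReal.ofReal (1 - θ) * H + ENNReal.ofReal θ * H = H := by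
    rw [← add_mul, ← ENNReal.ofReal_add h1.le h0]; simp
  have h3 : ENNReal.ofReal (1 - θ) * H ≤ B := by
    refine (ENNReal.add_le_add_iff_right (a := ENNReal.ofReal θ * H)
      (ENNReal.mul_ne_top ENNReal.ofReal_ne_top hH)).1 ?_
    rw [h2]; exact h
  calc H = ENNReal.ofReal (1 - θ)⁻¹ * (ENNReal.ofReal (1 - θ) * H) := by
        rw [← mul_assoc, ← ENNReal.ofReal_mul (inv_nonneg.2 h1.le), inv_mul_cancel₀ h1.ne']; simp
    _ ≤ _ := by gcongr

section Hardy

variable {α T : ℝ} {v : ℝ → ℝ}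

/-- The value v(t) is compared with v(r) and averaged over r in (t, 2t), an interval of length t.
There |t - r| ≤ t, so the difference term is dominated by the Gagliardo kernel. The condition r < 2t
is recorded as t > r/2, ready for exchanging the integrals. -/
theorem hardy_averaged (h0 : 0 < α) (hv : Measurable v) {η ε t : ℝ} (hη : 0 < η) (hε : 0 < ε)
    (ht : t ∈ Ioo ε (T / 2)) :
    ‖v t‖ₑ ^ 2 * ENNReal.ofReal (t ^ (-α)) ≤
      ENNReal.ofReal (1 + η) * (∫⁻ r in Ioo ε T, (Ioo (r / 2) r).indicator
          (fun t => ENNReal.ofReal (t ^ (-1 - α))) t * ‖v r‖ₑ ^ 2) +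
      ENNReal.ofReal (1 + η⁻¹) *
        ∫⁻ r in Ioo 0 T, ‖v t - v r‖ₑ ^ 2 / ENNReal.ofReal (|t - r| ^ (1 + 2 * (α / 2))) := by
  have ht0 : 0 < t := hε.trans ht.1
  have ht2 : 2 * t < T := by linarith [ht.2]
  have hvol : volume (Ioo t (2 * t)) = ENNReal.ofReal t := by
    rw [Real.volume_Ioo]; congr 1; ring
  have h1 : ‖v t‖ₑ ^ 2 * ENNReal.ofReal (t ^ (-α)) =
      ∫⁻ _ in Ioo t (2 * t), ‖v t‖ₑ ^ 2 * ENNReal.ofReal (t ^ (-1 - α)) := by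
    rw [setLIntegral_const, hvol, mul_assoc, ← ENNReal.ofReal_mul (by positivity)]
    congr 2
    rw [← Real.rpow_add_one ht0.ne']; congr 1; ring
  have hm1 : Measurable fun r => ENNReal.ofReal (t ^ (-1 - α)) * ‖v r‖ₑ ^ 2 :=
    (hv.enorm.pow_const 2).const_mul _
  have hm2 : Measurable fun r => ENNReal.ofReal (t ^ (-1 - α)) * ‖v t - v r‖ₑ ^ 2 :=
    ((measurable_const.sub hv).enorm.pow_const 2).const_mul _
  calc _ = _ := h1
    _ ≤ ∫⁻ r in Ioo t (2 * t),
        (ENNReal.ofReal (1 + η) * (ENNReal.ofReal (t ^ (-1 - α)) * ‖v r‖ₑ ^ 2) +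
        ENNReal.ofReal (1 + η⁻¹) * (ENNReal.ofReal (t ^ (-1 - α)) * ‖v t - v r‖ₑ ^ 2)) := by
        refine lintegral_mono fun r => ?_
        refine (mul_le_mul_left (enorm_sq_le_of_sub hη (v t) (v r)) _).trans (le_of_eq ?_)
        ring
    _ = ENNReal.ofReal (1 + η) * (∫⁻ r in Ioo t (2 * t),
          ENNReal.ofReal (t ^ (-1 - α)) * ‖v r‖ₑ ^ 2) +
        ENNReal.ofReal (1 + η⁻¹) *
          ∫⁻ r in Ioo t (2 * t), ENNReal.ofReal (t ^ (-1 - α)) * ‖v t - v r‖ₑ ^ 2 := by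
        rw [lintegral_add_left (hm1.const_mul _), lintegral_const_mul _ hm1,
          lintegral_const_mul _ hm2]
    _ ≤ _ := by
        refine add_le_add (mul_le_mul_right ?_ _) (mul_le_mul_right ?_ _)
        · rw [← lintegral_indicator measurableSet_Ioo, ← lintegral_indicator measurableSet_Ioo]
          refine lintegral_mono fun r => ?_
          by_cases hr : r ∈ Ioo t (2 * t)
          · have hr1 : r ∈ Ioo ε T := ⟨ht.1.trans hr.1, hr.2.trans ht2⟩
            have hr2 : t ∈ Ioo (r / 2) r := ⟨by linarith [hr.2], hr.1⟩
            rw [indicator_of_mem hr, indicator_of_mem hr1, indicator_of_mem hr2]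
          · rw [indicator_of_notMem hr]; exact zero_le
        · refine (setLIntegral_mono' measurableSet_Ioo fun r hr => ?_).trans
            (lintegral_mono_set (fun r hr => ⟨ht0.trans hr.1, hr.2.trans ht2⟩))
          have hp : 0 < r - t := by linarith [hr.1]
          rw [abs_sub_comm, abs_of_pos hp, ofReal_mul_rpow_le_div hp, mul_comm]
          gcongr
          rw [show -(1 + 2 * (α / 2)) = -(1 + α) by ring, show -1 - α = -(1 + α) by ring]
          exact Real.rpow_le_rpow_of_nonpos hp (by linarith [hr.2]) (by linarith)

/-- For fixed r, the t-integral over (r/2, r) equals κ r^{-α} with κ = (2^α - 1)/α < 1, so the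
averaged term reproduces the Hardy integral with a factor below one. -/
theorem hardy_lintegral_swap (h0 : 0 < α) (hv : Measurable v) {ε : ℝ} (hε : 0 < ε) :
    ∫⁻ t, ∫⁻ r in Ioo ε T, (Ioo (r / 2) r).indicator
        (fun t => ENNReal.ofReal (t ^ (-1 - α))) t * ‖v r‖ₑ ^ 2 =
      ENNReal.ofReal ((2 ^ α - 1) / α) *
        ∫⁻ r in Ioo ε T, ‖v r‖ₑ ^ 2 * ENNReal.ofReal (r ^ (-α)) := by
  have hv2 : Measurable fun r => ‖v r‖ₑ ^ 2 := hv.enorm.pow_const 2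
  have hs : MeasurableSet {p : ℝ × ℝ | p.1 ∈ Ioo (p.2 / 2) p.2} :=
    MeasurableSet.inter (s₁ := {p : ℝ × ℝ | p.2 / 2 < p.1}) (s₂ := {p : ℝ × ℝ | p.1 < p.2})
      (measurableSet_lt (by fun_prop) (by fun_prop)) (measurableSet_lt (by fun_prop) (by fun_prop))
  have hm : Measurable fun p : ℝ × ℝ => (Ioo (p.2 / 2) p.2).indicator
      (fun t => ENNReal.ofReal (t ^ (-1 - α))) p.1 * ‖v p.2‖ₑ ^ 2 := by
    refine Measurable.mul ?_ (hv2.comp measurable_snd)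
    exact Measurable.indicator (f := fun p : ℝ × ℝ => ENNReal.ofReal (p.1 ^ (-1 - α)))
      ((measurable_fst.pow_const _).ennreal_ofReal) hs
  have hp : Measurable fun t : ℝ => ENNReal.ofReal (t ^ (-1 - α)) :=
    (measurable_id.pow_const _).ennreal_ofReal
  have hq : Measurable fun r : ℝ => ‖v r‖ₑ ^ 2 * ENNReal.ofReal (r ^ (-α)) :=
    hv2.mul (measurable_id.pow_const _).ennreal_ofReal
  rw [lintegral_lintegral_swap hm.aemeasurable, ← lintegral_const_mul _ hq]
  refine setLIntegral_congr_fun measurableSet_Ioo fun r hr => ?_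
  rw [lintegral_mul_const _ (hp.indicator measurableSet_Ioo), lintegral_indicator measurableSet_Ioo,
    lintegral_Ioo_half_rpow h0 (hε.trans hr.1), ENNReal.ofReal_mul (hardyConst_pos h0).le]
  ring

/-- The constant of the fractional Hardy inequality. -/
def hardyC (α T : ℝ) : ℝ≥0∞ :=
  ENNReal.ofReal (1 - (1 + (2 ^ α - 1) / α) / 2)⁻¹ * (ENNReal.ofReal ((T / 2) ^ (-α)) +
    ENNReal.ofReal (1 + ((1 - (2 ^ α - 1) / α) / (2 * ((2 ^ α - 1) / α)))⁻¹))

theorem hardyC_lt_top (α T : ℝ) : hardyC α T < ⊤ := by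
  unfold hardyC
  finiteness

/-- The averaging bound covers t < T/2 and returns the same integral with a factor smaller than one,
which is absorbed on the left. For t ≥ T/2 the weight is bounded by (T/2)^{-α}. -/
theorem hardy_truncated (h0 : 0 < α) (h1 : α < 1) (hT : 0 < T) (hv : Measurable v)
    (hA : ∫⁻ t in Ioo 0 T, ‖v t‖ₑ ^ 2 < ⊤) {ε : ℝ} (hε : 0 < ε) :
    ∫⁻ t in Ioo ε T, ‖v t‖ₑ ^ 2 * ENNReal.ofReal (t ^ (-α)) ≤
      hardyC α T * ((∫⁻ t in Ioo 0 T, ‖v t‖ₑ ^ 2) + gagliardo (α / 2) (Ioo 0 T) v) := by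
  set κ : ℝ := (2 ^ α - 1) / α with hκ
  have hκ0 : 0 < κ := hardyConst_pos h0
  have hκ1 : κ < 1 := hardyConst_lt_one h0 h1
  -- Chosen so that (1 + η) κ = (1 + κ)/2, the midpoint between κ and 1.
  set η : ℝ := (1 - κ) / (2 * κ) with hη
  have hη0 : 0 < η := div_pos (by linarith) (by linarith)
  set A := ∫⁻ t in Ioo 0 T, ‖v t‖ₑ ^ 2
  set S := gagliardo (α / 2) (Ioo 0 T) v with hS
  set H := ∫⁻ t in Ioo ε T, ‖v t‖ₑ ^ 2 * ENNReal.ofReal (t ^ (-α)) with hH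
  have hv2 : Measurable fun r => ‖v r‖ₑ ^ 2 := hv.enorm.pow_const 2
  have hbd : ∀ c : ℝ, 0 < c → ∀ s : Set ℝ, MeasurableSet s → s ⊆ Ioo 0 T → (∀ t ∈ s, c ≤ t) →
      ∫⁻ t in s, ‖v t‖ₑ ^ 2 * ENNReal.ofReal (t ^ (-α)) ≤ ENNReal.ofReal (c ^ (-α)) * A := by
    intro c hc s hs hsT hcs
    rw [← lintegral_const_mul _ hv2]
    refine (setLIntegral_mono' hs fun t ht => ?_).trans (lintegral_mono_set hsT)
    rw [mul_comm]
    gcongr ENNReal.ofReal ?_ * _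
    exact Real.rpow_le_rpow_of_nonpos hc (hcs t ht) (by linarith)
  -- Absorption is only legitimate for a finite quantity; this is the reason for cutting off at ε.
  have hHtop : H ≠ ⊤ := by
    refine ((hbd ε hε (Ioo ε T) measurableSet_Ioo (fun t ht => ⟨hε.trans ht.1, ht.2⟩)
      fun t ht => ht.1.le).trans_lt (ENNReal.mul_lt_top (by simp) hA)).ne
  have hsplit : H ≤ (∫⁻ t in Ioo ε (T / 2), ‖v t‖ₑ ^ 2 * ENNReal.ofReal (t ^ (-α))) +
      ENNReal.ofReal ((T / 2) ^ (-α)) * A := by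
    have hsub : Ioo ε T ⊆ Ioo ε (T / 2) ∪ (Ico (T / 2) T ∩ Ioo ε T) := fun t ht => by
      rcases lt_or_ge t (T / 2) with h | h
      · exact Or.inl ⟨ht.1, h⟩
      · exact Or.inr ⟨⟨h, ht.2⟩, ht⟩
    refine (lintegral_mono_set hsub).trans ((lintegral_union_le _ _ _).trans ?_)
    gcongr
    exact hbd (T / 2) (by linarith) _ (measurableSet_Ico.inter measurableSet_Ioo)
      (fun t ht => ⟨hε.trans ht.2.1, ht.2.2⟩) fun t ht => ht.1.1
  have hmS : Measurable fun t => ∫⁻ r in Ioo 0 T, ‖v t - v r‖ₑ ^ 2 /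
      ENNReal.ofReal (|t - r| ^ (1 + 2 * (α / 2))) := by
    refine Measurable.lintegral_prod_right' (f := fun p : ℝ × ℝ => ‖v p.1 - v p.2‖ₑ ^ 2 /
      ENNReal.ofReal (|p.1 - p.2| ^ (1 + 2 * (α / 2)))) ?_
    refine Measurable.div ?_ ?_
    · exact ((hv.comp measurable_fst).sub (hv.comp measurable_snd)).enorm.pow_const 2
    · exact (((measurable_fst.sub measurable_snd).norm.pow_const _).ennreal_ofReal)
  have hmain : ∫⁻ t in Ioo ε (T / 2), ‖v t‖ₑ ^ 2 * ENNReal.ofReal (t ^ (-α)) ≤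
      ENNReal.ofReal (1 + η) * (ENNReal.ofReal κ * H) + ENNReal.ofReal (1 + η⁻¹) * S := by
    refine (setLIntegral_mono' measurableSet_Ioo fun t ht =>
      hardy_averaged (T := T) h0 hv hη0 hε ht).trans ?_
    rw [lintegral_add_right _ (hmS.const_mul _), lintegral_const_mul _ hmS,
      lintegral_const_mul' _ _ ENNReal.ofReal_ne_top]
    refine add_le_add (mul_le_mul_right ?_ _) (mul_le_mul_right ?_ _)
    · rw [← hardy_lintegral_swap h0 hv hε]
      exact setLIntegral_le_lintegral _ _
    · exact lintegral_mono_set fun t ht => ⟨hε.trans ht.1, by linarith [ht.2]⟩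
  have hθ : (1 + η) * κ = (1 + κ) / 2 := by rw [hη]; field_simp; ring
  have hfin : H ≤ (ENNReal.ofReal ((T / 2) ^ (-α)) * A + ENNReal.ofReal (1 + η⁻¹) * S) +
      ENNReal.ofReal ((1 + κ) / 2) * H := by
    refine (hsplit.trans (add_le_add_left hmain _)).trans (le_of_eq ?_)
    rw [← mul_assoc, ← ENNReal.ofReal_mul (by linarith), hθ]
    ring
  refine (ennreal_absorb (by linarith) (by linarith) hHtop hfin).trans ?_
  rw [hardyC, mul_assoc]
  refine mul_le_mul_right ?_ _
  rw [add_mul]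
  gcongr
  · exact le_self_add
  · exact le_add_self

/-- The constant of the truncated inequality does not depend on ε, so monotone convergence along ε =
1/(n+1) removes the cut-off. -/
theorem hardy (h0 : 0 < α) (h1 : α < 1) (hT : 0 < T) (hv : Measurable v)
    (hA : ∫⁻ t in Ioo 0 T, ‖v t‖ₑ ^ 2 < ⊤) :
    ∫⁻ t in Ioo 0 T, ‖v t‖ₑ ^ 2 * ENNReal.ofReal (t ^ (-α)) ≤
      hardyC α T * ((∫⁻ t in Ioo 0 T, ‖v t‖ₑ ^ 2) + gagliardo (α / 2) (Ioo 0 T) v) := by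
  have hU : Ioo 0 T = ⋃ n : ℕ, Ioo (1 / ((n : ℝ) + 1)) T := by
    ext t
    simp only [mem_iUnion, mem_Ioo]
    constructor
    · rintro ⟨h, h'⟩
      obtain ⟨n, hn⟩ := exists_nat_one_div_lt h
      exact ⟨n, hn, h'⟩
    · rintro ⟨n, h, h'⟩
      exact ⟨lt_trans (by positivity) h, h'⟩
  have hdir : Directed (· ⊆ ·) fun n : ℕ => Ioo (1 / ((n : ℝ) + 1)) T := by
    refine Monotone.directed_le (f := fun n : ℕ => Ioo (1 / ((n : ℝ) + 1)) T) fun m n hmn => ?_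
    exact Ioo_subset_Ioo_left (Nat.one_div_le_one_div hmn)
  conv_lhs => rw [hU]
  rw [setLIntegral_iUnion_of_directed _ hdir]
  exact iSup_le fun n => hardy_truncated h0 h1 hT hv hA (by positivity)

end Hardy

/-! ## Reflection, multiplication and extension by zero -/

theorem setLIntegral_Ioo_reflect (T : ℝ) (f : ℝ → ℝ≥0∞) :
    ∫⁻ t in Ioo 0 T, f (T - t) = ∫⁻ t in Ioo 0 T, f t := by
  have h := (Measure.measurePreserving_sub_left (volume : Measure ℝ) T).setLIntegral_comp_preimage_emb
    (MeasurableEquiv.subLeft T).measurableEmbedding f (Ioo 0 T)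
  have h2 : (fun t => T - t) ⁻¹' (Ioo 0 T) = Ioo 0 T := by
    ext t; simp only [mem_preimage, mem_Ioo]; constructor <;> rintro ⟨h1, h2⟩ <;> constructor <;> linarith
  rwa [h2] at h

theorem gagliardo_reflect (s T : ℝ) (v : ℝ → ℝ) :
    gagliardo s (Ioo 0 T) (fun t => v (T - t)) = gagliardo s (Ioo 0 T) v := by
  rw [gagliardo, gagliardo, ← setLIntegral_Ioo_reflect]
  refine lintegral_congr fun t => ?_
  rw [← setLIntegral_Ioo_reflect]
  refine lintegral_congr fun r => ?_
  rw [abs_sub_comm]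
  simp

theorem hardy_right {α T : ℝ} {v : ℝ → ℝ} (h0 : 0 < α) (h1 : α < 1) (hT : 0 < T)
    (hv : Measurable v) (hA : ∫⁻ t in Ioo 0 T, ‖v t‖ₑ ^ 2 < ⊤) :
    ∫⁻ t in Ioo 0 T, ‖v t‖ₑ ^ 2 * ENNReal.ofReal ((T - t) ^ (-α)) ≤
      hardyC α T * ((∫⁻ t in Ioo 0 T, ‖v t‖ₑ ^ 2) + gagliardo (α / 2) (Ioo 0 T) v) := by
  have h := hardy (v := fun t => v (T - t)) h0 h1 hT (hv.comp (measurable_const.sub measurable_id))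
    (by rwa [setLIntegral_Ioo_reflect T (fun t => ‖v t‖ₑ ^ 2)])
  rw [gagliardo_reflect, setLIntegral_Ioo_reflect T (fun t => ‖v t‖ₑ ^ 2),
    ← setLIntegral_Ioo_reflect] at h
  simpa using h

/-- `∫_{-T}^T |h|^{1-2s} dh` -/
def multiplierConst (s T : ℝ) : ℝ≥0∞ := ∫⁻ h in Ioo (-T) T, ENNReal.ofReal (|h| ^ (1 - 2 * s))

theorem multiplierConst_lt_top {s T : ℝ} (hs : s < 1) (hT : 0 < T) : multiplierConst s T < ⊤ := by
  have e : multiplierConst s T = ∫⁻ h, (Ioo (-T) T).indicator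
      (fun h => ENNReal.ofReal (|h| ^ (1 - 2 * s))) h :=
    (lintegral_indicator measurableSet_Ioo _).symm
  rw [e, lintegral_of_even]
  · refine ENNReal.mul_lt_top (by simp) ?_
    have h2 : ∀ h ∈ Ioi (0 : ℝ), (Ioo (-T) T).indicator
        (fun h => ENNReal.ofReal (|h| ^ (1 - 2 * s))) h ≤
        (Ioo 0 T).indicator (fun h => ENNReal.ofReal (h ^ (1 - 2 * s))) h := by
      intro h hh
      have hh0 : 0 < h := hh
      by_cases hm : h ∈ Ioo (-T) T
      · have hm2 : h ∈ Ioo 0 T := ⟨hh0, hm.2⟩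
        rw [indicator_of_mem hm, indicator_of_mem hm2, abs_of_pos hh0]
      · rw [indicator_of_notMem hm]; exact zero_le
    refine (setLIntegral_mono' measurableSet_Ioi h2).trans_lt ?_
    refine (setLIntegral_le_lintegral _ _).trans_lt ?_
    rw [lintegral_indicator measurableSet_Ioo]
    refine IntegrableOn.setLIntegral_lt_top ?_
    rw [intervalIntegral.integrableOn_Ioo_rpow_iff hT]
    linarith
  · intro h
    by_cases hm : h ∈ Ioo (-T) T
    · have hm2 : -h ∈ Ioo (-T) T := ⟨by linarith [hm.2], by linarith [hm.1]⟩
      rw [indicator_of_mem hm, indicator_of_mem hm2, abs_neg]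
    · have hm2 : -h ∉ Ioo (-T) T := fun h' => hm ⟨by linarith [h'.2], by linarith [h'.1]⟩
      rw [indicator_of_notMem hm, indicator_of_notMem hm2]

theorem enorm_real_sq (x : ℝ) : ‖x‖ₑ ^ 2 = ENNReal.ofReal (x ^ 2) := by
  rw [← ofReal_norm, ← ENNReal.ofReal_pow (norm_nonneg _), Real.norm_eq_abs, sq_abs]

/-- Write m(t)v(t) - m(r)v(r) = m(t)(v(t) - v(r)) + (m(t) - m(r))v(r). The Lipschitz bound on m
lowers the singularity of the second term to |t - r|^{1-2s}, whose integral over all possible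
differences is `multiplierConst`. -/
theorem gagliardo_mul_le {s T M : ℝ} {m v : ℝ → ℝ} (hv : Measurable v)
    (hm : ∀ t ∈ Ioo 0 T, |m t| ≤ M) (hl : ∀ t ∈ Ioo 0 T, ∀ r ∈ Ioo 0 T, |m t - m r| ≤ M * |t - r|) :
    gagliardo s (Ioo 0 T) (fun t => m t * v t) ≤ ENNReal.ofReal (2 * M ^ 2) *
      (gagliardo s (Ioo 0 T) v + multiplierConst s T * ∫⁻ t in Ioo 0 T, ‖v t‖ₑ ^ 2) := by
  have hv2 : Measurable fun r => ‖v r‖ₑ ^ 2 := hv.enorm.pow_const 2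
  have key : ∀ t ∈ Ioo 0 T, ∀ r ∈ Ioo 0 T,
      ‖m t * v t - m r * v r‖ₑ ^ 2 / ENNReal.ofReal (|t - r| ^ (1 + 2 * s)) ≤
      ENNReal.ofReal (2 * M ^ 2) * (‖v t - v r‖ₑ ^ 2 / ENNReal.ofReal (|t - r| ^ (1 + 2 * s)) +
        ENNReal.ofReal (|t - r| ^ (1 - 2 * s)) * ‖v r‖ₑ ^ 2) := by
    intro t ht r hr
    rcases eq_or_ne t r with rfl | hne
    · simp
    have hp : 0 < |t - r| := abs_pos.2 (sub_ne_zero.2 hne)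
    have hreal : (m t * v t - m r * v r) ^ 2 ≤
        2 * M ^ 2 * ((v t - v r) ^ 2 + |t - r| ^ 2 * v r ^ 2) := by
      have e : m t * v t - m r * v r = m t * (v t - v r) + (m t - m r) * v r := by ring
      have h1 : (m t) ^ 2 ≤ M ^ 2 := sq_le_sq' (by linarith [neg_abs_le (m t), hm t ht])
        ((le_abs_self _).trans (hm t ht))
      have h2 : (m t - m r) ^ 2 ≤ M ^ 2 * |t - r| ^ 2 := by
        rw [← mul_pow]
        have := hl t ht r hr
        exact sq_le_sq' (by linarith [neg_abs_le (m t - m r)]) ((le_abs_self _).trans this)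
      rw [e]
      nlinarith [sq_nonneg (m t * (v t - v r) - (m t - m r) * v r),
        mul_le_mul_of_nonneg_right h1 (sq_nonneg (v t - v r)),
        mul_le_mul_of_nonneg_right h2 (sq_nonneg (v r))]
    rw [ofReal_mul_rpow_le_div hp, ofReal_mul_rpow_le_div hp, enorm_real_sq, enorm_real_sq,
      enorm_real_sq, ← ENNReal.ofReal_mul (sq_nonneg _), ← ENNReal.ofReal_mul (sq_nonneg _),
      ← ENNReal.ofReal_mul (by positivity), ← ENNReal.ofReal_add (by positivity) (by positivity),
      ← ENNReal.ofReal_mul (by positivity)]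
    refine ENNReal.ofReal_le_ofReal ?_
    refine (mul_le_mul_of_nonneg_right hreal (by positivity)).trans (le_of_eq ?_)
    rw [show 1 - 2 * s = (-(1 + 2 * s)) + 2 by ring, Real.rpow_add hp, Real.rpow_two]
    ring
  have hw : Measurable fun p : ℝ × ℝ => ENNReal.ofReal (|p.1 - p.2| ^ (1 - 2 * s)) * ‖v p.2‖ₑ ^ 2 :=
    (((measurable_fst.sub measurable_snd).norm.pow_const _).ennreal_ofReal).mul
      (hv2.comp measurable_snd)
  have hwt : ∀ t, Measurable fun r => ENNReal.ofReal (|t - r| ^ (1 - 2 * s)) * ‖v r‖ₑ ^ 2 :=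
    fun t => Measurable.mul (by fun_prop) hv2
  calc gagliardo s (Ioo 0 T) (fun t => m t * v t)
      ≤ ∫⁻ t in Ioo 0 T, ENNReal.ofReal (2 * M ^ 2) *
          ((∫⁻ r in Ioo 0 T, ‖v t - v r‖ₑ ^ 2 / ENNReal.ofReal (|t - r| ^ (1 + 2 * s))) +
          ∫⁻ r in Ioo 0 T, ENNReal.ofReal (|t - r| ^ (1 - 2 * s)) * ‖v r‖ₑ ^ 2) := by
        refine setLIntegral_mono' measurableSet_Ioo fun t ht => ?_
        refine (setLIntegral_mono' measurableSet_Ioo (key t ht)).trans ?_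
        rw [lintegral_const_mul' _ _ ENNReal.ofReal_ne_top, lintegral_add_right _ (hwt t)]
    _ = ENNReal.ofReal (2 * M ^ 2) * (gagliardo s (Ioo 0 T) v + ∫⁻ t in Ioo 0 T,
          ∫⁻ r in Ioo 0 T, ENNReal.ofReal (|t - r| ^ (1 - 2 * s)) * ‖v r‖ₑ ^ 2) := by
        rw [lintegral_const_mul' _ _ ENNReal.ofReal_ne_top,
          lintegral_add_right _ hw.lintegral_prod_right', gagliardo]
    _ ≤ _ := by
        refine mul_le_mul_right (add_le_add_right ?_ _) _
        rw [lintegral_lintegral_swap hw.aemeasurable, ← lintegral_const_mul _ hv2]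
        refine setLIntegral_mono' measurableSet_Ioo fun r hr => ?_
        have hr2 : Measurable fun t : ℝ => ENNReal.ofReal (|t - r| ^ (1 - 2 * s)) := by fun_prop
        rw [lintegral_mul_const _ hr2]
        refine mul_le_mul_left ?_ _
        rw [← lintegral_indicator measurableSet_Ioo, multiplierConst,
          ← lintegral_indicator measurableSet_Ioo, ← lintegral_add_right_eq_self _ r]
        refine lintegral_mono fun h => ?_
        by_cases hh : h + r ∈ Ioo 0 T
        · have h2 : h ∈ Ioo (-T) T := ⟨by linarith [hh.1, hr.2], by linarith [hh.2, hr.1]⟩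
          rw [indicator_of_mem hh, indicator_of_mem h2]
          simp
        · rw [indicator_of_notMem hh]; exact zero_le

theorem lintegral_Ici_rpow {α c : ℝ} (h0 : 0 < α) (hc : 0 < c) :
    ∫⁻ y in Ici c, ENNReal.ofReal (y ^ (-(1 + α))) = ENNReal.ofReal (c ^ (-α) / α) := by
  rw [setLIntegral_congr Ioi_ae_eq_Ici.symm,
    ← ofReal_integral_eq_lintegral_ofReal (integrableOn_Ioi_rpow_of_lt (by linarith) hc),
    integral_Ioi_rpow_of_lt (by linarith) hc]
  · congr 1
    rw [show -(1 + α) + 1 = -α by ring]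
    field_simp
  · refine (ae_restrict_iff' measurableSet_Ioi).2 (ae_of_all _ fun t ht => ?_)
    exact Real.rpow_nonneg (hc.le.trans (le_of_lt ht)) _

/-- The two half-lines outside the interval start at distances t and T - t from the point t; these
distances become the Hardy weights at the two ends. -/
theorem lintegral_compl_Ioo_le {α T t : ℝ} (h0 : 0 < α) (ht : t ∈ Ioo 0 T) :
    ∫⁻ r in (Ioo 0 T)ᶜ, (ENNReal.ofReal (|t - r| ^ (1 + α)))⁻¹ ≤
      ENNReal.ofReal α⁻¹ * (ENNReal.ofReal (t ^ (-α)) + ENNReal.ofReal ((T - t) ^ (-α))) := by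
  have hsub : (Ioo 0 T)ᶜ ⊆ Iic 0 ∪ Ici T := fun r hr => by
    by_contra h
    simp only [mem_union, mem_Iic, mem_Ici, not_or, not_le] at h
    exact hr h
  have key : ∀ c > 0, ∫⁻ y in Ici c, (ENNReal.ofReal (|y| ^ (1 + α)))⁻¹ =
      ENNReal.ofReal α⁻¹ * ENNReal.ofReal (c ^ (-α)) := by
    intro c hc
    rw [← ENNReal.ofReal_mul (by positivity), mul_comm, ← div_eq_mul_inv, ← lintegral_Ici_rpow h0 hc]
    refine setLIntegral_congr_fun measurableSet_Ici fun y hy => ?_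
    have hy0 : 0 < y := hc.trans_le hy
    rw [abs_of_pos hy0, ← one_div, ofReal_mul_rpow_le_div hy0, one_mul]
  refine (lintegral_mono_set hsub).trans ((lintegral_union_le _ _ _).trans ?_)
  rw [mul_add, ← key t ht.1, ← key (T - t) (by linarith [ht.2])]
  refine add_le_add (le_of_eq ?_) (le_of_eq ?_)
  · have h := (Measure.measurePreserving_sub_left (volume : Measure ℝ)
      t).setLIntegral_comp_preimage_emb (MeasurableEquiv.subLeft t).measurableEmbedding
      (fun y => (ENNReal.ofReal (|y| ^ (1 + α)))⁻¹) (Ici t)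
    have h2 : (fun r => t - r) ⁻¹' (Ici t) = Iic 0 := by
      ext r; simp
    rwa [h2] at h
  · have h := (measurePreserving_sub_right (volume : Measure ℝ)
      t).setLIntegral_comp_preimage_emb (MeasurableEquiv.subRight t).measurableEmbedding
      (fun y => (ENNReal.ofReal (|y| ^ (1 + α)))⁻¹) (Ici (T - t))
    have h2 : (fun r => r - t) ⁻¹' (Ici (T - t)) = Ici T := by
      ext r; simp
    rw [h2] at h
    rw [← h]
    simp_rw [abs_sub_comm]

/-- Split the plane into four products of the interval and its complement. Inside one finds the
original seminorm, outside zero, and the two mixed pieces agree by symmetry. In a mixed piece one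
value vanishes, so the kernel can be integrated over the complement. -/
theorem gagliardo_zeroExtension_le {α T : ℝ} {v : ℝ → ℝ} (h0 : 0 < α) (hv : Measurable v) :
    gagliardo (α / 2) univ ((Ioo 0 T).indicator v) ≤ gagliardo (α / 2) (Ioo 0 T) v +
      2 * (ENNReal.ofReal α⁻¹ * ((∫⁻ t in Ioo 0 T, ‖v t‖ₑ ^ 2 * ENNReal.ofReal (t ^ (-α))) +
        ∫⁻ t in Ioo 0 T, ‖v t‖ₑ ^ 2 * ENNReal.ofReal ((T - t) ^ (-α)))) := by
  set I := Ioo 0 T with hI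
  have hIm : MeasurableSet I := measurableSet_Ioo
  set F : ℝ → ℝ → ℝ≥0∞ := fun t r => ‖I.indicator v t - I.indicator v r‖ₑ ^ 2 /
    ENNReal.ofReal (|t - r| ^ (1 + 2 * (α / 2))) with hF
  have hFm : Measurable (Function.uncurry F) := by
    refine Measurable.div ?_ ?_
    · exact (((hv.indicator hIm).comp measurable_fst).sub
        ((hv.indicator hIm).comp measurable_snd)).enorm.pow_const 2
    · exact (((measurable_fst.sub measurable_snd).norm.pow_const _).ennreal_ofReal)
  have hFI : Measurable fun t => ∫⁻ r in I, F t r := hFm.lintegral_prod_right'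
  have hq : Measurable fun t : ℝ => ‖v t‖ₑ ^ 2 * ENNReal.ofReal (t ^ (-α)) :=
    (hv.enorm.pow_const 2).mul (measurable_id.pow_const _).ennreal_ofReal
  have hq' : Measurable fun t : ℝ => ‖v t‖ₑ ^ 2 * ENNReal.ofReal ((T - t) ^ (-α)) :=
    (hv.enorm.pow_const 2).mul ((measurable_const.sub measurable_id).pow_const _).ennreal_ofReal
  set Q := ENNReal.ofReal α⁻¹ * ((∫⁻ t in I, ‖v t‖ₑ ^ 2 * ENNReal.ofReal (t ^ (-α))) +
        ∫⁻ t in I, ‖v t‖ₑ ^ 2 * ENNReal.ofReal ((T - t) ^ (-α))) with hQ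
  have hcross : ∫⁻ t in I, ∫⁻ r in Iᶜ, F t r ≤ Q := by
    have hqq : Measurable fun t : ℝ => ‖v t‖ₑ ^ 2 * ENNReal.ofReal (t ^ (-α)) +
        ‖v t‖ₑ ^ 2 * ENNReal.ofReal ((T - t) ^ (-α)) := hq.add hq'
    rw [hQ, ← lintegral_add_left hq, ← lintegral_const_mul _ hqq]
    refine setLIntegral_mono' hIm fun t ht => ?_
    have e : ∫⁻ r in Iᶜ, F t r = ‖v t‖ₑ ^ 2 *
        ∫⁻ r in Iᶜ, (ENNReal.ofReal (|t - r| ^ (1 + α)))⁻¹ := by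
      rw [← lintegral_const_mul' _ _ (by finiteness)]
      refine setLIntegral_congr_fun hIm.compl fun r hr => ?_
      simp only [hF]
      rw [indicator_of_mem ht, indicator_of_notMem hr, sub_zero, div_eq_mul_inv]
      ring_nf
    rw [e]
    refine (mul_le_mul_right (lintegral_compl_Ioo_le h0 ht) _).trans (le_of_eq ?_)
    ring
  have hsymm : ∫⁻ t in Iᶜ, ∫⁻ r in I, F t r = ∫⁻ t in I, ∫⁻ r in Iᶜ, F t r := by
    rw [lintegral_lintegral_swap hFm.aemeasurable]
    refine lintegral_congr fun t => lintegral_congr fun r => ?_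
    simp only [hF]
    rw [abs_sub_comm, ← enorm_neg, neg_sub]
  have hzero : ∫⁻ t in Iᶜ, ∫⁻ r in Iᶜ, F t r = 0 := by
    rw [← lintegral_zero (μ := volume.restrict Iᶜ)]
    refine setLIntegral_congr_fun hIm.compl fun t ht => ?_
    rw [← lintegral_zero (μ := volume.restrict Iᶜ)]
    refine setLIntegral_congr_fun hIm.compl fun r hr => ?_
    simp only [hF]
    rw [indicator_of_notMem ht, indicator_of_notMem hr]
    simp
  have hdiag : ∫⁻ t in I, ∫⁻ r in I, F t r = gagliardo (α / 2) I v := by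
    refine setLIntegral_congr_fun hIm fun t ht => setLIntegral_congr_fun hIm fun r hr => ?_
    simp only [hF]
    rw [indicator_of_mem ht, indicator_of_mem hr]
  have hsplit : gagliardo (α / 2) univ (I.indicator v) =
      (∫⁻ t in I, ∫⁻ r in I, F t r) + (∫⁻ t in I, ∫⁻ r in Iᶜ, F t r) +
      ((∫⁻ t in Iᶜ, ∫⁻ r in I, F t r) + ∫⁻ t in Iᶜ, ∫⁻ r in Iᶜ, F t r) := by
    rw [gagliardo, Measure.restrict_univ, ← lintegral_add_left hFI, ← lintegral_add_left hFI,
      ← lintegral_add_compl _ hIm]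
    congr 1 <;> exact lintegral_congr fun t => (lintegral_add_compl _ hIm).symm
  rw [hsplit, hdiag, hsymm, hzero, add_zero, two_mul, ← add_assoc]
  gcongr

/-! ## Riemann–Liouville integrals on `(0,T)` -/

theorem MemL2.integrableOn {X : Type*} [NormedAddCommGroup X] {T : ℝ} {v : ℝ → X}
    (hv : MemL2 T v) : IntegrableOn v (Ioo 0 T) :=
  MemLp.integrable (by norm_num) hv

section Cut

variable {X : Type*} [NormedAddCommGroup X] [NormedSpace ℝ X] {T γ : ℝ} {v w : ℝ → X}

/-- The function `e^{-t} v(t)` on `(0,T)`, extended by zero. -/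
def expCut (T : ℝ) (v : ℝ → X) : ℝ → X := (Ioo 0 T).indicator fun t => Real.exp (-t) • v t

theorem expCut_of_mem {t : ℝ} (ht : t ∈ Ioo 0 T) : expCut T v t = Real.exp (-t) • v t :=
  indicator_of_mem ht _

theorem expCut_of_notMem {t : ℝ} (ht : t ∉ Ioo 0 T) : expCut T v t = 0 :=
  indicator_of_notMem ht _

theorem expCut_congr (h : v =ᵐ[volume.restrict (Ioo 0 T)] w) : expCut T v =ᵐ[volume] expCut T w := by
  rw [Filter.EventuallyEq, ae_restrict_iff' measurableSet_Ioo] at h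
  filter_upwards [h] with t ht
  by_cases hm : t ∈ Ioo 0 T
  · rw [expCut_of_mem hm, expCut_of_mem hm, ht hm]
  · rw [expCut_of_notMem hm, expCut_of_notMem hm]

/-- The factor e^{-(t-s)} = e^{-t} e^{s} splits, so damping commutes with convolution up to the
factor e^t. The cut at T is invisible for t < T by causality. -/
theorem rlIntLeft_eq_expInt (γ : ℝ) (v : ℝ → X) {t : ℝ} (ht : t ∈ Ioo 0 T) :
    rlIntLeft γ v t = Real.exp t • expInt γ (expCut T v) t := by
  rw [rlIntLeft, expInt, ← integral_smul, ← integral_smul, ← integral_indicator measurableSet_Ioo]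
  refine integral_congr_ae ?_
  have h0 : ∀ᵐ s : ℝ, s ≠ t := by simp [ae_iff, measure_singleton]
  filter_upwards [h0] with s hst
  by_cases hs : s ∈ Ioo 0 t
  · have hs2 : s ∈ Ioo 0 T := ⟨hs.1, hs.2.trans ht.2⟩
    rw [indicator_of_mem hs, expCut_of_mem hs2, gammaKernel_of_pos γ (by linarith [hs.2]),
      smul_smul, smul_smul, smul_smul]
    congr 1
    rw [show Real.exp (-(t - s)) = Real.exp s * Real.exp (-t) by rw [← Real.exp_add]; ring_nf]
    have h1 : Real.exp t * Real.exp (-t) = 1 := by rw [← Real.exp_add]; simp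
    have h2 : Real.exp s * Real.exp (-s) = 1 := by rw [← Real.exp_add]; simp
    linear_combination (-(Real.Gamma γ)⁻¹ * (t - s) ^ (γ - 1)) *
      (Real.exp s * Real.exp (-s) * h1 + h2)
  · rw [indicator_of_notMem hs]
    rcases lt_or_ge s t with h | h
    · have hs2 : s ∉ Ioo 0 T := fun h' => hs ⟨h'.1, h⟩
      rw [expCut_of_notMem hs2]; simp
    · rw [gammaKernel_of_nonpos γ (by linarith)]; simp

theorem rlIntLeft_congr (h : v =ᵐ[volume.restrict (Ioo 0 T)] w) {t : ℝ} (ht : t ∈ Ioo 0 T) :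
    rlIntLeft γ v t = rlIntLeft γ w t := by
  rw [rlIntLeft_eq_expInt γ v ht, rlIntLeft_eq_expInt γ w ht]
  congr 1
  refine expInt_congr ?_
  filter_upwards [expCut_congr h] with s hs _
  exact hs

theorem expInt_of_nonpos {t : ℝ} (ht : t ≤ 0) : expInt γ (expCut T v) t = 0 := by
  refine integral_eq_zero_of_ae (ae_of_all _ fun s => ?_)
  rcases lt_or_ge s t with h | h
  · have hs2 : s ∉ Ioo 0 T := fun h' => by linarith [h'.1]
    simp only [expCut_of_notMem hs2, smul_zero, Pi.zero_apply]
  · simp only [gammaKernel_of_nonpos γ (by linarith : t - s ≤ 0), zero_smul, Pi.zero_apply]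

theorem expCut_rlIntLeft (γ : ℝ) (v : ℝ → X) :
    expCut T (rlIntLeft γ v) = (Ioo 0 T).indicator (expInt γ (expCut T v)) := by
  funext t
  by_cases ht : t ∈ Ioo 0 T
  · rw [expCut_of_mem ht, indicator_of_mem ht, rlIntLeft_eq_expInt γ v ht, smul_smul,
      ← Real.exp_add]
    simp
  · rw [expCut_of_notMem ht, indicator_of_notMem ht]

/-- Cutting the inner convolution to (0,T) does no harm: it vanishes on the negative half-line
already, and values after T are not seen at t < T. -/
theorem expInt_expCut_rlIntLeft (a b : ℝ) (v : ℝ → X) {t : ℝ} (ht : t ∈ Ioo 0 T) :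
    expInt a (expCut T (rlIntLeft b v)) t = expInt a (expInt b (expCut T v)) t := by
  refine expInt_congr (ae_of_all _ fun s hs => ?_)
  rw [expCut_rlIntLeft]
  by_cases hm : s ∈ Ioo 0 T
  · rw [indicator_of_mem hm]
  · rw [indicator_of_notMem hm, expInt_of_nonpos]
    by_contra h
    exact hm ⟨not_le.1 h, hs.trans ht.2⟩

theorem integrable_expCut (hv : IntegrableOn v (Ioo 0 T)) : Integrable (expCut T v) := by
  refine (integrable_indicator_iff measurableSet_Ioo).2 ?_
  refine Integrable.mono' hv.norm ?_ ?_
  · exact (Continuous.aestronglyMeasurable (by fun_prop)).smul hv.1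
  · refine (ae_restrict_iff' measurableSet_Ioo).2 (ae_of_all _ fun t ht => ?_)
    rw [norm_smul, Real.norm_of_nonneg (Real.exp_pos _).le]
    exact mul_le_of_le_one_left (norm_nonneg _) (Real.exp_le_one_iff.2 (by linarith [ht.1]))

theorem integrableOn_exp_smul (hv : IntegrableOn v (Ioo 0 T)) :
    IntegrableOn (fun t => Real.exp t • v t) (Ioo 0 T) := by
  refine Integrable.mono' (hv.norm.const_mul (Real.exp T)) ?_ ?_
  · exact (Continuous.aestronglyMeasurable (by fun_prop)).smul hv.1
  · refine (ae_restrict_iff' measurableSet_Ioo).2 (ae_of_all _ fun t ht => ?_)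
    rw [norm_smul, Real.norm_of_nonneg (Real.exp_pos _).le]
    exact mul_le_mul_of_nonneg_right (Real.exp_le_exp.2 ht.2.le) (norm_nonneg _)

theorem integrableOn_rlIntLeft (hγ : 0 < γ) (hv : IntegrableOn v (Ioo 0 T)) :
    IntegrableOn (rlIntLeft γ v) (Ioo 0 T) :=
  (integrableOn_exp_smul (integrable_expInt hγ (integrable_expCut hv)).integrableOn).congr_fun
    (fun _ ht => (rlIntLeft_eq_expInt γ v ht).symm) measurableSet_Ioo

theorem lintegral_expCut_sq_le (v : ℝ → X) :
    ∫⁻ t, ‖expCut T v t‖ₑ ^ 2 ≤ ∫⁻ t in Ioo 0 T, ‖v t‖ₑ ^ 2 := by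
  rw [← lintegral_indicator measurableSet_Ioo]
  refine lintegral_mono fun t => ?_
  by_cases ht : t ∈ Ioo 0 T
  · rw [indicator_of_mem ht, expCut_of_mem ht, enorm_smul]
    gcongr
    refine mul_le_of_le_one_left zero_le ?_
    rw [Real.enorm_of_nonneg (Real.exp_pos _).le]
    exact ENNReal.ofReal_le_one.2 (Real.exp_le_one_iff.2 (by linarith [ht.1]))
  · rw [expCut_of_notMem ht]; simp

theorem lintegral_exp_smul_sq_le (v : ℝ → X) :
    ∫⁻ t in Ioo 0 T, ‖Real.exp t • v t‖ₑ ^ 2 ≤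
      ENNReal.ofReal (Real.exp T ^ 2) * ∫⁻ t in Ioo 0 T, ‖v t‖ₑ ^ 2 := by
  rw [← lintegral_const_mul' _ _ ENNReal.ofReal_ne_top]
  refine setLIntegral_mono' measurableSet_Ioo fun t ht => ?_
  rw [enorm_smul, mul_pow, ENNReal.ofReal_pow (Real.exp_pos _).le,
    Real.enorm_of_nonneg (Real.exp_pos _).le]
  gcongr
  exact ht.2.le

theorem lintegral_rlIntLeft_sq_le (hγ : 0 < γ) (hv : MemL2 T v) :
    ∫⁻ t in Ioo 0 T, ‖rlIntLeft γ v t‖ₑ ^ 2 ≤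
      ENNReal.ofReal (Real.exp T ^ 2) * ∫⁻ t in Ioo 0 T, ‖v t‖ₑ ^ 2 := by
  rw [setLIntegral_congr_fun (g := fun t => ‖Real.exp t • expInt γ (expCut T v) t‖ₑ ^ 2)
    measurableSet_Ioo fun t ht => by rw [rlIntLeft_eq_expInt γ v ht]]
  refine (lintegral_exp_smul_sq_le _).trans (mul_le_mul_right ?_ _)
  exact (setLIntegral_le_lintegral _ _).trans ((lintegral_expInt_sq_le hγ
    (integrable_expCut hv.integrableOn).1).trans (lintegral_expCut_sq_le v))

theorem MemL2.rlIntLeft (hγ : 0 < γ) (hv : MemL2 T v) : MemL2 T (rlIntLeft γ v) :=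
  memLp_two_of_lintegral_lt_top (integrableOn_rlIntLeft hγ hv.integrableOn).1
    ((lintegral_rlIntLeft_sq_le hγ hv).trans_lt
      (ENNReal.mul_lt_top ENNReal.ofReal_lt_top (lintegral_lt_top_of_memLp_two hv)))

end Cut

section Scalar

variable {T γ : ℝ} {v w : ℝ → ℝ}

theorem MemL2.memL12_expCut (hv : MemL2 T v) : MemL12 (expCut T v) :=
  ⟨integrable_expCut hv.integrableOn, memLp_two_of_lintegral_lt_top
    (integrable_expCut hv.integrableOn).1
    ((lintegral_expCut_sq_le v).trans_lt (lintegral_lt_top_of_memLp_two hv))⟩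

theorem rlIntLeft_add {a b : ℝ} (ha : 0 < a) (hb : 0 < b) (hv : MemL2 T v) :
    ∀ᵐ t ∂volume.restrict (Ioo 0 T), rlIntLeft a (rlIntLeft b v) t = rlIntLeft (a + b) v t := by
  rw [ae_restrict_iff' measurableSet_Ioo]
  filter_upwards [hv.memL12_expCut.expInt_add ha hb] with t ht hm
  rw [rlIntLeft_eq_expInt a _ hm, rlIntLeft_eq_expInt (a + b) _ hm, expInt_expCut_rlIntLeft a b v hm,
    ht]

/-- The right integral is the adjoint convolution, so the exponential weight appears inverted: e^t
on the argument and e^{-s} outside. -/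
theorem rlIntRight_eq_integral (γ : ℝ) (v : ℝ → ℝ) {s : ℝ} (hs : s ∈ Ioo 0 T) :
    rlIntRight γ T v s = Real.exp (-s) *
      ∫ t, gammaKernel γ (t - s) * (Ioo 0 T).indicator (fun t => Real.exp t * v t) t := by
  rw [rlIntRight, smul_eq_mul, ← integral_const_mul, ← integral_const_mul,
    ← integral_indicator measurableSet_Ioo]
  refine integral_congr_ae ?_
  have h0 : ∀ᵐ t : ℝ, t ≠ s := by simp [ae_iff, measure_singleton]
  filter_upwards [h0] with t hst
  by_cases ht : t ∈ Ioo s T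
  · have ht2 : t ∈ Ioo 0 T := ⟨hs.1.trans ht.1, ht.2⟩
    rw [indicator_of_mem ht, indicator_of_mem ht2, gammaKernel_of_pos γ (by linarith [ht.1]),
      smul_eq_mul]
    rw [show Real.exp (-(t - s)) = Real.exp s * Real.exp (-t) by rw [← Real.exp_add]; ring_nf]
    have h1 : Real.exp t * Real.exp (-t) = 1 := by rw [← Real.exp_add]; simp
    have h2 : Real.exp s * Real.exp (-s) = 1 := by rw [← Real.exp_add]; simp
    linear_combination (-(Real.Gamma γ)⁻¹ * (t - s) ^ (γ - 1) * v t) *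
      (Real.exp s * Real.exp (-s) * h1 + h2)
  · rw [indicator_of_notMem ht]
    rcases lt_or_ge s t with h | h
    · have ht2 : t ∉ Ioo 0 T := fun h' => ht ⟨h, h'.2⟩
      rw [indicator_of_notMem ht2]; simp
    · rw [gammaKernel_of_nonpos γ (by linarith)]; simp

theorem memL12_indicator_exp_mul (hv : MemL2 T v) :
    MemL12 ((Ioo 0 T).indicator fun t => Real.exp t * v t) := by
  have h1 : Integrable ((Ioo 0 T).indicator fun t => Real.exp t * v t) :=
    (integrable_indicator_iff measurableSet_Ioo).2 (integrableOn_exp_smul hv.integrableOn)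
  refine ⟨h1, (memLp_indicator_iff_restrict measurableSet_Ioo).2 ?_⟩
  refine memLp_two_of_lintegral_lt_top ((integrable_indicator_iff measurableSet_Ioo).1 h1).1 ?_
  exact (lintegral_exp_smul_sq_le v).trans_lt
    (ENNReal.mul_lt_top ENNReal.ofReal_lt_top (lintegral_lt_top_of_memLp_two hv))

theorem lintegral_mul_lt_top {Z : Type*} [MeasurableSpace Z] {μ : Measure Z} {f g : Z → ℝ≥0∞}
    (hf : AEMeasurable f μ) (hg : AEMeasurable g μ) (h1 : ∫⁻ z, f z ^ 2 ∂μ < ⊤)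
    (h2 : ∫⁻ z, g z ^ 2 ∂μ < ⊤) : ∫⁻ z, f z * g z ∂μ < ⊤ := by
  have h := (sq_lintegral_mul_le hf hg).trans_lt (ENNReal.mul_lt_top h1 h2)
  by_contra h'
  rw [not_lt, top_le_iff] at h'
  rw [h'] at h
  simp at h

/-- Absolute convergence, needed for Fubini in the duality of left and right integrals: the kernel
is bounded on L² by Young, and Cauchy–Schwarz handles the pairing with b. -/
theorem integrable_gammaKernel_prod (hγ : 0 < γ) {a b : ℝ → ℝ} (ha : MemL12 a) (hb : MemL12 b) :
    Integrable (fun p : ℝ × ℝ => gammaKernel γ (p.1 - p.2) * a p.2 * b p.1)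
      (volume.prod volume) := by
  have hk : Measurable fun p : ℝ × ℝ => gammaKernel γ (p.1 - p.2) :=
    (measurable_gammaKernel γ).comp (measurable_fst.sub measurable_snd)
  have hm : AEStronglyMeasurable (fun p : ℝ × ℝ => gammaKernel γ (p.1 - p.2) * a p.2 * b p.1)
      (volume.prod volume) :=
    (hk.aestronglyMeasurable.mul ha.mem.1.comp_snd).mul hb.mem.1.comp_fst
  refine ⟨hm, ?_⟩
  rw [HasFiniteIntegral, lintegral_prod _ hm.enorm]
  have hka : AEMeasurable (fun p : ℝ × ℝ => ENNReal.ofReal (gammaKernel γ (p.1 - p.2)) * ‖a p.2‖ₑ)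
      (volume.prod volume) :=
    (measurable_gammaKernel_sub γ).aemeasurable.mul ha.mem.1.comp_snd.enorm
  have e : ∀ t, ∫⁻ s, ‖gammaKernel γ (t - s) * a s * b t‖ₑ =
      (∫⁻ s, ENNReal.ofReal (gammaKernel γ (t - s)) * ‖a s‖ₑ) * ‖b t‖ₑ := by
    intro t
    rw [← lintegral_mul_const' _ _ (by finiteness)]
    refine lintegral_congr fun s => ?_
    rw [enorm_mul, enorm_mul, Real.enorm_of_nonneg (gammaKernel_nonneg hγ _)]
  rw [lintegral_congr e]
  exact lintegral_mul_lt_top hka.lintegral_prod_right' hb.mem.1.enorm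
    ((lintegral_gammaKernel_conv_sq_le hγ ha.mem.1.enorm).trans_lt
      (lintegral_lt_top_of_memLp_two ha.mem)) (lintegral_lt_top_of_memLp_two hb.mem)

/-- Left and right integrals are adjoint to each other. After damping v by e^{-t} and weighting w by
e^t, both sides are the same double integral of one kernel, in opposite orders. -/
theorem integral_mul_rlIntRight (hγ : 0 < γ) (hv : MemL2 T v) (hw : MemL2 T w) :
    ∫ s in Ioo 0 T, v s * rlIntRight γ T w s = ∫ t in Ioo 0 T, rlIntLeft γ v t * w t := by
  have ha := hv.memL12_expCut
  have hb := memL12_indicator_exp_mul hw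
  set a := expCut T v with hadef
  set b := (Ioo 0 T).indicator fun t => Real.exp t * w t with hbdef
  have h1 : ∫ s in Ioo 0 T, v s * rlIntRight γ T w s =
      ∫ s, ∫ t, gammaKernel γ (t - s) * a s * b t := by
    rw [← integral_indicator measurableSet_Ioo]
    refine integral_congr_ae (ae_of_all _ fun s => ?_)
    simp only
    by_cases hs : s ∈ Ioo 0 T
    · rw [indicator_of_mem hs, rlIntRight_eq_integral γ w hs, ← mul_assoc, ← integral_const_mul]
      refine integral_congr_ae (ae_of_all _ fun t => ?_)
      simp only [hadef, expCut_of_mem hs, smul_eq_mul]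
      ring
    · rw [indicator_of_notMem hs]
      simp only [hadef, expCut_of_notMem hs]
      simp
  have h2 : ∫ t in Ioo 0 T, rlIntLeft γ v t * w t =
      ∫ t, ∫ s, gammaKernel γ (t - s) * a s * b t := by
    rw [← integral_indicator measurableSet_Ioo]
    refine integral_congr_ae (ae_of_all _ fun t => ?_)
    simp only
    by_cases ht : t ∈ Ioo 0 T
    · rw [indicator_of_mem ht, rlIntLeft_eq_expInt γ v ht, integral_mul_const, hbdef,
        indicator_of_mem ht, expInt]
      simp only [smul_eq_mul]
      ring
    · rw [indicator_of_notMem ht, hbdef, indicator_of_notMem ht]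
      simp
  rw [h1, h2]
  exact (integral_integral_swap (integrable_gammaKernel_prod hγ ha hb)).symm

end Scalar

/-! ## Sobolev norms on `(0,T)` -/

theorem sobolevNormSq_of_lt {s : ℝ} (hs : s < 1) (T : ℝ) (w : ℝ → ℝ) :
    sobolevNormSq s T w = (∫⁻ t in Ioo 0 T, ‖w t‖ₑ ^ 2) + gagliardo s (Ioo 0 T) w := by
  rw [sobolevNormSq, if_pos hs, gagliardo]

theorem gagliardo_exp_mul_le {s T : ℝ} {v : ℝ → ℝ}
    (hv : AEStronglyMeasurable v (volume.restrict (Ioo 0 T))) :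
    gagliardo s (Ioo 0 T) (fun t => Real.exp t * v t) ≤ ENNReal.ofReal (2 * Real.exp T ^ 2) *
      (gagliardo s (Ioo 0 T) v + multiplierConst s T * ∫⁻ t in Ioo 0 T, ‖v t‖ₑ ^ 2) := by
  have e := hv.ae_eq_mk
  have h := gagliardo_mul_le (s := s) (T := T) (M := Real.exp T) (m := Real.exp)
    hv.stronglyMeasurable_mk.measurable ?_ ?_
  · rw [gagliardo_congr s e, lintegral_congr_ae (g := fun t => ‖hv.mk v t‖ₑ ^ 2)
      (by filter_upwards [e] with t ht; rw [ht]),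
      gagliardo_congr s (W := fun t => Real.exp t * hv.mk v t)
      (by filter_upwards [e] with t ht; rw [ht])]
    exact h
  · intro t ht
    rw [abs_of_pos (Real.exp_pos _)]
    exact Real.exp_le_exp.2 ht.2.le
  · have key : ∀ t r : ℝ, r ≤ t → t ≤ T → |Real.exp t - Real.exp r| ≤ Real.exp T * |t - r| := by
      intro t r hrt htT
      rw [abs_of_nonneg (sub_nonneg.2 (Real.exp_le_exp.2 hrt)), abs_of_nonneg (sub_nonneg.2 hrt)]
      have h1 : Real.exp t - Real.exp r ≤ Real.exp t * (t - r) := by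
        have h2 := Real.add_one_le_exp (r - t)
        have h3 : Real.exp r = Real.exp t * Real.exp (r - t) := by rw [← Real.exp_add]; ring_nf
        rw [h3]
        nlinarith [Real.exp_pos t]
      exact h1.trans (mul_le_mul_of_nonneg_right (Real.exp_le_exp.2 htT) (sub_nonneg.2 hrt))
    intro t ht r hr
    rcases le_total r t with h | h
    · exact key t r h ht.2.le
    · rw [abs_sub_comm, abs_sub_comm t r]
      exact key r t h hr.2.le

/-- The constant in `gagliardo_zeroExtension_exp_le`. -/
def zeroExtensionConst (α T : ℝ) : ℝ≥0∞ :=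
  (1 + 2 * (ENNReal.ofReal α⁻¹ * (hardyC α T + hardyC α T))) *
    (ENNReal.ofReal (Real.exp T ^ 2) +
      ENNReal.ofReal (2 * Real.exp T ^ 2) * (1 + multiplierConst (α / 2) T))

theorem zeroExtensionConst_lt_top {α T : ℝ} (h1 : α < 1) (hT : 0 < T) :
    zeroExtensionConst α T < ⊤ := by
  have := multiplierConst_lt_top (s := α / 2) (by linarith) hT
  have h2 := hardyC_lt_top α T
  unfold zeroExtensionConst
  finiteness

/-- Extension by zero is bounded on H^{α/2} because α/2 < 1/2: the weights produced at both ends of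
the interval are controlled by the Hardy inequality. The factor e^t compensates the damping of the
other argument in the later duality. -/
theorem gagliardo_zeroExtension_exp_le {α T : ℝ} (h0 : 0 < α) (h1 : α < 1) (hT : 0 < T)
    {v : ℝ → ℝ} (hv : MemL2 T v) :
    gagliardo (α / 2) univ ((Ioo 0 T).indicator fun t => Real.exp t * v t) ≤
      zeroExtensionConst α T * sobolevNormSq (α / 2) T v := by
  have hm : AEStronglyMeasurable (fun t => Real.exp t * v t) (volume.restrict (Ioo 0 T)) :=
    (integrableOn_exp_smul hv.integrableOn).1
  -- The Hardy and extension bounds are stated for measurable functions, hence the passage to a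
  -- representative.
  obtain ⟨g, hg, hge⟩ : ∃ g : ℝ → ℝ, Measurable g ∧
      (fun t => Real.exp t * v t) =ᵐ[volume.restrict (Ioo 0 T)] g :=
    ⟨hm.mk _, hm.stronglyMeasurable_mk.measurable, hm.ae_eq_mk⟩
  have hind : (Ioo 0 T).indicator (fun t => Real.exp t * v t) =ᵐ[volume]
      (Ioo 0 T).indicator g := by
    have := hge
    rw [Filter.EventuallyEq, ae_restrict_iff' measurableSet_Ioo] at this
    filter_upwards [this] with t ht
    by_cases hm : t ∈ Ioo 0 T
    · rw [indicator_of_mem hm, indicator_of_mem hm, ht hm]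
    · rw [indicator_of_notMem hm, indicator_of_notMem hm]
  have hA : ∫⁻ t in Ioo 0 T, ‖g t‖ₑ ^ 2 ≤
      ENNReal.ofReal (Real.exp T ^ 2) * ∫⁻ t in Ioo 0 T, ‖v t‖ₑ ^ 2 := by
    rw [lintegral_congr_ae (g := fun t => ‖Real.exp t * v t‖ₑ ^ 2)
      (by filter_upwards [hge] with t ht; rw [ht])]
    exact lintegral_exp_smul_sq_le v
  have hAtop : ∫⁻ t in Ioo 0 T, ‖g t‖ₑ ^ 2 < ⊤ :=
    hA.trans_lt (ENNReal.mul_lt_top (by simp) (lintegral_lt_top_of_memLp_two hv))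
  have hS : gagliardo (α / 2) (Ioo 0 T) g ≤ ENNReal.ofReal (2 * Real.exp T ^ 2) *
      (gagliardo (α / 2) (Ioo 0 T) v + multiplierConst (α / 2) T *
        ∫⁻ t in Ioo 0 T, ‖v t‖ₑ ^ 2) := by
    rw [← gagliardo_congr _ hge]
    exact gagliardo_exp_mul_le hv.1
  rw [gagliardo_congr (A := univ) (W := (Ioo 0 T).indicator g) _ (by rwa [Measure.restrict_univ]),
    sobolevNormSq_of_lt (by linarith)]
  set A := ∫⁻ t in Ioo 0 T, ‖v t‖ₑ ^ 2
  set S := gagliardo (α / 2) (Ioo 0 T) v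
  set A' := ∫⁻ t in Ioo 0 T, ‖g t‖ₑ ^ 2
  set S' := gagliardo (α / 2) (Ioo 0 T) g
  set K := multiplierConst (α / 2) T
  calc _ ≤ S' + 2 * (ENNReal.ofReal α⁻¹ * (hardyC α T * (A' + S') + hardyC α T * (A' + S'))) := by
        refine (gagliardo_zeroExtension_le h0 hg).trans ?_
        gcongr
        · exact hardy h0 h1 hT hg hAtop
        · exact hardy_right h0 h1 hT hg hAtop
    _ ≤ (A' + S') + 2 * (ENNReal.ofReal α⁻¹ * (hardyC α T * (A' + S') + hardyC α T * (A' + S'))) := by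
        gcongr
        exact le_add_self
    _ = (1 + 2 * (ENNReal.ofReal α⁻¹ * (hardyC α T + hardyC α T))) * (A' + S') := by ring
    _ ≤ (1 + 2 * (ENNReal.ofReal α⁻¹ * (hardyC α T + hardyC α T))) *
        (ENNReal.ofReal (Real.exp T ^ 2) * (A + S) +
          ENNReal.ofReal (2 * Real.exp T ^ 2) * ((A + S) + K * (A + S))) := by
        refine mul_le_mul_right (add_le_add (hA.trans ?_) (hS.trans ?_)) _
        · gcongr; exact le_self_add
        · gcongr
          · exact le_add_self
          · exact le_self_add
    _ = _ := by rw [zeroExtensionConst]; ring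

/-! ## The equation for one mode -/

theorem lintegral_sq_eq_ofReal {G : ℝ → ℝ} (hG : MemLp G 2) :
    ∫⁻ t, ‖G t‖ₑ ^ 2 = ENNReal.ofReal (∫ t, G t ^ 2) := by
  rw [ofReal_integral_eq_lintegral_ofReal hG.integrable_sq (ae_of_all _ fun t => sq_nonneg _)]
  exact lintegral_congr fun t => enorm_real_sq _

theorem memL12_of_restrict {T : ℝ} {g : ℝ → ℝ} (hg : MemL2 T g) :
    MemL12 ((Ioo 0 T).indicator g) :=
  ⟨(integrable_indicator_iff measurableSet_Ioo).2 hg.integrableOn,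
    (memLp_indicator_iff_restrict measurableSet_Ioo).2 hg⟩

/-- Only the sign of the cosine matters here, so the endpoint α = 1, where it vanishes, is included.
-/
theorem expInt_nonneg_inner {α : ℝ} (h0 : 0 < α) (h1 : α ≤ 1) {G : ℝ → ℝ} (hG : MemL12 G) :
    0 ≤ ∫ t, expInt α G t * G t := by
  refine le_trans (mul_nonneg ?_ (dampedEnergy_nonneg α G)) (hG.coercive h0 h1)
  refine Real.cos_nonneg_of_neg_pi_div_two_le_of_le ?_ ?_ <;> nlinarith [Real.pi_pos]

section Operator

variable (T : ℝ)

theorem memLp_expInt_indicator {α : ℝ} (h0 : 0 < α) (g : Lp ℝ 2 (volume.restrict (Ioo 0 T))) :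
    MemLp (expInt α ((Ioo 0 T).indicator g)) 2 (volume.restrict (Ioo 0 T)) :=
  ((memL12_of_restrict (Lp.memLp g)).expInt h0).mem.restrict _

/-- The operator `g ↦ expInt α (1_{(0,T)} g)` on `L²(0,T)`. -/
def expIntOp {α : ℝ} (h0 : 0 < α) :
    Lp ℝ 2 (volume.restrict (Ioo 0 T)) →L[ℝ] Lp ℝ 2 (volume.restrict (Ioo 0 T)) :=
  LinearMap.mkContinuous
    { toFun := fun g => (memLp_expInt_indicator T h0 g).toLp _
      map_add' := fun g g' => by
        rw [← MemLp.toLp_add, MemLp.toLp_eq_toLp_iff]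
        have i1 := ae_integrable_expInt h0 (memL12_of_restrict (Lp.memLp g)).int
        have i2 := ae_integrable_expInt h0 (memL12_of_restrict (Lp.memLp g')).int
        have e := Lp.coeFn_add g g'
        rw [Filter.EventuallyEq, ae_restrict_iff' measurableSet_Ioo] at e
        filter_upwards [ae_restrict_of_ae i1, ae_restrict_of_ae i2] with t h1 h2
        rw [Pi.add_apply, expInt, expInt, expInt, ← integral_add h1 h2]
        refine integral_congr_ae ?_
        filter_upwards [e] with s hs
        by_cases hm : s ∈ Ioo 0 T
        · simp only [indicator_of_mem hm, hs hm, Pi.add_apply, smul_add]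
        · simp only [indicator_of_notMem hm, smul_zero, add_zero]
      map_smul' := fun c g => by
        rw [RingHom.id_apply, ← MemLp.toLp_const_smul, MemLp.toLp_eq_toLp_iff]
        have e := Lp.coeFn_smul c g
        rw [Filter.EventuallyEq, ae_restrict_iff' measurableSet_Ioo] at e
        refine ae_of_all _ fun t => ?_
        rw [Pi.smul_apply, expInt, expInt, ← integral_smul]
        refine integral_congr_ae ?_
        filter_upwards [e] with s hs
        by_cases hm : s ∈ Ioo 0 T
        · simp only [indicator_of_mem hm, hs hm, Pi.smul_apply]
          rw [smul_comm]
        · simp only [indicator_of_notMem hm, smul_zero] } 1 fun g => by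
    have hG := memL12_of_restrict (Lp.memLp g)
    rw [one_mul, LinearMap.coe_mk, AddHom.coe_mk, Lp.norm_toLp, Lp.norm_def]
    refine ENNReal.toReal_mono (Lp.memLp g).2.ne ?_
    refine (eLpNorm_mono_measure _ Measure.restrict_le_self).trans ?_
    rw [← eLpNorm_indicator_eq_eLpNorm_restrict measurableSet_Ioo,
      eLpNorm_eq_lintegral_rpow_enorm_toReal (by norm_num) (by norm_num),
      eLpNorm_eq_lintegral_rpow_enorm_toReal (by norm_num) (by norm_num)]
    gcongr ?_ ^ _
    have := lintegral_expInt_sq_le h0 hG.mem.1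
    simpa using this

theorem expIntOp_ae_eq {α : ℝ} (h0 : 0 < α) (g : Lp ℝ 2 (volume.restrict (Ioo 0 T))) :
    expIntOp T h0 g =ᵐ[volume.restrict (Ioo 0 T)] expInt α ((Ioo 0 T).indicator g) :=
  MemLp.coeFn_toLp (memLp_expInt_indicator T h0 g)

theorem inner_expIntOp_nonneg {α : ℝ} (h0 : 0 < α) (h1 : α ≤ 1)
    (g : Lp ℝ 2 (volume.restrict (Ioo 0 T))) : 0 ≤ ⟪expIntOp T h0 g, g⟫ := by
  rw [L2.inner_def]
  refine (expInt_nonneg_inner h0 h1 (memL12_of_restrict (Lp.memLp g))).trans (le_of_eq ?_)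
  rw [← integral_indicator measurableSet_Ioo]
  have e := expIntOp_ae_eq T h0 g
  rw [Filter.EventuallyEq, ae_restrict_iff' measurableSet_Ioo] at e
  refine integral_congr_ae ?_
  filter_upwards [e] with t ht
  by_cases hm : t ∈ Ioo 0 T
  · rw [indicator_of_mem hm, indicator_of_mem hm, ht hm]
    simp [mul_comm]
  · rw [indicator_of_notMem hm, indicator_of_notMem hm, mul_zero]

/-- Lax–Milgram: convolution is a monotone operator on L²(0,T), hence ⟨(1 + λA)g, g⟩ ≥ ‖g‖² for
every λ ≥ 0, and the operator is invertible. -/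
theorem exists_expInt_solution {α lam : ℝ} (h0 : 0 < α) (h1 : α ≤ 1) (hl : 0 ≤ lam) {F : ℝ → ℝ}
    (hF : MemL2 T F) : ∃ W : ℝ → ℝ, MemL2 T W ∧ ∀ᵐ t ∂volume.restrict (Ioo 0 T),
      W t + lam * expInt α ((Ioo 0 T).indicator W) t = F t := by
  set A := ContinuousLinearMap.id ℝ (Lp ℝ 2 (volume.restrict (Ioo 0 T))) + lam • expIntOp T h0
  have hu : IsUnit A := by
    refine ContinuousLinearMap.isUnit_of_forall_le_norm_inner_map A (c := 1) one_pos fun g => ?_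
    have : ⟪A g, g⟫ = ‖g‖ ^ 2 + lam * ⟪expIntOp T h0 g, g⟫ := by
      simp only [A, _root_.add_apply, ContinuousLinearMap.id_apply,
        _root_.smul_apply, inner_add_left, real_inner_self_eq_norm_sq,
        real_inner_smul_left]
    rw [this, Real.norm_eq_abs]
    refine le_trans ?_ (le_abs_self _)
    have := mul_nonneg hl (inner_expIntOp_nonneg T h0 h1 g)
    simpa using this
  obtain ⟨B, hB⟩ := hu.exists_right_inv
  set g := B (hF.toLp F)
  have hg : A g = hF.toLp F := by
    have := congrArg (fun L => L (hF.toLp F)) hB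
    simpa using this
  refine ⟨g, Lp.memLp g, ?_⟩
  have e1 : (A g : ℝ → ℝ) =ᵐ[volume.restrict (Ioo 0 T)] F := by rw [hg]; exact hF.coeFn_toLp
  have e2 := Lp.coeFn_add g (lam • expIntOp T h0 g)
  have e3 := Lp.coeFn_smul lam (expIntOp T h0 g)
  filter_upwards [e1, e2, e3, expIntOp_ae_eq T h0 g] with t h1 h2 h3 h4
  rw [← h1]
  refine Eq.trans ?_ h2.symm
  rw [Pi.add_apply, h3, Pi.smul_apply, h4, smul_eq_mul]

end Operator

/-! ## Estimates for one mode -/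

theorem expCut_exp_mul (T : ℝ) (W : ℝ → ℝ) :
    expCut T (fun t => Real.exp t * W t) = (Ioo 0 T).indicator W := by
  funext t
  by_cases ht : t ∈ Ioo 0 T
  · rw [expCut_of_mem ht, indicator_of_mem ht, smul_eq_mul, ← mul_assoc, ← Real.exp_add]
    simp
  · rw [expCut_of_notMem ht, indicator_of_notMem ht]

/-- Solve the damped equation for W with right-hand side e^{-t} f, then put w = e^t W. -/
theorem exists_rlIntLeft_solution {α lam T : ℝ} (h0 : 0 < α) (h1 : α ≤ 1) (hl : 0 ≤ lam)
    {f : ℝ → ℝ} (hf : MemL2 T f) : ∃ w : ℝ → ℝ, MemL2 T w ∧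
      ∀ᵐ t ∂volume.restrict (Ioo 0 T), w t + lam * rlIntLeft α w t = f t := by
  obtain ⟨W, hW, he⟩ := exists_expInt_solution T h0 h1 hl
    (F := expCut T f) (hf.memL12_expCut.mem.restrict _)
  refine ⟨fun t => Real.exp t * W t, ?_, ?_⟩
  · exact (memLp_indicator_iff_restrict measurableSet_Ioo).1 (memL12_indicator_exp_mul hW).mem
  · filter_upwards [he, ae_restrict_mem measurableSet_Ioo] with t ht hm
    rw [rlIntLeft_eq_expInt α _ hm, expCut_exp_mul, smul_eq_mul]
    rw [expCut_of_mem hm, smul_eq_mul] at ht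
    have : Real.exp t * Real.exp (-t) = 1 := by rw [← Real.exp_add]; simp
    linear_combination Real.exp t * ht + f t * this

theorem MemL12.ofReal_dampedEnergy {G : ℝ → ℝ} (hG : MemL12 G) {γ : ℝ} (hγ : 0 ≤ γ) :
    ENNReal.ofReal (dampedEnergy γ G) =
      ∫⁻ ξ, ENNReal.ofReal (‖damped ξ‖ ^ (-γ)) * ‖realFourier G ξ‖ₑ ^ 2 := by
  rw [dampedEnergy, ofReal_integral_eq_lintegral_ofReal (hG.integrable_dampedEnergy hγ)
    (ae_of_all _ fun ξ => by positivity)]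
  refine lintegral_congr fun ξ => ?_
  rw [ENNReal.ofReal_mul (by positivity), ENNReal.ofReal_pow (norm_nonneg _), ofReal_norm]

theorem abs_le_norm_damped (ξ : ℝ) : |ξ| ≤ ‖damped ξ‖ := by
  have h := Complex.abs_im_le_norm (damped ξ)
  rw [damped_im, abs_mul, abs_of_pos (by positivity : (0 : ℝ) < 2 * Real.pi)] at h
  refine le_trans ?_ h
  have := Real.pi_gt_three
  nlinarith [abs_nonneg ξ]

/-- On the Fourier side the weight is |ξ|^{2s} |z|^{-2γ}, and |ξ| ≤ |z|. -/
theorem MemL12.gagliardo_expInt_le {G : ℝ → ℝ} (hG : MemL12 G) {γ s : ℝ} (hγ : 0 < γ)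
    (hs : 0 < s) : gagliardo s univ (_root_.expInt γ G) ≤ gagliardoConst s *
      ∫⁻ ξ, ENNReal.ofReal (‖damped ξ‖ ^ (-(2 * γ - 2 * s))) * ‖realFourier G ξ‖ₑ ^ 2 := by
  rw [(hG.expInt hγ).gagliardo_univ_eq]
  refine mul_le_mul_right (lintegral_mono fun ξ => ?_) _
  rw [hG.realFourier_expInt hγ, enorm_mul, mul_pow, ← mul_assoc]
  refine mul_le_mul_left ?_ _
  have hz : 0 < ‖damped ξ‖ := norm_pos_iff.2 (damped_ne_zero ξ)
  rw [← ofReal_norm, norm_damped_cpow, ← ENNReal.ofReal_pow (by positivity),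
    ← ENNReal.ofReal_mul (by positivity)]
  refine ENNReal.ofReal_le_ofReal ?_
  rw [← Real.rpow_natCast, ← Real.rpow_mul hz.le,
    show -(2 * γ - 2 * s) = 2 * s + -γ * ((2 : ℕ) : ℝ) by push_cast; ring, Real.rpow_add hz]
  gcongr
  exact abs_le_norm_damped ξ

/-- The bound for the Sobolev norm of `e^t V` by the norms of `V` on the line. -/
theorem sobolevNormSq_exp_mul_le {s T : ℝ} (hs : s < 1) {u V : ℝ → ℝ}
    (hV : MemL12 V) (hu : ∀ t ∈ Ioo 0 T, u t = Real.exp t * V t) :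
    sobolevNormSq s T u ≤ (ENNReal.ofReal (Real.exp T ^ 2) + ENNReal.ofReal (2 * Real.exp T ^ 2) *
      (1 + multiplierConst s T)) * ((∫⁻ t, ‖V t‖ₑ ^ 2) + gagliardo s univ V) := by
  have hue : u =ᵐ[volume.restrict (Ioo 0 T)] fun t => Real.exp t * V t :=
    (ae_restrict_iff' measurableSet_Ioo).2 (ae_of_all _ hu)
  rw [sobolevNormSq_of_lt hs, gagliardo_congr s hue, lintegral_congr_ae
    (g := fun t => ‖Real.exp t • V t‖ₑ ^ 2) (by filter_upwards [hue] with t ht; rw [ht]; rfl)]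
  have h1 : ∫⁻ t in Ioo 0 T, ‖V t‖ₑ ^ 2 ≤ ∫⁻ t, ‖V t‖ₑ ^ 2 := setLIntegral_le_lintegral _ _
  have h2 : gagliardo s (Ioo 0 T) V ≤ gagliardo s univ V := gagliardo_mono_set s (subset_univ _) V
  set A := ∫⁻ t, ‖V t‖ₑ ^ 2
  set S := gagliardo s univ V
  calc _ ≤ ENNReal.ofReal (Real.exp T ^ 2) * A +
        ENNReal.ofReal (2 * Real.exp T ^ 2) * (S + multiplierConst s T * A) := by
        refine add_le_add ((lintegral_exp_smul_sq_le V).trans (by gcongr)) ?_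
        exact (gagliardo_exp_mul_le (hV.mem.1.restrict)).trans (by gcongr)
    _ ≤ ENNReal.ofReal (Real.exp T ^ 2) * (A + S) +
        ENNReal.ofReal (2 * Real.exp T ^ 2) * ((A + S) + multiplierConst s T * (A + S)) := by
        gcongr
        · exact le_self_add
        · exact le_add_self
        · exact le_self_add
    _ = _ := by ring

section Mode

variable {α T lam : ℝ} {f w : ℝ → ℝ}

/-- `w + λ I^α w = f` on `(0,T)`. -/
structure SolvesMode (α T lam : ℝ) (f w : ℝ → ℝ) : Prop where
  f_mem : MemL2 T f
  w_mem : MemL2 T w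
  eq : ∀ᵐ t ∂volume.restrict (Ioo 0 T), w t + lam * rlIntLeft α w t = f t

namespace SolvesMode

theorem expCut_eq (h : SolvesMode α T lam f w) : ∀ᵐ t, t ∈ Ioo 0 T →
    expCut T w t + lam * expInt α (expCut T w) t = expCut T f t := by
  have := h.eq
  rw [ae_restrict_iff' measurableSet_Ioo] at this
  filter_upwards [this] with t ht hm
  have h1 := ht hm
  rw [rlIntLeft_eq_expInt α w hm, smul_eq_mul] at h1
  have h2 : Real.exp t * Real.exp (-t) = 1 := by rw [← Real.exp_add]; simp
  rw [expCut_of_mem hm, expCut_of_mem (v := f) hm, smul_eq_mul, smul_eq_mul]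
  linear_combination Real.exp (-t) * h1 - lam * expInt α (expCut T w) t * h2

/-- Multiply the damped equation by its solution W and bound the product W F by (W² + F²)/2. The two
terms on the left are then controlled separately, since both are nonnegative. -/
theorem energy (h : SolvesMode α T lam f w) (h0 : 0 < α) :
    (∫ t, expCut T w t ^ 2) + lam * ∫ t, expInt α (expCut T w) t * expCut T w t ≤
      ((∫ t, expCut T f t ^ 2) + ∫ t, expCut T w t ^ 2) / 2 := by
  have hw := h.w_mem.memL12_expCut
  have hf := h.f_mem.memL12_expCut
  have i1 : Integrable fun t => expInt α (expCut T w) t * expCut T w t :=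
    (hw.expInt h0).mem.integrable_mul hw.mem
  have i2 := hw.mem.integrable_sq
  have i3 := hf.mem.integrable_sq
  rw [← integral_const_mul, ← integral_add i2 (i1.const_mul _), ← integral_add i3 i2,
    ← integral_div]
  refine integral_mono_ae (i2.add (i1.const_mul _)) ((i3.add i2).div_const _) ?_
  filter_upwards [h.expCut_eq] with t ht
  by_cases hm : t ∈ Ioo 0 T
  · have := ht hm
    have e : expCut T w t ^ 2 + lam * (expInt α (expCut T w) t * expCut T w t) =
        expCut T w t * expCut T f t := by rw [← this]; ring
    refine e.le.trans ?_
    nlinarith [sq_nonneg (expCut T f t - expCut T w t)]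
  · simp only [expCut_of_notMem hm]
    simp

theorem integral_sq_le (h : SolvesMode α T lam f w) (h0 : 0 < α) (h1 : α ≤ 1) (hl : 0 ≤ lam) :
    ∫ t, expCut T w t ^ 2 ≤ ∫ t, expCut T f t ^ 2 := by
  have e := h.energy h0
  have := mul_nonneg hl (expInt_nonneg_inner h0 h1 h.w_mem.memL12_expCut)
  linarith

/-- Coercivity inserted in the energy inequality. This needs α < 1 strictly, as cos(απ/2) must not
vanish. -/
theorem dampedEnergy_le (h : SolvesMode α T lam f w) (h0 : 0 < α) (h1 : α < 1) (hl : 0 ≤ lam) :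
    lam * dampedEnergy α (expCut T w) ≤
      (Real.cos (α * (Real.pi / 2)))⁻¹ * ∫ t, expCut T f t ^ 2 := by
  have e := h.energy h0
  have hc : 0 < Real.cos (α * (Real.pi / 2)) := by
    refine Real.cos_pos_of_mem_Ioo ⟨?_, ?_⟩ <;> nlinarith [Real.pi_pos]
  have h2 := mul_le_mul_of_nonneg_left (h.w_mem.memL12_expCut.coercive h0 h1.le) hl
  have h3 : 0 ≤ ∫ t, expCut T w t ^ 2 := integral_nonneg fun _ => sq_nonneg _
  have h4 : 0 ≤ ∫ t, expCut T f t ^ 2 := integral_nonneg fun _ => sq_nonneg _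
  rw [← div_eq_inv_mul, le_div_iff₀ hc]
  nlinarith

/-- From λ I^α w = f - w, once w is bounded by f. -/
theorem integral_expInt_sq_le (h : SolvesMode α T lam f w) (h0 : 0 < α) (h1 : α ≤ 1)
    (hl : 0 ≤ lam) : lam ^ 2 * ∫ t, expCut T (rlIntLeft α w) t ^ 2 ≤
      4 * ∫ t, expCut T f t ^ 2 := by
  have hw := h.w_mem.memL12_expCut
  have hf := h.f_mem.memL12_expCut
  have hd := (h.w_mem.rlIntLeft h0).memL12_expCut
  have hle := h.integral_sq_le h0 h1 hl
  calc lam ^ 2 * ∫ t, expCut T (rlIntLeft α w) t ^ 2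
      ≤ 2 * (∫ t, expCut T f t ^ 2) + 2 * ∫ t, expCut T w t ^ 2 := by
        rw [← integral_const_mul, ← integral_const_mul, ← integral_const_mul,
          ← integral_add (hf.mem.integrable_sq.const_mul _) (hw.mem.integrable_sq.const_mul _)]
        refine integral_mono_ae (hd.mem.integrable_sq.const_mul _)
          ((hf.mem.integrable_sq.const_mul _).add (hw.mem.integrable_sq.const_mul _)) ?_
        filter_upwards [h.expCut_eq] with t ht
        rw [expCut_rlIntLeft]
        by_cases hm : t ∈ Ioo 0 T
        · have := ht hm
          simp only [indicator_of_mem hm]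
          have e : lam * expInt α (expCut T w) t = expCut T f t - expCut T w t := by linarith
          rw [← mul_pow, e]
          nlinarith [sq_nonneg (expCut T f t + expCut T w t)]
        · simp only [expCut_of_notMem hm, indicator_of_notMem hm]
          simp
    _ ≤ _ := by linarith

theorem lintegral_expCut_le (h : SolvesMode α T lam f w) (h0 : 0 < α) (h1 : α ≤ 1)
    (hl : 0 ≤ lam) : ∫⁻ t, ‖expCut T w t‖ₑ ^ 2 ≤ ∫⁻ t in Ioo 0 T, ‖f t‖ₑ ^ 2 := by
  refine le_trans ?_ (lintegral_expCut_sq_le f)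
  rw [lintegral_sq_eq_ofReal h.w_mem.memL12_expCut.mem,
    lintegral_sq_eq_ofReal h.f_mem.memL12_expCut.mem]
  exact ENNReal.ofReal_le_ofReal (h.integral_sq_le h0 h1 hl)

theorem lintegral_w_le (h : SolvesMode α T lam f w) (h0 : 0 < α) (h1 : α ≤ 1) (hl : 0 ≤ lam) :
    ∫⁻ t in Ioo 0 T, ‖w t‖ₑ ^ 2 ≤
      ENNReal.ofReal (Real.exp T ^ 2) * ∫⁻ t in Ioo 0 T, ‖f t‖ₑ ^ 2 := by
  have e : ∫⁻ t in Ioo 0 T, ‖w t‖ₑ ^ 2 =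
      ∫⁻ t in Ioo 0 T, ‖Real.exp t • expCut T w t‖ₑ ^ 2 := by
    refine setLIntegral_congr_fun measurableSet_Ioo fun t ht => ?_
    rw [expCut_of_mem ht, smul_smul, ← Real.exp_add]
    simp
  rw [e]
  refine (lintegral_exp_smul_sq_le _).trans (mul_le_mul_right ?_ _)
  exact (setLIntegral_le_lintegral _ _).trans (h.lintegral_expCut_le h0 h1 hl)

theorem lintegral_expCut_rlIntLeft_le (h : SolvesMode α T lam f w) (h0 : 0 < α) (h1 : α ≤ 1)
    (hl : 0 ≤ lam) : ENNReal.ofReal lam ^ 2 * ∫⁻ t, ‖expCut T (rlIntLeft α w) t‖ₑ ^ 2 ≤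
      4 * ∫⁻ t in Ioo 0 T, ‖f t‖ₑ ^ 2 := by
  refine le_trans ?_ (mul_le_mul_right (lintegral_expCut_sq_le f) _)
  rw [lintegral_sq_eq_ofReal (h.w_mem.rlIntLeft h0).memL12_expCut.mem,
    lintegral_sq_eq_ofReal h.f_mem.memL12_expCut.mem, ← ENNReal.ofReal_pow hl,
    ← ENNReal.ofReal_mul (sq_nonneg _), show (4 : ℝ≥0∞) = ENNReal.ofReal 4 by norm_num,
    ← ENNReal.ofReal_mul (by norm_num)]
  exact ENNReal.ofReal_le_ofReal (h.integral_expInt_sq_le h0 h1 hl)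

theorem lintegral_dampedEnergy_le (h : SolvesMode α T lam f w) (h0 : 0 < α) (h1 : α < 1)
    (hl : 0 ≤ lam) : ENNReal.ofReal lam *
      ∫⁻ ξ, ENNReal.ofReal (‖damped ξ‖ ^ (-α)) * ‖realFourier (expCut T w) ξ‖ₑ ^ 2 ≤
      ENNReal.ofReal (Real.cos (α * (Real.pi / 2)))⁻¹ * ∫⁻ t in Ioo 0 T, ‖f t‖ₑ ^ 2 := by
  refine le_trans ?_ (mul_le_mul_right (lintegral_expCut_sq_le f) _)
  have hc : 0 < Real.cos (α * (Real.pi / 2)) := by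
    refine Real.cos_pos_of_mem_Ioo ⟨?_, ?_⟩ <;> nlinarith [Real.pi_pos]
  rw [← h.w_mem.memL12_expCut.ofReal_dampedEnergy h0.le,
    lintegral_sq_eq_ofReal h.f_mem.memL12_expCut.mem, ← ENNReal.ofReal_mul hl,
    ← ENNReal.ofReal_mul (inv_nonneg.2 hc.le)]
  exact ENNReal.ofReal_le_ofReal (h.dampedEnergy_le h0 h1 hl)

end SolvesMode

end Mode

/-! ## Sobolev regularity of the solution of one mode -/

theorem sobolevNormSq_congr {s T : ℝ} (hs : s < 1) {u v : ℝ → ℝ}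
    (h : u =ᵐ[volume.restrict (Ioo 0 T)] v) : sobolevNormSq s T u = sobolevNormSq s T v := by
  rw [sobolevNormSq_of_lt hs, sobolevNormSq_of_lt hs, gagliardo_congr s h]
  congr 1
  refine lintegral_congr_ae ?_
  filter_upwards [h] with t ht
  rw [ht]

theorem HasTimeDeriv.congr {X : Type*} [NormedAddCommGroup X] [NormedSpace ℝ X] {T : ℝ}
    {u v g k : ℝ → X} (h : HasTimeDeriv T u g) (hu : u =ᵐ[volume.restrict (Ioo 0 T)] v)
    (hg : g =ᵐ[volume.restrict (Ioo 0 T)] k) : HasTimeDeriv T v k := by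
  refine ⟨h.1.congr hu, h.2.1.congr hg, fun ψ hψ => ?_⟩
  have e1 : ∫ t in Ioo 0 T, deriv ψ t • v t = ∫ t in Ioo 0 T, deriv ψ t • u t := by
    refine integral_congr_ae ?_
    filter_upwards [hu] with t ht
    rw [ht]
  have e2 : ∫ t in Ioo 0 T, ψ t • k t = ∫ t in Ioo 0 T, ψ t • g t := by
    refine integral_congr_ae ?_
    filter_upwards [hg] with t ht
    rw [ht]
  rw [e1, e2, h.2.2 ψ hψ]

/-- The constant in `sobolevNormSq_le_lintegral_realFourier`. -/
def energyConst (s T : ℝ) : ℝ≥0∞ :=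
  (ENNReal.ofReal (Real.exp T ^ 2) + ENNReal.ofReal (2 * Real.exp T ^ 2) *
      (1 + multiplierConst s T)) * (1 + gagliardoConst s)

theorem energyConst_lt_top {s T : ℝ} (h0 : 0 < s) (h1 : s < 1) (hT : 0 < T) :
    energyConst s T < ⊤ := by
  have := multiplierConst_lt_top h1 hT
  have h2 := gagliardoConst_lt_top h0 h1
  unfold energyConst
  finiteness

theorem MemL12.lintegral_expInt_sq_le_realFourier {G : ℝ → ℝ} (hG : MemL12 G) {γ δ : ℝ}
    (hγ : 0 < γ) (hδ : δ ≤ 2 * γ) : ∫⁻ t, ‖_root_.expInt γ G t‖ₑ ^ 2 ≤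
      ∫⁻ ξ, ENNReal.ofReal (‖damped ξ‖ ^ (-δ)) * ‖realFourier G ξ‖ₑ ^ 2 := by
  rw [← (hG.expInt hγ).plancherel]
  refine lintegral_mono fun ξ => ?_
  rw [hG.realFourier_expInt hγ, enorm_mul, mul_pow]
  refine mul_le_mul_left ?_ _
  have hz : 0 < ‖damped ξ‖ := norm_pos_iff.2 (damped_ne_zero ξ)
  rw [← ofReal_norm, norm_damped_cpow, ← ENNReal.ofReal_pow (by positivity)]
  refine ENNReal.ofReal_le_ofReal ?_
  rw [← Real.rpow_natCast, ← Real.rpow_mul hz.le]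
  refine Real.rpow_le_rpow_of_exponent_le (one_le_norm_damped ξ) ?_
  push_cast
  linarith

/-- Fractional integration of order γ gains γ derivatives, so the H^s norm costs the Fourier weight
|z|^{-2(γ-s)}. The L² part is dominated by the same weight because s > 0 and |z| ≥ 1. -/
theorem MemL12.sobolevNormSq_le_lintegral_realFourier {G u : ℝ → ℝ} (hG : MemL12 G) {γ s T : ℝ}
    (hγ : 0 < γ) (h0 : 0 < s) (h1 : s < 1)
    (hu : ∀ᵐ t ∂volume.restrict (Ioo 0 T), u t = Real.exp t * _root_.expInt γ G t) :
    sobolevNormSq s T u ≤ energyConst s T *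
      ∫⁻ ξ, ENNReal.ofReal (‖damped ξ‖ ^ (-(2 * γ - 2 * s))) * ‖realFourier G ξ‖ₑ ^ 2 := by
  rw [sobolevNormSq_congr h1 hu]
  refine (sobolevNormSq_exp_mul_le h1 (hG.expInt hγ) fun _ _ => rfl).trans ?_
  rw [energyConst, mul_assoc]
  refine mul_le_mul_right ?_ _
  rw [add_mul, one_mul]
  exact add_le_add (hG.lintegral_expInt_sq_le_realFourier hγ (by linarith))
    (hG.gagliardo_expInt_le hγ h0)

/-! ### Test functions in time and the primitive I^1 -/

theorem IsTestFun.memL2 {T : ℝ} {ψ : ℝ → ℝ} (hψ : IsTestFun (Ioo 0 T) ψ) : MemL2 T ψ :=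
  (hψ.1.continuous.memLp_of_hasCompactSupport hψ.2.1).restrict _

theorem IsTestFun.memL2_deriv {T : ℝ} {ψ : ℝ → ℝ} (hψ : IsTestFun (Ioo 0 T) ψ) :
    MemL2 T (deriv ψ) :=
  ((hψ.1.continuous_deriv (by simp)).memLp_of_hasCompactSupport hψ.2.1.deriv).restrict _

theorem IsTestFun.eq_zero {E : Type*} [NormedAddCommGroup E] [NormedSpace ℝ E] {U : Set E}
    {ψ : E → ℝ} (hψ : IsTestFun U ψ) {x : E} (hx : x ∉ U) : ψ x = 0 :=
  image_eq_zero_of_notMem_tsupport fun h => hx (hψ.2.2 h)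

theorem rlIntRight_one_deriv {T : ℝ} {ψ : ℝ → ℝ} (hψ : IsTestFun (Ioo 0 T) ψ) {s : ℝ}
    (hs : s ∈ Ioo 0 T) : rlIntRight 1 T (deriv ψ) s = -ψ s := by
  simp only [rlIntRight, Real.Gamma_one, inv_one, one_smul, sub_self, Real.rpow_zero]
  rw [← integral_Ioc_eq_integral_Ioo, ← intervalIntegral.integral_of_le hs.2.le,
    intervalIntegral.integral_deriv_eq_sub (fun x _ => (hψ.1.differentiable (by simp)) x)
    ((hψ.1.continuous_deriv (by simp)).intervalIntegrable _ _), hψ.eq_zero (by simp), zero_sub]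

/-- Duality with the right integral: applied to ψ' with ψ a test function, it returns -ψ. -/
theorem hasTimeDeriv_rlIntLeft_one {T : ℝ} {v : ℝ → ℝ} (hv : MemL2 T v) :
    HasTimeDeriv T (rlIntLeft 1 v) v := by
  refine ⟨integrableOn_rlIntLeft one_pos hv.integrableOn, hv.integrableOn, fun ψ hψ => ?_⟩
  have h := integral_mul_rlIntRight one_pos hv hψ.memL2_deriv
  rw [← integral_neg]
  have e1 : ∫ t in Ioo 0 T, deriv ψ t • rlIntLeft 1 v t =
      ∫ t in Ioo 0 T, rlIntLeft 1 v t * deriv ψ t :=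
    integral_congr_ae (ae_of_all _ fun t => by simp only [smul_eq_mul]; ring)
  rw [e1, ← h]
  refine setIntegral_congr_fun measurableSet_Ioo fun t ht => ?_
  simp only [rlIntRight_one_deriv hψ ht, smul_eq_mul]
  ring

theorem sobolevNormSq_rlIntLeft_one_le {s T : ℝ} (h0 : 0 < s) (h1 : s < 1) {g : ℝ → ℝ}
    (hg : MemL2 T g) : sobolevNormSq s T (rlIntLeft 1 g) ≤
      energyConst s T * ∫⁻ t in Ioo 0 T, ‖g t‖ₑ ^ 2 := by
  have e : ∀ᵐ t ∂volume.restrict (Ioo 0 T),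
      rlIntLeft 1 g t = Real.exp t * expInt 1 (expCut T g) t := by
    rw [ae_restrict_iff' measurableSet_Ioo]
    exact ae_of_all _ fun t ht => rlIntLeft_eq_expInt 1 g ht
  refine (hg.memL12_expCut.sobolevNormSq_le_lintegral_realFourier one_pos h0 h1 e).trans
    (mul_le_mul_right ?_ _)
  refine le_trans ?_ (lintegral_expCut_sq_le g)
  rw [← hg.memL12_expCut.plancherel]
  refine lintegral_mono fun ξ => mul_le_of_le_one_left' ?_
  rw [← ENNReal.ofReal_one]
  refine ENNReal.ofReal_le_ofReal ?_
  exact Real.rpow_le_one_of_one_le_of_nonpos (one_le_norm_damped ξ) (by linarith)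

theorem rlIntLeft_one_deriv {T : ℝ} {ψ : ℝ → ℝ} (hψ : IsTestFun (Ioo 0 T) ψ) {s : ℝ}
    (hs : s ∈ Ioo 0 T) : rlIntLeft 1 (deriv ψ) s = ψ s := by
  simp only [rlIntLeft, Real.Gamma_one, inv_one, one_smul, sub_self, Real.rpow_zero]
  rw [← integral_Ioc_eq_integral_Ioo, ← intervalIntegral.integral_of_le hs.1.le,
    intervalIntegral.integral_deriv_eq_sub (fun x _ => (hψ.1.differentiable (by simp)) x)
    ((hψ.1.continuous_deriv (by simp)).intervalIntegrable _ _), hψ.eq_zero (x := 0) (by simp), sub_zero]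

/-- A test function is the primitive of its derivative, so the bound for I^1 on L² applies. -/
theorem IsTestFun.sobolevNormSq_lt_top {s T : ℝ} (h0 : 0 < s) (h1 : s < 1) (hT : 0 < T)
    {ψ : ℝ → ℝ} (hψ : IsTestFun (Ioo 0 T) ψ) : sobolevNormSq s T ψ < ⊤ := by
  have e : ψ =ᵐ[volume.restrict (Ioo 0 T)] rlIntLeft 1 (deriv ψ) :=
    (ae_restrict_iff' measurableSet_Ioo).2 (ae_of_all _ fun t ht => (rlIntLeft_one_deriv hψ ht).symm)
  rw [sobolevNormSq_congr h1 e]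
  exact (sobolevNormSq_rlIntLeft_one_le h0 h1 hψ.memL2_deriv).trans_lt
    (ENNReal.mul_lt_top (energyConst_lt_top h0 h1 hT)
      (lintegral_lt_top_of_memLp_two hψ.memL2_deriv))

namespace SolvesMode

variable {α T lam : ℝ} {f w : ℝ → ℝ}

theorem sobolevNormSq_one_le (h : SolvesMode α T lam f w) (h0 : 0 < α) (h1 : α ≤ 1)
    (hl : 0 ≤ lam) : sobolevNormSq 1 T (rlIntLeft 1 w) ≤
      ((ENNReal.ofReal (Real.exp T ^ 2) + 1) * ENNReal.ofReal (Real.exp T ^ 2)) *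
        ∫⁻ t in Ioo 0 T, ‖f t‖ₑ ^ 2 := by
  rw [sobolevNormSq, if_neg (lt_irrefl _), mul_assoc, add_mul, one_mul]
  have hw := h.lintegral_w_le h0 h1 hl
  refine add_le_add ((lintegral_rlIntLeft_sq_le one_pos h.w_mem).trans (mul_le_mul_right hw _)) ?_
  exact (iInf₂_le w (hasTimeDeriv_rlIntLeft_one h.w_mem)).trans hw

/-- With γ = 1 the required Fourier weight is |z|^{-(2-2s)}, and the coercive energy of w controls
|z|^{-α}. The exponent s = 1 - α/2 is exactly the borderline. -/
theorem lam_mul_sobolevNormSq_le (h : SolvesMode α T lam f w) (h0 : 0 < α) (h1 : α < 1)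
    (hl : 0 ≤ lam) {s : ℝ} (hs0 : 0 < s) (hs : s ≤ 1 - α / 2) :
    ENNReal.ofReal lam * sobolevNormSq s T (rlIntLeft 1 w) ≤
      (energyConst s T * ENNReal.ofReal (Real.cos (α * (Real.pi / 2)))⁻¹) *
        ∫⁻ t in Ioo 0 T, ‖f t‖ₑ ^ 2 := by
  have e : ∀ᵐ t ∂volume.restrict (Ioo 0 T),
      rlIntLeft 1 w t = Real.exp t * expInt 1 (expCut T w) t := by
    rw [ae_restrict_iff' measurableSet_Ioo]
    exact ae_of_all _ fun t ht => rlIntLeft_eq_expInt 1 w ht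
  have := h.w_mem.memL12_expCut.sobolevNormSq_le_lintegral_realFourier one_pos
    hs0 (by linarith) e
  have h2 : ∫⁻ ξ, ENNReal.ofReal (‖damped ξ‖ ^ (-(2 * 1 - 2 * s))) *
      ‖realFourier (expCut T w) ξ‖ₑ ^ 2 ≤
      ∫⁻ ξ, ENNReal.ofReal (‖damped ξ‖ ^ (-α)) * ‖realFourier (expCut T w) ξ‖ₑ ^ 2 := by
    refine lintegral_mono fun ξ => mul_le_mul_left (ENNReal.ofReal_le_ofReal ?_) _
    exact Real.rpow_le_rpow_of_exponent_le (one_le_norm_damped ξ) (by linarith)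
  refine (mul_le_mul_right (this.trans (mul_le_mul_right h2 _)) _).trans ?_
  rw [mul_left_comm, mul_assoc]
  exact mul_le_mul_right (h.lintegral_dampedEnergy_le h0 h1 hl) _

/-- Write I^1 w = I^{1-α}(I^α w). With γ = s = 1 - α the Fourier weight disappears, and what remains
is the L² norm of the damped I^α w, bounded by f with the factor λ². -/
theorem lam_sq_mul_sobolevNormSq_le (h : SolvesMode α T lam f w) (h0 : 0 < α) (h1 : α < 1)
    (hl : 0 ≤ lam) :
    ENNReal.ofReal lam ^ 2 * sobolevNormSq (1 - α) T (rlIntLeft 1 w) ≤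
      (energyConst (1 - α) T * 4) * ∫⁻ t in Ioo 0 T, ‖f t‖ₑ ^ 2 := by
  have e : ∀ᵐ t ∂volume.restrict (Ioo 0 T),
      rlIntLeft 1 w t = Real.exp t * expInt (1 - α) (expCut T (rlIntLeft α w)) t := by
    filter_upwards [rlIntLeft_add (a := 1 - α) (b := α) (by linarith) h0 h.w_mem,
      ae_restrict_mem measurableSet_Ioo] with t ht hm
    rw [sub_add_cancel] at ht
    rw [← ht, rlIntLeft_eq_expInt _ _ hm, smul_eq_mul]
  have := (h.w_mem.rlIntLeft h0).memL12_expCut.sobolevNormSq_le_lintegral_realFourier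
    (γ := 1 - α) (s := 1 - α) (by linarith) (by linarith) (by linarith) e
  simp only [sub_self, neg_zero, Real.rpow_zero, ENNReal.ofReal_one, one_mul] at this
  rw [(h.w_mem.rlIntLeft h0).memL12_expCut.plancherel] at this
  refine (mul_le_mul_right this _).trans ?_
  rw [mul_left_comm, mul_assoc]
  exact mul_le_mul_right (h.lintegral_expCut_rlIntLeft_le h0 h1.le hl) _

theorem lam_sq_mul_lintegral_rlIntLeft_le (h : SolvesMode α T lam f w) (h0 : 0 < α) (h1 : α ≤ 1)
    (hl : 0 ≤ lam) : ENNReal.ofReal lam ^ 2 * ∫⁻ t in Ioo 0 T, ‖rlIntLeft α w t‖ₑ ^ 2 ≤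
      (ENNReal.ofReal (Real.exp T ^ 2) * 4) * ∫⁻ t in Ioo 0 T, ‖f t‖ₑ ^ 2 := by
  have e : ∫⁻ t in Ioo 0 T, ‖rlIntLeft α w t‖ₑ ^ 2 =
      ∫⁻ t in Ioo 0 T, ‖Real.exp t • expCut T (rlIntLeft α w) t‖ₑ ^ 2 := by
    refine setLIntegral_congr_fun measurableSet_Ioo fun t ht => ?_
    rw [expCut_of_mem ht, smul_smul, ← Real.exp_add]
    simp
  rw [e]
  refine (mul_le_mul_right (lintegral_exp_smul_sq_le _) _).trans ?_
  rw [mul_left_comm, mul_assoc]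
  exact mul_le_mul_right ((mul_le_mul_right (setLIntegral_le_lintegral _ _) _).trans
    (h.lintegral_expCut_rlIntLeft_le h0 h1 hl)) _

end SolvesMode

/-! ### Duality between the fractional derivative of a mode and H^{α/2}(0,T) -/

theorem norm_damped_rpow_le {α : ℝ} (h0 : 0 ≤ α) (h1 : α ≤ 1) (ξ : ℝ) :
    ‖damped ξ‖ ^ α ≤ 1 + (2 * Real.pi) ^ α * |ξ| ^ α := by
  have h : ‖damped ξ‖ ≤ 1 + 2 * Real.pi * |ξ| := by
    refine (norm_add_le _ _).trans (le_of_eq ?_)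
    rw [norm_one, norm_mul, Complex.norm_I, mul_one, Complex.norm_real, Real.norm_eq_abs, abs_mul,
      abs_of_pos (by positivity : (0 : ℝ) < 2 * Real.pi)]
  refine (Real.rpow_le_rpow (norm_nonneg _) h h0).trans ?_
  refine (Real.rpow_add_le_add_rpow zero_le_one (by positivity) h0 h1).trans ?_
  rw [Real.one_rpow, Real.mul_rpow (by positivity) (abs_nonneg _)]

/-- The constant in `MemL12.lintegral_damped_rpow_le`. -/
def dualConst (α T : ℝ) : ℝ≥0∞ :=
  ENNReal.ofReal (Real.exp T ^ 2) +
    ENNReal.ofReal ((2 * Real.pi) ^ α) * ((gagliardoConst (α / 2))⁻¹ * zeroExtensionConst α T)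

theorem dualConst_lt_top {α T : ℝ} (h1 : α < 1) (hT : 0 < T) : dualConst α T < ⊤ := by
  have := zeroExtensionConst_lt_top h1 hT
  have h2 : (gagliardoConst (α / 2))⁻¹ < ⊤ := ENNReal.inv_lt_top.2 (pos_iff_ne_zero.2
    (gagliardoConst_ne_zero _))
  exact ENNReal.add_lt_top.2 ⟨ENNReal.ofReal_lt_top,
    ENNReal.mul_lt_top ENNReal.ofReal_lt_top (ENNReal.mul_lt_top h2 this)⟩

/-- Extension by zero puts e^t v in H^{α/2} of the line; the Gagliardo identity, divided by its
nonzero constant, gives the weight |ξ|^α, and Plancherel supplies the remaining constant term. -/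
theorem MemL2.lintegral_damped_rpow_le {α T : ℝ} (h0 : 0 < α) (h1 : α < 1) (hT : 0 < T)
    {v : ℝ → ℝ} (hv : MemL2 T v) :
    ∫⁻ ξ, ENNReal.ofReal (‖damped ξ‖ ^ α) *
        ‖realFourier ((Ioo 0 T).indicator fun t => Real.exp t * v t) ξ‖ₑ ^ 2 ≤
      dualConst α T * sobolevNormSq (α / 2) T v := by
  have hV := memL12_indicator_exp_mul hv
  set V := (Ioo 0 T).indicator fun t => Real.exp t * v t with hVdef
  have hF : Measurable fun ξ => ‖realFourier V ξ‖ₑ ^ 2 :=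
    (hV.realFourier_continuous.measurable.enorm).pow_const 2
  have hm : Measurable fun ξ : ℝ => ENNReal.ofReal (|ξ| ^ α) * ‖realFourier V ξ‖ₑ ^ 2 :=
    ((measurable_norm.pow_const α).ennreal_ofReal).mul hF
  have hg := hV.gagliardo_univ_eq (α / 2)
  rw [show 2 * (α / 2) = α by ring] at hg
  have hc0 := gagliardoConst_ne_zero (α / 2)
  have hct := (gagliardoConst_lt_top (s := α / 2) (by linarith) (by linarith)).ne
  have h2 : ∫⁻ ξ, ENNReal.ofReal (|ξ| ^ α) * ‖realFourier V ξ‖ₑ ^ 2 =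
      (gagliardoConst (α / 2))⁻¹ * gagliardo (α / 2) univ V := by
    rw [hg, ← mul_assoc, ENNReal.inv_mul_cancel hc0 hct, one_mul]
  have h3 : ∫⁻ t, ‖V t‖ₑ ^ 2 ≤ ENNReal.ofReal (Real.exp T ^ 2) * sobolevNormSq (α / 2) T v := by
    have : ∫⁻ t, ‖V t‖ₑ ^ 2 = ∫⁻ t in Ioo 0 T, ‖Real.exp t • v t‖ₑ ^ 2 := by
      rw [← lintegral_indicator measurableSet_Ioo]
      refine lintegral_congr fun t => ?_
      by_cases ht : t ∈ Ioo 0 T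
      · rw [indicator_of_mem ht, hVdef, indicator_of_mem ht, smul_eq_mul]
      · rw [indicator_of_notMem ht, hVdef, indicator_of_notMem ht]; simp
    rw [this]
    refine (lintegral_exp_smul_sq_le _).trans (mul_le_mul_right ?_ _)
    rw [sobolevNormSq]
    exact le_self_add
  calc _ ≤ ∫⁻ ξ, (‖realFourier V ξ‖ₑ ^ 2 + ENNReal.ofReal ((2 * Real.pi) ^ α) *
          (ENNReal.ofReal (|ξ| ^ α) * ‖realFourier V ξ‖ₑ ^ 2)) := by
        refine lintegral_mono fun ξ => ?_
        refine (mul_le_mul_left (ENNReal.ofReal_le_ofReal (norm_damped_rpow_le h0.le h1.le ξ))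
          _).trans (le_of_eq ?_)
        rw [ENNReal.ofReal_add zero_le_one (by positivity), ENNReal.ofReal_mul (by positivity),
          ENNReal.ofReal_one]
        ring
    _ = (∫⁻ t, ‖V t‖ₑ ^ 2) + ENNReal.ofReal ((2 * Real.pi) ^ α) *
          ((gagliardoConst (α / 2))⁻¹ * gagliardo (α / 2) univ V) := by
        rw [lintegral_add_left hF, lintegral_const_mul _ hm, h2, hV.plancherel]
    _ ≤ ENNReal.ofReal (Real.exp T ^ 2) * sobolevNormSq (α / 2) T v +
          ENNReal.ofReal ((2 * Real.pi) ^ α) * ((gagliardoConst (α / 2))⁻¹ *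
            (zeroExtensionConst α T * sobolevNormSq (α / 2) T v)) := by
        gcongr
        exact gagliardo_zeroExtension_exp_le h0 h1 hT hv
    _ = _ := by rw [dualConst]; ring

/-- Since D^α I^1 w = I^{1-α} w, this is the bound of the fractional derivative in the dual of
H^{α/2}. After Parseval, Cauchy–Schwarz splits the weight as |z|^{-α/2} |z|^{α/2}: one factor is the
coercive energy of w, which absorbs λ, the other the H^{α/2} norm of v. -/
theorem SolvesMode.lam_mul_sq_integral_le {α T lam : ℝ} {f w : ℝ → ℝ}
    (h : SolvesMode α T lam f w) (h0 : 0 < α) (h1 : α < 1) (hT : 0 < T) (hl : 0 ≤ lam)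
    {v : ℝ → ℝ} (hv : MemL2 T v) :
    ENNReal.ofReal lam * ‖∫ t in Ioo 0 T, rlIntLeft (1 - α) w t * v t‖ₑ ^ 2 ≤
      (ENNReal.ofReal (Real.cos (α * (Real.pi / 2)))⁻¹ * dualConst α T) *
        ((∫⁻ t in Ioo 0 T, ‖f t‖ₑ ^ 2) * sobolevNormSq (α / 2) T v) := by
  have hV := memL12_indicator_exp_mul hv
  have hW := h.w_mem.memL12_expCut
  have hest := hv.lintegral_damped_rpow_le h0 h1 hT
  set V := (Ioo 0 T).indicator fun t => Real.exp t * v t with hVdef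
  set W := expCut T w with hWdef
  have e : ∫ t in Ioo 0 T, rlIntLeft (1 - α) w t * v t = ∫ t, expInt (1 - α) W t * V t := by
    rw [← integral_indicator measurableSet_Ioo]
    refine integral_congr_ae (ae_of_all _ fun t => ?_)
    by_cases ht : t ∈ Ioo 0 T
    · simp only [hVdef, indicator_of_mem ht]
      rw [rlIntLeft_eq_expInt _ _ ht, smul_eq_mul]
      ring
    · simp only [hVdef, indicator_of_notMem ht, mul_zero]
  have hα : 0 < 1 - α := by linarith
  have hme : ∀ p : ℝ, Measurable fun ξ => ENNReal.ofReal (‖damped ξ‖ ^ p) := fun p =>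
    ((continuous_damped.measurable.norm).pow_const p).ennreal_ofReal
  have hWm := hW.realFourier_continuous.measurable.enorm
  have hVm := hV.realFourier_continuous.measurable.enorm
  have hp := (hW.expInt hα).parseval hV
  have h2 : ‖∫ t, expInt (1 - α) W t * V t‖ₑ ≤
      ∫⁻ ξ, (ENNReal.ofReal (‖damped ξ‖ ^ (-(α / 2))) * ‖realFourier W ξ‖ₑ) *
        (ENNReal.ofReal (‖damped ξ‖ ^ (α / 2)) * ‖realFourier V ξ‖ₑ) := by
    have : ‖∫ t, expInt (1 - α) W t * V t‖ₑ =
        ‖((∫ t, expInt (1 - α) W t * V t : ℝ) : ℂ)‖ₑ := by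
      rw [← ofReal_norm, ← ofReal_norm, Complex.norm_real]
    rw [this, ← hp]
    refine (enorm_integral_le_lintegral_enorm _).trans (lintegral_mono fun ξ => ?_)
    have hz : 0 < ‖damped ξ‖ := norm_pos_iff.2 (damped_ne_zero ξ)
    rw [hW.realFourier_expInt hα, enorm_mul, enorm_mul, RCLike.enorm_conj, mul_mul_mul_comm,
      mul_assoc, ← ENNReal.ofReal_mul (by positivity), ← Real.rpow_add hz]
    refine mul_le_mul_left ?_ _
    rw [← ofReal_norm, norm_damped_cpow]
    refine ENNReal.ofReal_le_ofReal ?_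
    -- The right-hand exponent is -α/2 + α/2 = 0, so the claim is |z|^{-(1-α)} ≤ 1.
    refine Real.rpow_le_rpow_of_exponent_le (one_le_norm_damped ξ) ?_
    linarith
  have hsq : ∀ (p ξ : ℝ), ENNReal.ofReal (‖damped ξ‖ ^ p) ^ 2 =
      ENNReal.ofReal (‖damped ξ‖ ^ (2 * p)) := fun p ξ => by
    rw [← ENNReal.ofReal_pow (by positivity), ← Real.rpow_natCast, ← Real.rpow_mul (norm_nonneg _)]
    congr 2
    push_cast
    ring
  have h3 : ‖∫ t, expInt (1 - α) W t * V t‖ₑ ^ 2 ≤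
      (∫⁻ ξ, ENNReal.ofReal (‖damped ξ‖ ^ (-α)) * ‖realFourier W ξ‖ₑ ^ 2) *
        ∫⁻ ξ, ENNReal.ofReal (‖damped ξ‖ ^ α) * ‖realFourier V ξ‖ₑ ^ 2 := by
    refine (pow_le_pow_left' h2 2).trans ((sq_lintegral_mul_le ((hme _).mul hWm).aemeasurable
      ((hme _).mul hVm).aemeasurable).trans (le_of_eq ?_))
    congr 1 <;> refine lintegral_congr fun ξ => ?_
    · rw [Pi.mul_apply, mul_pow, hsq, show 2 * -(α / 2) = -α by ring]
    · rw [Pi.mul_apply, mul_pow, hsq, show 2 * (α / 2) = α by ring]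
  rw [e]
  calc _ ≤ (ENNReal.ofReal lam * ∫⁻ ξ, ENNReal.ofReal (‖damped ξ‖ ^ (-α)) *
          ‖realFourier W ξ‖ₑ ^ 2) *
          ∫⁻ ξ, ENNReal.ofReal (‖damped ξ‖ ^ α) * ‖realFourier V ξ‖ₑ ^ 2 := by
        rw [mul_assoc]
        exact mul_le_mul_right h3 _
    _ ≤ (ENNReal.ofReal (Real.cos (α * (Real.pi / 2)))⁻¹ * ∫⁻ t in Ioo 0 T, ‖f t‖ₑ ^ 2) *
          (dualConst α T * sobolevNormSq (α / 2) T v) :=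
        mul_le_mul' (h.lintegral_dampedEnergy_le h0 h1 hl) hest
    _ = _ := by ring

/-! ## Uniqueness for one mode -/

/-- The primitive vanishes to the left of the support, and to the right of it because the total
integral is zero; so it is again compactly supported in the interval. -/
theorem IsTestFun.primitive {a b : ℝ} {φ : ℝ → ℝ} (hφ : IsTestFun (Ioo a b) φ)
    (h : ∫ t, φ t = 0) : ∃ ψ : ℝ → ℝ, IsTestFun (Ioo a b) ψ ∧ deriv ψ = φ := by
  have hc := hφ.1.continuous
  have hd : ∀ x, HasDerivAt (fun x => ∫ t in a..x, φ t) (φ x) x := fun x =>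
    intervalIntegral.integral_hasDerivAt_right (hc.intervalIntegrable _ _)
      (hc.stronglyMeasurableAtFilter _ _) hc.continuousAt
  have hderiv : deriv (fun x => ∫ t in a..x, φ t) = φ := funext fun x => (hd x).deriv
  have hsupp : tsupport (fun x => ∫ t in a..x, φ t) ⊆ Ioo a b := by
    rcases (tsupport φ).eq_empty_or_nonempty with he | hne
    · have : φ = 0 := by simpa [tsupport_eq_empty_iff] using he
      simp [this, tsupport]
    obtain ⟨m, hm⟩ := hφ.2.1.isCompact.exists_isLeast hne
    obtain ⟨M, hM⟩ := hφ.2.1.isCompact.exists_isGreatest hne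
    have hma := (hφ.2.2 hm.1)
    have hMb := (hφ.2.2 hM.1)
    refine Subset.trans (closure_minimal (t := Icc m M) ?_ isClosed_Icc) (Icc_subset_Ioo hma.1 hMb.2)
    intro x hx
    by_contra hx'
    apply hx
    have hz : ∀ t, t ∉ Icc m M → φ t = 0 := fun t ht =>
      image_eq_zero_of_notMem_tsupport fun ht' => ht ⟨hm.2 ht', hM.2 ht'⟩
    rcases lt_or_ge x m with h1 | h1
    · refine intervalIntegral.integral_zero_ae (ae_of_all _ fun t ht => hz t fun ht' => ?_)
      rcases mem_uIoc.1 ht with h2 | h2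
      · linarith [ht'.1, h2.2]
      · linarith [ht'.1, h2.2, hma.1]
    · have h2 : M < x := by
        by_contra h3
        exact hx' ⟨h1, not_lt.1 h3⟩
      simp only
      rw [intervalIntegral.integral_of_le (by linarith [hm.2 hM.1, hma.1]), ← h]
      refine setIntegral_eq_integral_of_forall_compl_eq_zero fun t ht => hz t fun ht' => ht ?_
      exact ⟨by linarith [ht'.1, hma.1], by linarith [ht'.2]⟩
  refine ⟨fun x => ∫ t in a..x, φ t, ⟨?_, ?_, hsupp⟩, hderiv⟩
  · rw [contDiff_infty_iff_deriv, hderiv]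
    exact ⟨fun x => (hd x).differentiableAt, hφ.1⟩
  · exact HasCompactSupport.of_support_subset_isCompact isCompact_Icc
      ((subset_tsupport _).trans (hsupp.trans Ioo_subset_Icc_self))

/-- The du Bois-Reymond lemma. The constant is the mean of g against a fixed bump of integral one.
-/
theorem ae_eq_const_of_integral_deriv_mul_eq_zero {a b : ℝ} (hab : a < b) {g : ℝ → ℝ}
    (hg : IntegrableOn g (Ioo a b))
    (h : ∀ ψ : ℝ → ℝ, IsTestFun (Ioo a b) ψ → ∫ t in Ioo a b, deriv ψ t * g t = 0) :
    ∃ c : ℝ, ∀ᵐ t ∂volume.restrict (Ioo a b), g t = c := by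
  obtain ⟨η, hη, hη1⟩ : ∃ η : ℝ → ℝ, IsTestFun (Ioo a b) η ∧ ∫ t, η t = 1 := by
    let B : ContDiffBump ((a + b) / 2) := ⟨(b - a) / 8, (b - a) / 4, by linarith, by linarith⟩
    refine ⟨B.normed volume, ⟨B.contDiff_normed, B.hasCompactSupport_normed, ?_⟩, B.integral_normed⟩
    rw [B.tsupport_normed_eq, Real.closedBall_eq_Icc]
    exact Icc_subset_Ioo (by simp only [B]; linarith) (by simp only [B]; linarith)
  have hint : ∀ φ : ℝ → ℝ, IsTestFun (Ioo a b) φ → IntegrableOn (fun t => φ t * g t) (Ioo a b) := by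
    intro φ hφ
    obtain ⟨C, hC⟩ := hφ.2.1.exists_bound_of_continuous hφ.1.continuous
    exact hg.bdd_mul hφ.1.continuous.aestronglyMeasurable (ae_of_all _ hC)
  have hset : ∀ φ : ℝ → ℝ, IsTestFun (Ioo a b) φ → ∫ t in Ioo a b, φ t = ∫ t, φ t := fun φ hφ =>
    setIntegral_eq_integral_of_forall_compl_eq_zero fun t ht => hφ.eq_zero ht
  refine ⟨∫ t in Ioo a b, η t * g t, ?_⟩
  set c := ∫ t in Ioo a b, η t * g t with hc
  have hz : ∀ᵐ t, t ∈ Ioo a b → g t - c = 0 := by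
    refine isOpen_Ioo.ae_eq_zero_of_integral_contDiff_smul_eq_zero (μ := volume)
      (f := fun t => g t - c) ?_ ?_
    · exact (hg.sub (integrableOn_const (by simp))).locallyIntegrableOn
    · intro φ hφ1 hφ2 hφ3
      have hφ : IsTestFun (Ioo a b) φ := ⟨hφ1, hφ2, hφ3⟩
      -- Subtracting the right multiple of the bump makes the integral zero, so the result is the
      -- derivative of a test function.
      have hφη : IsTestFun (Ioo a b) fun t => φ t - (∫ s, φ s) * η t :=
        ⟨hφ1.sub (contDiff_const.mul hη.1), hφ2.sub (hη.2.1.mul_left),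
          (tsupport_sub _ _).trans
            (union_subset hφ3 ((tsupport_mul_subset_right).trans hη.2.2))⟩
      have hφη0 : ∫ t, (φ t - (∫ s, φ s) * η t) = 0 := by
        rw [integral_sub (hφ1.continuous.integrable_of_hasCompactSupport hφ2)
          ((hη.1.continuous.integrable_of_hasCompactSupport hη.2.1).const_mul _),
          integral_const_mul, hη1, mul_one, sub_self]
      obtain ⟨ψ, hψ, hd⟩ := hφη.primitive hφη0
      have h1 := h ψ hψ
      rw [hd] at h1
      have h2 : ∫ t in Ioo a b, (φ t - (∫ s, φ s) * η t) * g t =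
          (∫ t in Ioo a b, φ t * g t) - (∫ s, φ s) * c := by
        rw [hc, ← integral_const_mul, ← integral_sub (hint φ hφ) ((hint η hη).const_mul _)]
        exact integral_congr_ae (ae_of_all _ fun t => by simp only; ring)
      have h3 : ∫ t, φ t • (g t - c) = ∫ t in Ioo a b, φ t • (g t - c) :=
        (setIntegral_eq_integral_of_forall_compl_eq_zero fun t ht => by
          rw [hφ.eq_zero ht, zero_smul]).symm
      have h4 : ∫ t in Ioo a b, φ t • (g t - c) =
          (∫ t in Ioo a b, φ t * g t) - (∫ t in Ioo a b, φ t) * c := by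
        rw [← integral_mul_const, ← integral_sub (hint φ hφ)
          ((hφ1.continuous.integrable_of_hasCompactSupport hφ2).integrableOn.mul_const _)]
        exact integral_congr_ae (ae_of_all _ fun t => by simp only [smul_eq_mul]; ring)
      rw [h3, h4, hset φ hφ, ← h2, h1]
  rw [ae_restrict_iff' measurableSet_Ioo]
  filter_upwards [hz] with t ht hm
  linarith [ht hm]

theorem lintegral_Ioo_rpow_lt_top {p T : ℝ} (hp : -1 < p) (hT : 0 < T) :
    ∫⁻ t in Ioo 0 T, ENNReal.ofReal (t ^ p) < ⊤ := by
  have h := (intervalIntegral.integrableOn_Ioo_rpow_iff hT).2 hp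
  refine lt_of_le_of_lt ?_ h.2
  refine lintegral_mono fun t => ?_
  rw [← ofReal_norm]
  exact ENNReal.ofReal_le_ofReal (le_abs_self _)

/-- Cauchy–Schwarz after t^{-θ} = t^{-α/2} t^{-(θ-α/2)}: the first factor is paid for by the Hardy
integral, and the square of the second is integrable exactly when 2θ - α < 1. -/
theorem lintegral_weight_lt_top {α θ T : ℝ} (hT : 0 < T) (hθ : θ < (1 + α) / 2) {v : ℝ → ℝ}
    (hv : MemL2 T v) (h : ∫⁻ t in Ioo 0 T, ‖v t‖ₑ ^ 2 * ENNReal.ofReal (t ^ (-α)) < ⊤) :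
    ∫⁻ t in Ioo 0 T, ‖v t‖ₑ * ENNReal.ofReal (t ^ (-θ)) < ⊤ := by
  have hr : ∀ p : ℝ, AEMeasurable (fun t : ℝ => ENNReal.ofReal (t ^ p))
      (volume.restrict (Ioo 0 T)) := fun p =>
    ((measurable_id.pow_const p).ennreal_ofReal).aemeasurable
  have h2 : ∫⁻ t in Ioo 0 T, (‖v t‖ₑ * ENNReal.ofReal (t ^ (-(α / 2)))) *
      ENNReal.ofReal (t ^ (-(θ - α / 2))) < ⊤ := by
    refine lintegral_mul_lt_top (hv.1.enorm.mul (hr _)) (hr _) (lt_of_le_of_lt ?_ h)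
      (lt_of_le_of_lt ?_ (lintegral_Ioo_rpow_lt_top (p := -(2 * θ - α)) (by linarith) hT))
    · refine setLIntegral_mono' measurableSet_Ioo fun t ht => ?_
      rw [mul_pow, ← ENNReal.ofReal_pow (Real.rpow_nonneg ht.1.le _), ← Real.rpow_natCast,
        ← Real.rpow_mul ht.1.le]
      push_cast
      rw [show -(α / 2) * 2 = -α by ring]
    · refine setLIntegral_mono' measurableSet_Ioo fun t ht => ?_
      rw [← ENNReal.ofReal_pow (Real.rpow_nonneg ht.1.le _), ← Real.rpow_natCast,
        ← Real.rpow_mul ht.1.le]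
      push_cast
      rw [show -(θ - α / 2) * 2 = -(2 * θ - α) by ring]
  refine lt_of_le_of_lt (setLIntegral_mono' measurableSet_Ioo fun t ht => ?_) h2
  rw [mul_assoc, ← ENNReal.ofReal_mul (Real.rpow_nonneg ht.1.le _), ← Real.rpow_add ht.1]
  rw [show -(α / 2) + -(θ - α / 2) = -θ by ring]

/-- For 0 < s < t, 1/t = t^{-(1-θ)} t^{-θ} ≤ (t-s)^{-(1-θ)} s^{-θ}. The fractional kernel becomes
(t-s)^{γ+θ-2}, still integrable because θ > 1 - γ, while s^{-θ} goes to v. This is how a fractional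
integral is shown to have no nonzero constant value near 0. -/
theorem lintegral_inv_mul_rlIntLeft_lt_top {γ θ T : ℝ} (hγ : 0 < γ) (hγ1 : γ ≤ 1)
    (hθ1 : θ ≤ 1) (hθ : 1 - γ < θ) (hT : 0 < T) {v : ℝ → ℝ} (hv : MemL2 T v)
    (h : ∫⁻ t in Ioo 0 T, ‖v t‖ₑ * ENNReal.ofReal (t ^ (-θ)) < ⊤) :
    ∫⁻ t in Ioo 0 T, ENNReal.ofReal t⁻¹ * ‖rlIntLeft γ v t‖ₑ < ⊤ := by
  have hΓ := Real.Gamma_pos_of_pos hγ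
  set k : ℝ × ℝ → ℝ≥0∞ := fun p =>
    (Ioi (0 : ℝ)).indicator (fun x => ENNReal.ofReal (x ^ (γ + θ - 2))) (p.1 - p.2) with hk
  have hkm : Measurable k := by
    have : Measurable ((Ioi (0 : ℝ)).indicator fun x => ENNReal.ofReal (x ^ (γ + θ - 2))) :=
      Measurable.indicator (by fun_prop) measurableSet_Ioi
    exact this.comp (measurable_fst.sub measurable_snd)
  set C := ∫⁻ x in Ioo 0 T, ENNReal.ofReal (x ^ (γ + θ - 2)) with hC
  have hCt : C < ⊤ := lintegral_Ioo_rpow_lt_top (by linarith) hT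
  have hinner : ∀ s ∈ Ioo 0 T, ∫⁻ t in Ioo 0 T, k (t, s) ≤ C := by
    intro s hs
    rw [hC, ← lintegral_indicator measurableSet_Ioo, ← lintegral_indicator measurableSet_Ioo,
      ← lintegral_sub_right_eq_self (fun x => (Ioo 0 T).indicator
        (fun x => ENNReal.ofReal (x ^ (γ + θ - 2))) x) s]
    refine lintegral_mono fun t => ?_
    by_cases ht : t ∈ Ioo 0 T
    · rw [indicator_of_mem ht]
      by_cases hts : 0 < t - s
      · have h1 : t - s ∈ Ioo 0 T := ⟨hts, by linarith [ht.2, hs.1]⟩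
        simp only [hk, indicator_of_mem h1, indicator_of_mem (mem_Ioi.2 hts), le_refl]
      · simp only [hk, indicator_of_notMem (show t - s ∉ Ioi (0 : ℝ) from hts), zero_le]
    · rw [indicator_of_notMem ht]
      exact zero_le
  have hpt : ∀ t ∈ Ioo 0 T, ENNReal.ofReal t⁻¹ * ‖rlIntLeft γ v t‖ₑ ≤
      ENNReal.ofReal (Real.Gamma γ)⁻¹ *
        ∫⁻ s in Ioo 0 T, k (t, s) * (‖v s‖ₑ * ENNReal.ofReal (s ^ (-θ))) := by
    intro t ht
    rw [rlIntLeft, enorm_smul, Real.enorm_of_nonneg (inv_nonneg.2 hΓ.le), mul_left_comm]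
    refine mul_le_mul_right ?_ _
    refine (mul_le_mul_right (enorm_integral_le_lintegral_enorm _) _).trans ?_
    rw [← lintegral_const_mul' _ _ ENNReal.ofReal_ne_top]
    refine le_trans (setLIntegral_mono' measurableSet_Ioo fun s hs => ?_)
      (lintegral_mono' (Measure.restrict_mono (Ioo_subset_Ioo_right ht.2.le) le_rfl) le_rfl)
    have hts : 0 < t - s := by linarith [hs.2]
    have hs0 := hs.1
    simp only [hk, indicator_of_mem (mem_Ioi.2 hts)]
    rw [enorm_smul, Real.enorm_of_nonneg (by positivity), mul_comm (‖v s‖ₑ), ← mul_assoc,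
      ← mul_assoc, ← ENNReal.ofReal_mul (inv_nonneg.2 ht.1.le), ← ENNReal.ofReal_mul (by positivity)]
    refine mul_le_mul_left (ENNReal.ofReal_le_ofReal ?_) _
    have e1 : t⁻¹ = t ^ (-(1 - θ)) * t ^ (-θ) := by
      rw [← Real.rpow_add ht.1, ← Real.rpow_neg_one]; congr 1; ring
    have e2 : (t - s) ^ (γ + θ - 2) = (t - s) ^ (-(1 - θ)) * (t - s) ^ (γ - 1) := by
      rw [← Real.rpow_add hts]; congr 1; ring
    have e3 : t ^ (-(1 - θ)) ≤ (t - s) ^ (-(1 - θ)) :=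
      Real.rpow_le_rpow_of_nonpos hts (by linarith) (by linarith)
    have e4 : t ^ (-θ) ≤ s ^ (-θ) := Real.rpow_le_rpow_of_nonpos hs0 hs.2.le (by linarith)
    have p1 : 0 ≤ (t - s) ^ (γ - 1) := by positivity
    have p2 : 0 ≤ t ^ (-θ) := Real.rpow_nonneg ht.1.le _
    have p3 : 0 ≤ (t - s) ^ (-(1 - θ)) := by positivity
    rw [e1, e2]
    calc _ ≤ (t - s) ^ (-(1 - θ)) * s ^ (-θ) * (t - s) ^ (γ - 1) :=
          mul_le_mul_of_nonneg_right (mul_le_mul e3 e4 p2 p3) p1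
      _ = _ := by ring
  have hvm : AEMeasurable (fun s => ‖v s‖ₑ * ENNReal.ofReal (s ^ (-θ)))
      (volume.restrict (Ioo 0 T)) :=
    hv.1.enorm.mul ((measurable_id.pow_const (-θ)).ennreal_ofReal).aemeasurable
  refine (setLIntegral_mono' measurableSet_Ioo hpt).trans_lt ?_
  rw [lintegral_const_mul' _ _ ENNReal.ofReal_ne_top]
  refine ENNReal.mul_lt_top ENNReal.ofReal_lt_top ?_
  have hjm : AEMeasurable (fun p : ℝ × ℝ => k (p.1, p.2) *
      (‖v p.2‖ₑ * ENNReal.ofReal (p.2 ^ (-θ))))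
      ((volume.restrict (Ioo 0 T)).prod (volume.restrict (Ioo 0 T))) :=
    hkm.aemeasurable.mul hvm.comp_snd
  rw [lintegral_lintegral_swap hjm]
  have hle : ∫⁻ s in Ioo 0 T, ∫⁻ t in Ioo 0 T, k (t, s) * (‖v s‖ₑ * ENNReal.ofReal (s ^ (-θ))) ≤
      ∫⁻ s in Ioo 0 T, C * (‖v s‖ₑ * ENNReal.ofReal (s ^ (-θ))) := by
    refine setLIntegral_mono' measurableSet_Ioo fun s hs => ?_
    have hks : Measurable fun t => k (t, s) := hkm.comp measurable_prodMk_right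
    rw [lintegral_mul_const _ hks]
    exact mul_le_mul_left (hinner s hs) _
  refine hle.trans_lt ?_
  rw [lintegral_const_mul' _ _ hCt.ne]
  exact ENNReal.mul_lt_top hCt h

theorem eq_zero_of_lintegral_inv_lt_top {c T : ℝ} (hT : 0 < T)
    (h : ∫⁻ t in Ioo 0 T, ENNReal.ofReal t⁻¹ * ‖c‖ₑ < ⊤) : c = 0 := by
  by_contra hc
  have h1 : ‖c‖ₑ ≠ 0 := by simpa using hc
  rw [lintegral_mul_const' _ _ (by simp)] at h
  have h2 : ∫⁻ t in Ioo 0 T, ENNReal.ofReal t⁻¹ < ⊤ := by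
    by_contra h'
    rw [not_lt, top_le_iff] at h'
    rw [h', ENNReal.top_mul h1] at h
    exact lt_irrefl _ h
  have h3 : IntegrableOn (fun t : ℝ => t ^ (-1 : ℝ)) (Ioo 0 T) := by
    refine ⟨(measurable_id.pow_const _).aestronglyMeasurable, lt_of_le_of_lt ?_ h2⟩
    refine setLIntegral_mono' measurableSet_Ioo fun t ht => ?_
    simp only [Real.rpow_neg_one]
    rw [Real.enorm_of_nonneg (inv_nonneg.2 ht.1.le)]
  have := (intervalIntegral.integrableOn_Ioo_rpow_iff hT).1 h3
  linarith

theorem hardy_lt_top {α T : ℝ} (h0 : 0 < α) (h1 : α < 1) (hT : 0 < T) {v : ℝ → ℝ}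
    (hv : MemL2 T v) (hs : sobolevNormSq (α / 2) T v < ⊤) :
    ∫⁻ t in Ioo 0 T, ‖v t‖ₑ ^ 2 * ENNReal.ofReal (t ^ (-α)) < ⊤ := by
  have he := hv.1.ae_eq_mk
  set g := hv.1.mk v with hg
  rw [sobolevNormSq_congr (by linarith) he, sobolevNormSq_of_lt (by linarith)] at hs
  have h2 : ∫⁻ t in Ioo 0 T, ‖v t‖ₑ ^ 2 * ENNReal.ofReal (t ^ (-α)) =
      ∫⁻ t in Ioo 0 T, ‖g t‖ₑ ^ 2 * ENNReal.ofReal (t ^ (-α)) := by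
    refine lintegral_congr_ae ?_
    filter_upwards [he] with t ht
    rw [ht]
  rw [h2]
  refine (hardy h0 h1 hT hv.1.stronglyMeasurable_mk.measurable ?_).trans_lt
    (ENNReal.mul_lt_top (hardyC_lt_top α T) hs)
  exact (le_self_add).trans_lt hs

/-- Test the damped equation with the damped y: the I^1 term is nonnegative and the I^{1-α} term is
coercive, so the damped energy of y vanishes. -/
theorem ae_eq_zero_of_rlIntLeft_add {α lam T : ℝ} (h0 : 0 < α) (h1 : α < 1) (hl : 0 ≤ lam)
    {y : ℝ → ℝ} (hy : MemL2 T y)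
    (h : ∀ᵐ t ∂volume.restrict (Ioo 0 T), rlIntLeft (1 - α) y t + lam * rlIntLeft 1 y t = 0) :
    y =ᵐ[volume.restrict (Ioo 0 T)] 0 := by
  have hY := hy.memL12_expCut
  have hα : 0 < 1 - α := by linarith
  have hz : ∀ᵐ t, expInt (1 - α) (expCut T y) t * expCut T y t +
      lam * (expInt 1 (expCut T y) t * expCut T y t) = 0 := by
    rw [ae_restrict_iff' measurableSet_Ioo] at h
    filter_upwards [h] with t ht
    by_cases hm : t ∈ Ioo 0 T
    · have := ht hm
      rw [rlIntLeft_eq_expInt _ _ hm, rlIntLeft_eq_expInt _ _ hm, smul_eq_mul, smul_eq_mul] at this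
      have h3 : expInt (1 - α) (expCut T y) t + lam * expInt 1 (expCut T y) t = 0 := by
        refine (mul_eq_zero.1 (?_ : Real.exp t * _ = 0)).resolve_left (Real.exp_pos t).ne'
        linear_combination this
      linear_combination expCut T y t * h3
    · rw [expCut_of_notMem hm]; simp
  have i1 : Integrable fun t => expInt (1 - α) (expCut T y) t * expCut T y t :=
    (hY.expInt hα).mem.integrable_mul hY.mem
  have i2 : Integrable fun t => expInt 1 (expCut T y) t * expCut T y t :=
    (hY.expInt one_pos).mem.integrable_mul hY.mem
  have hsum := integral_eq_zero_of_ae hz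
  rw [integral_add i1 (i2.const_mul _), integral_const_mul] at hsum
  have h2 := mul_nonneg hl (expInt_nonneg_inner one_pos le_rfl hY)
  have h3 := hY.coercive hα (by linarith)
  have hc : 0 < Real.cos ((1 - α) * (Real.pi / 2)) := by
    refine Real.cos_pos_of_mem_Ioo ⟨?_, ?_⟩ <;> nlinarith [Real.pi_pos]
  have h4 : dampedEnergy (1 - α) (expCut T y) = 0 := by
    refine le_antisymm ?_ (dampedEnergy_nonneg _ _)
    by_contra h5
    have := mul_pos hc (not_le.1 h5)
    linarith
  have h5 := hY.ae_eq_zero_of_dampedEnergy hα.le h4.le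
  rw [Filter.EventuallyEq, ae_restrict_iff' measurableSet_Ioo]
  filter_upwards [h5] with t ht hm
  rw [expCut_of_mem hm, Pi.zero_apply, smul_eq_mul] at ht
  exact (mul_eq_zero.1 ht).resolve_left (Real.exp_pos _).ne'

theorem rlIntLeft_sub {γ T : ℝ} (hγ : 0 < γ) {u v : ℝ → ℝ} (hu : MemL2 T u) (hv : MemL2 T v) :
    ∀ᵐ t ∂volume.restrict (Ioo 0 T),
      rlIntLeft γ (fun t => u t - v t) t = rlIntLeft γ u t - rlIntLeft γ v t := by
  rw [ae_restrict_iff' measurableSet_Ioo]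
  filter_upwards [ae_integrable_expInt hγ hu.memL12_expCut.int,
    ae_integrable_expInt hγ hv.memL12_expCut.int] with t h1 h2 hm
  rw [rlIntLeft_eq_expInt _ _ hm, rlIntLeft_eq_expInt _ _ hm, rlIntLeft_eq_expInt _ _ hm, ← smul_sub,
    expInt, expInt, expInt, ← integral_sub h1 h2]
  congr 2
  funext s
  rw [← smul_sub]
  congr 1
  by_cases hs : s ∈ Ioo 0 T
  · rw [expCut_of_mem hs, expCut_of_mem hs, expCut_of_mem hs, smul_sub]
  · rw [expCut_of_notMem hs, expCut_of_notMem hs, expCut_of_notMem hs, sub_zero]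

theorem MemL2.integral_mul_integrable {T : ℝ} {u v : ℝ → ℝ} (hu : MemL2 T u) (hv : MemL2 T v) :
    IntegrableOn (fun t => u t * v t) (Ioo 0 T) := MemLp.integrable_mul hu hv

theorem hasTimeDeriv_rlIntLeft {γ T : ℝ} (hγ : 0 < γ) {w : ℝ → ℝ} (hw : MemL2 T w) :
    HasTimeDeriv T (rlIntLeft γ (rlIntLeft 1 w)) (rlIntLeft γ w) := by
  refine (hasTimeDeriv_rlIntLeft_one (hw.rlIntLeft hγ)).congr ?_ (EventuallyEq.refl _ _)
  filter_upwards [rlIntLeft_add hγ one_pos hw, rlIntLeft_add one_pos hγ hw] with t ht ht2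
  rw [ht, ht2, add_comm]

namespace SolvesMode

variable {α T lam : ℝ} {f w : ℝ → ℝ}

/-- The weak form of the equation solved by `I^1 w`. -/
theorem weak_form (h : SolvesMode α T lam f w) (h0 : 0 < α) (h1 : α < 1) {v : ℝ → ℝ}
    (hv : MemL2 T v) :
    (∫ t in Ioo 0 T, rlIntLeft (1 - α) w t * v t) + lam * ∫ t in Ioo 0 T, rlIntLeft 1 w t * v t =
      ∫ t in Ioo 0 T, f t * rlIntRight (1 - α) T v t := by
  have hα : 0 < 1 - α := by linarith
  rw [integral_mul_rlIntRight hα h.f_mem hv, ← integral_const_mul,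
    ← integral_add ((h.w_mem.rlIntLeft hα).integral_mul_integrable hv)
      (((h.w_mem.rlIntLeft one_pos).integral_mul_integrable hv).const_mul lam)]
  refine integral_congr_ae ?_
  have e1 : (fun t => w t) =ᵐ[volume.restrict (Ioo 0 T)] fun t => f t - lam * rlIntLeft α w t := by
    filter_upwards [h.eq] with t ht
    linarith
  have hr : MemL2 T fun t => lam * rlIntLeft α w t := (h.w_mem.rlIntLeft h0).const_mul lam
  filter_upwards [rlIntLeft_sub hα h.f_mem hr, rlIntLeft_add hα h0 h.w_mem,
    ae_restrict_mem measurableSet_Ioo] with t h2 h3 hm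
  rw [rlIntLeft_congr e1 hm, h2]
  have h4 : rlIntLeft (1 - α) (fun t => lam * rlIntLeft α w t) t =
      lam * rlIntLeft (1 - α) (rlIntLeft α w) t := by
    simp only [rlIntLeft, smul_eq_mul]
    rw [mul_left_comm lam, ← integral_const_mul lam]
    congr 1
    exact integral_congr_ae (ae_of_all _ fun s => mul_left_comm _ _ _)
  rw [h4, h3, sub_add_cancel]
  ring

/-- For the difference y of two solutions, the distributional equation says that I^{1-α} y + λ I^1 y
has zero derivative, hence is a constant. Regularity in H^{α/2} is what excludes a nonzero constant:
for λ = 0 the function t^{α-1} would produce one. -/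
theorem unique (h : SolvesMode α T lam f w) (h0 : 0 < α) (h1 : α < 1) (hT : 0 < T) (hl : 0 ≤ lam)
    {u : ℝ → ℝ} (hu : MemL2 T u) (hs : sobolevNormSq (α / 2) T u < ⊤)
    (hw : ∀ ψ : ℝ → ℝ, IsTestFun (Ioo 0 T) ψ →
      -(∫ t in Ioo 0 T, deriv ψ t * rlIntLeft (1 - α) u t) + lam * ∫ t in Ioo 0 T, u t * ψ t =
        ∫ t in Ioo 0 T, f t * rlIntRight (1 - α) T ψ t) :
    u =ᵐ[volume.restrict (Ioo 0 T)] rlIntLeft 1 w := by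
  have hα : 0 < 1 - α := by linarith
  have hv := h.w_mem.rlIntLeft one_pos
  set v := rlIntLeft 1 w with hvdef
  have hvs : sobolevNormSq (α / 2) T v < ⊤ :=
    (sobolevNormSq_rlIntLeft_one_le (by linarith) (by linarith) h.w_mem).trans_lt
      (ENNReal.mul_lt_top (energyConst_lt_top (by linarith) (by linarith) hT)
        (lintegral_lt_top_of_memLp_two h.w_mem))
  set y := fun t => u t - v t with hydef
  have hy : MemL2 T y := MemLp.sub hu hv
  -- The weight exponent must lie strictly between α, for the later estimate of I^{1-α}, and
  -- (1+α)/2, for Cauchy–Schwarz with Hardy. The midpoint of these bounds is taken.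
  have hyH : ∫⁻ t in Ioo 0 T, ‖y t‖ₑ * ENNReal.ofReal (t ^ (-((1 + 3 * α) / 4))) < ⊤ := by
    have a1 := lintegral_weight_lt_top (θ := (1 + 3 * α) / 4) hT (by linarith) hu
      (hardy_lt_top h0 h1 hT hu hs)
    have a2 := lintegral_weight_lt_top (θ := (1 + 3 * α) / 4) hT (by linarith) hv
      (hardy_lt_top h0 h1 hT hv hvs)
    refine lt_of_le_of_lt ?_ (ENNReal.add_lt_top.2 ⟨a1, a2⟩)
    have hm : AEMeasurable (fun t => ‖u t‖ₑ * ENNReal.ofReal (t ^ (-((1 + 3 * α) / 4))))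
        (volume.restrict (Ioo 0 T)) :=
      hu.1.enorm.mul ((measurable_id.pow_const _).ennreal_ofReal).aemeasurable
    rw [← lintegral_add_left' hm]
    refine lintegral_mono fun t => ?_
    rw [← add_mul]
    exact mul_le_mul_left (enorm_sub_le) _
  set g := fun t => rlIntLeft (1 - α) y t + lam * rlIntLeft 1 y t with hg
  have hgi : IntegrableOn g (Ioo 0 T) :=
    (hy.rlIntLeft hα).integrableOn.add ((hy.rlIntLeft one_pos).integrableOn.const_mul lam)
  -- The hypothesis on u minus the weak form of I^1 w: for the latter the fractional derivative is
  -- I^{1-α} w, and λ I^1 y is differentiated back to λ y.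
  obtain ⟨c, hc⟩ := ae_eq_const_of_integral_deriv_mul_eq_zero hT hgi fun ψ hψ => by
    have hψ' := hψ.memL2_deriv
    have e1 := hw ψ hψ
    rw [← h.weak_form h0 h1 hψ.memL2] at e1
    have e2 := (hasTimeDeriv_rlIntLeft hα h.w_mem).2.2 ψ hψ
    have e3 := (hasTimeDeriv_rlIntLeft_one hy).2.2 ψ hψ
    simp only [smul_eq_mul] at e2 e3
    have c1 : ∫ t in Ioo 0 T, rlIntLeft (1 - α) w t * ψ t =
        ∫ t in Ioo 0 T, ψ t * rlIntLeft (1 - α) w t := by simp only [mul_comm]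
    have c2 : ∫ t in Ioo 0 T, deriv ψ t * rlIntLeft (1 - α) y t =
        (∫ t in Ioo 0 T, deriv ψ t * rlIntLeft (1 - α) u t) -
          ∫ t in Ioo 0 T, deriv ψ t * rlIntLeft (1 - α) v t := by
      rw [← integral_sub (hψ'.integral_mul_integrable (hu.rlIntLeft hα))
        (hψ'.integral_mul_integrable (hv.rlIntLeft hα))]
      refine integral_congr_ae ?_
      filter_upwards [rlIntLeft_sub hα hu hv] with t ht
      rw [ht, mul_sub]
    have c3 : ∫ t in Ioo 0 T, ψ t * y t =
        (∫ t in Ioo 0 T, u t * ψ t) - ∫ t in Ioo 0 T, v t * ψ t := by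
      rw [← integral_sub (hu.integral_mul_integrable hψ.memL2)
        (hv.integral_mul_integrable hψ.memL2)]
      exact integral_congr_ae (ae_of_all _ fun t => by simp only [hydef]; ring)
    have c4 : ∫ t in Ioo 0 T, deriv ψ t * g t =
        (∫ t in Ioo 0 T, deriv ψ t * rlIntLeft (1 - α) y t) +
          lam * ∫ t in Ioo 0 T, deriv ψ t * rlIntLeft 1 y t := by
      rw [← integral_const_mul, ← integral_add (hψ'.integral_mul_integrable (hy.rlIntLeft hα))
        ((hψ'.integral_mul_integrable (hy.rlIntLeft one_pos)).const_mul lam)]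
      exact integral_congr_ae (ae_of_all _ fun t => by simp only [hg]; ring)
    rw [c4, c2, e3, c3]
    linear_combination -e1 - e2 - c1
  -- Both terms of the constant are integrable against dt/t near 0, which a nonzero constant is not.
  have hc0 : c = 0 := by
    refine eq_zero_of_lintegral_inv_lt_top hT ?_
    have b1 := lintegral_inv_mul_rlIntLeft_lt_top (θ := (1 + 3 * α) / 4) hα (by linarith)
      (by linarith) (by linarith) hT hy hyH
    have b2 := lintegral_inv_mul_rlIntLeft_lt_top (θ := (1 + 3 * α) / 4) one_pos le_rfl
      (by linarith) (by linarith) hT hy hyH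
    refine lt_of_le_of_lt ?_ (ENNReal.add_lt_top.2 ⟨b1,
      ENNReal.mul_lt_top (ENNReal.ofReal_lt_top (r := lam)) b2⟩)
    have hm : AEMeasurable (fun t => ENNReal.ofReal t⁻¹ * ‖rlIntLeft (1 - α) y t‖ₑ)
        (volume.restrict (Ioo 0 T)) :=
      (measurable_id.inv.ennreal_ofReal).aemeasurable.mul (hy.rlIntLeft hα).1.enorm
    rw [← lintegral_const_mul' _ _ ENNReal.ofReal_ne_top, ← lintegral_add_left' hm]
    refine lintegral_mono_ae ?_
    filter_upwards [hc] with t ht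
    rw [← ht, mul_left_comm, ← mul_add]
    refine mul_le_mul_right ((enorm_add_le _ _).trans ?_) _
    rw [enorm_mul, Real.enorm_of_nonneg hl]
  have hz := ae_eq_zero_of_rlIntLeft_add h0 h1 hl hy (by
    filter_upwards [hc] with t ht
    rw [← hc0, ← ht])
  filter_upwards [hz] with t ht
  simpa [hydef, sub_eq_zero] using ht

end SolvesMode

/-! ## Vector-valued functions through their coordinates -/

theorem ennreal_sq_tsum_mul_le (a b : ℕ → ℝ≥0∞) :
    (∑' i, a i * b i) ^ 2 ≤ (∑' i, a i ^ 2) * ∑' i, b i ^ 2 := by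
  have h := sq_lintegral_mul_le (μ := Measure.count) (f := a) (g := b)
    (measurable_of_countable a).aemeasurable (measurable_of_countable b).aemeasurable
  simpa only [lintegral_count] using h

section Coordinates

variable {X : Type*} [NormedAddCommGroup X] [InnerProductSpace ℝ X] (e : HilbertBasis ℕ ℝ X)
  {T : ℝ}

theorem HilbertBasis.enorm_sq_eq_tsum (x : X) : ‖x‖ₑ ^ 2 = ∑' i, ‖⟪e i, x⟫‖ₑ ^ 2 := by
  have h := lp.hasSum_norm (p := 2) (by norm_num) (e.repr x)
  simp only [ENNReal.toReal_ofNat, Real.rpow_ofNat, LinearIsometryEquiv.norm_map] at h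
  have h2 : ∀ i, ‖⟪e i, x⟫‖ₑ ^ 2 = ENNReal.ofReal (‖e.repr x i‖ ^ 2) := fun i => by
    rw [ENNReal.ofReal_pow (norm_nonneg _), ofReal_norm, e.repr_apply_apply]
  simp_rw [h2]
  rw [← ENNReal.ofReal_tsum_of_nonneg (fun i => by positivity) h.summable, h.tsum_eq,
    ENNReal.ofReal_pow (norm_nonneg _), ofReal_norm]

theorem HilbertBasis.ext_inner {x y : X} (h : ∀ i, ⟪e i, x⟫ = ⟪e i, y⟫) : x = y := by
  apply e.repr.injective
  ext i
  rw [e.repr_apply_apply, e.repr_apply_apply, h]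

theorem MemL2.inner {v : ℝ → X} (hv : MemL2 T v) (x : X) : MemL2 T fun t => ⟪x, v t⟫ :=
  MemLp.const_inner (𝕜 := ℝ) x hv

theorem MemL2.lintegral_enorm_sq_eq {v : ℝ → X} (hv : MemL2 T v) :
    ∫⁻ t in Ioo 0 T, ‖v t‖ₑ ^ 2 = ∑' i, ∫⁻ t in Ioo 0 T, ‖⟪e i, v t⟫‖ₑ ^ 2 := by
  simp_rw [e.enorm_sq_eq_tsum]
  exact lintegral_tsum fun i => ((hv.inner (e i)).1.enorm).pow_const 2

/-- A function is assembled from square summable coordinates. -/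
theorem exists_memL2_of_coordinates {c : ℕ → ℝ → ℝ} (hc : ∀ i, MemL2 T (c i))
    (hs : ∑' i, ∫⁻ t in Ioo 0 T, ‖c i t‖ₑ ^ 2 < ⊤) : ∃ U : ℝ → X, MemL2 T U ∧
      ∀ᵐ t ∂volume.restrict (Ioo 0 T), ∀ i, ⟪e i, U t⟫ = c i t := by
  classical
  have hm : ∀ i, AEMeasurable (fun t => ‖c i t‖ₑ ^ 2) (volume.restrict (Ioo 0 T)) := fun i =>
    (hc i).1.enorm.pow_const 2
  rw [← lintegral_tsum hm] at hs
  have hfin := ae_lt_top' (AEMeasurable.tsum hm) hs.ne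
  have hmem : ∀ᵐ t ∂volume.restrict (Ioo 0 T), Memℓp (fun i => c i t) 2 := by
    filter_upwards [hfin] with t ht
    apply memℓp_gen
    have h2 : ∀ i, ‖c i t‖ₑ ^ 2 = ENNReal.ofReal (‖c i t‖ ^ 2) := fun i => by
      rw [ENNReal.ofReal_pow (norm_nonneg _), ofReal_norm]
    simp_rw [h2] at ht
    have := ENNReal.summable_toReal ht.ne
    simp only [ENNReal.toReal_ofNat, Real.rpow_ofNat]
    exact this.congr fun i => ENNReal.toReal_ofReal (by positivity)
  set U : ℝ → X := fun t =>
    if h : Memℓp (fun i => c i t) 2 then e.repr.symm ⟨fun i => c i t, h⟩ else 0 with hU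
  have hcoord : ∀ᵐ t ∂volume.restrict (Ioo 0 T), ∀ i, ⟪e i, U t⟫ = c i t := by
    filter_upwards [hmem] with t ht i
    simp only [hU, dif_pos ht]
    rw [← e.repr_apply_apply, LinearIsometryEquiv.apply_symm_apply]
  refine ⟨U, ?_, hcoord⟩
  have hmeas : AEStronglyMeasurable U (volume.restrict (Ioo 0 T)) := by
    refine aestronglyMeasurable_of_tendsto_ae atTop
      (f := fun n t => ∑ i ∈ Finset.range n, c i t • e i) (fun n => ?_) ?_
    · exact Finset.aestronglyMeasurable_fun_sum _ fun i _ => (hc i).1.smul_const _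
    · filter_upwards [hmem] with t ht
      simp only [hU, dif_pos ht]
      exact (e.hasSum_repr_symm ⟨fun i => c i t, ht⟩).tendsto_sum_nat
  refine memLp_two_of_lintegral_lt_top hmeas (lt_of_le_of_lt (le_of_eq ?_) hs)
  refine lintegral_congr_ae ?_
  filter_upwards [hcoord] with t ht
  rw [e.enorm_sq_eq_tsum]
  simp_rw [ht]

/-- The exceptional null set is where the Bochner integral fails to converge, so it is the same for
all x. -/
theorem inner_rlIntLeft [CompleteSpace X] {γ : ℝ} (hγ : 0 < γ) {v : ℝ → X}
    (hv : IntegrableOn v (Ioo 0 T)) :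
    ∀ᵐ t ∂volume.restrict (Ioo 0 T), ∀ x : X,
      ⟪x, rlIntLeft γ v t⟫ = rlIntLeft γ (fun s => ⟪x, v s⟫) t := by
  rw [ae_restrict_iff' measurableSet_Ioo]
  filter_upwards [ae_integrable_expInt hγ (integrable_expCut hv)] with t ht hm x
  rw [rlIntLeft_eq_expInt _ _ hm, rlIntLeft_eq_expInt _ _ hm, expInt, expInt, inner_smul_right,
    smul_eq_mul, ← integral_inner ht]
  congr 1
  refine integral_congr_ae (ae_of_all _ fun s => ?_)
  simp only [inner_smul_right, smul_eq_mul]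
  by_cases hs : s ∈ Ioo 0 T
  · rw [expCut_of_mem hs, expCut_of_mem hs, inner_smul_right, smul_eq_mul]
  · rw [expCut_of_notMem hs, expCut_of_notMem hs, inner_zero_right]

theorem hasTimeDeriv_of_coordinates [CompleteSpace X] {U D : ℝ → X} (hU : IntegrableOn U (Ioo 0 T))
    (hD : IntegrableOn D (Ioo 0 T))
    (h : ∀ i, HasTimeDeriv T (fun t => ⟪e i, U t⟫) fun t => ⟪e i, D t⟫) : HasTimeDeriv T U D := by
  refine ⟨hU, hD, fun ψ hψ => e.ext_inner fun i => ?_⟩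
  have hb : ∀ {g : ℝ → ℝ} {V : ℝ → X}, Continuous g → HasCompactSupport g →
      IntegrableOn V (Ioo 0 T) → IntegrableOn (fun t => g t • V t) (Ioo 0 T) := by
    intro g V hg hgc hV
    obtain ⟨C, hC⟩ := hgc.exists_bound_of_continuous hg
    exact hV.bdd_smul C hg.aestronglyMeasurable (ae_of_all _ hC)
  rw [inner_neg_right, ← integral_inner (hb hψ.1.continuous hψ.2.1 hD),
    ← integral_inner (hb (hψ.1.continuous_deriv (by simp)) hψ.2.1.deriv hU)]
  simpa only [inner_smul_right, smul_eq_mul] using (h i).2.2 ψ hψ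

/-- Time reversal exchanges the two integrals; measurability and bounds for the right one are
inherited in this way. -/
theorem rlIntRight_eq_rlIntLeft_reflect (γ T : ℝ) (v : ℝ → X) (t : ℝ) :
    rlIntRight γ T v t = rlIntLeft γ (fun s => v (T - s)) (T - t) := by
  rw [rlIntRight, rlIntLeft]
  congr 1
  rw [← integral_indicator measurableSet_Ioo, ← integral_indicator measurableSet_Ioo,
    ← integral_sub_left_eq_self _ volume T]
  refine integral_congr_ae (ae_of_all _ fun s => ?_)
  by_cases hs : s ∈ Ioo 0 (T - t)
  · have h : T - s ∈ Ioo t T := ⟨by linarith [hs.2], by linarith [hs.1]⟩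
    simp only [indicator_of_mem hs, indicator_of_mem h]
    congr 2
    ring
  · have h : T - s ∉ Ioo t T := fun h => hs ⟨by linarith [h.2], by linarith [h.1]⟩
    simp only [indicator_of_notMem hs, indicator_of_notMem h]

theorem measurePreserving_reflect (T : ℝ) : MeasurePreserving (fun t : ℝ => T - t)
    (volume.restrict (Ioo 0 T)) (volume.restrict (Ioo 0 T)) := by
  have h := (Measure.measurePreserving_sub_left (volume : Measure ℝ) T).restrict_preimage
    (s := Ioo 0 T) measurableSet_Ioo
  have e : (fun t : ℝ => T - t) ⁻¹' Ioo 0 T = Ioo 0 T := by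
    ext t
    simp only [mem_preimage, mem_Ioo]
    constructor <;> rintro ⟨h1, h2⟩ <;> constructor <;> linarith
  rwa [e] at h

theorem MemL2.reflect {X : Type*} [NormedAddCommGroup X] {T : ℝ} {v : ℝ → X} (hv : MemL2 T v) : MemL2 T fun t => v (T - t) :=
  hv.comp_measurePreserving (measurePreserving_reflect T)

theorem lintegral_reflect (T : ℝ) (g : ℝ → ℝ≥0∞) :
    ∫⁻ t in Ioo 0 T, g (T - t) = ∫⁻ t in Ioo 0 T, g t :=
  (measurePreserving_reflect T).lintegral_comp_emb (MeasurableEquiv.subLeft T).measurableEmbedding g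

theorem inner_rlIntRight [CompleteSpace X] {γ : ℝ} (hγ : 0 < γ) {v : ℝ → X} (hv : MemL2 T v) :
    ∀ᵐ t ∂volume.restrict (Ioo 0 T), ∀ x : X,
      ⟪x, rlIntRight γ T v t⟫ = rlIntRight γ T (fun s => ⟪x, v s⟫) t := by
  have h := (measurePreserving_reflect T).quasiMeasurePreserving.ae
    (inner_rlIntLeft hγ hv.reflect.integrableOn)
  filter_upwards [h] with t ht x
  rw [rlIntRight_eq_rlIntLeft_reflect, rlIntRight_eq_rlIntLeft_reflect, ht x]

theorem MemL2.rlIntRight {γ : ℝ} (hγ : 0 < γ) {v : ℝ → X} (hv : MemL2 T v) :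
    MemL2 T (rlIntRight γ T v) := by
  have := (hv.reflect.rlIntLeft hγ).reflect
  refine (memLp_congr_ae (ae_of_all _ fun t => ?_)).1 this
  rw [rlIntRight_eq_rlIntLeft_reflect]

theorem lintegral_rlIntRight_sq_le {γ : ℝ} (hγ : 0 < γ) {v : ℝ → X} (hv : MemL2 T v) :
    ∫⁻ t in Ioo 0 T, ‖_root_.rlIntRight γ T v t‖ₑ ^ 2 ≤
      ENNReal.ofReal (Real.exp T ^ 2) * ∫⁻ t in Ioo 0 T, ‖v t‖ₑ ^ 2 := by
  simp_rw [rlIntRight_eq_rlIntLeft_reflect]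
  rw [lintegral_reflect T fun t => ‖_root_.rlIntLeft γ (fun s => v (T - s)) t‖ₑ ^ 2,
    ← lintegral_reflect T fun t => ‖v t‖ₑ ^ 2]
  exact lintegral_rlIntLeft_sq_le hγ hv.reflect

end Coordinates

/-- Term by term integration of a sum of products. -/
theorem hasSum_integral_mul {T : ℝ} {a b : ℕ → ℝ → ℝ} (ha : ∀ i, MemL2 T (a i))
    (hb : ∀ i, MemL2 T (b i)) (has : ∑' i, ∫⁻ t in Ioo 0 T, ‖a i t‖ₑ ^ 2 < ⊤)
    (hbs : ∑' i, ∫⁻ t in Ioo 0 T, ‖b i t‖ₑ ^ 2 < ⊤) :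
    HasSum (fun i => ∫ t in Ioo 0 T, a i t * b i t) (∫ t in Ioo 0 T, ∑' i, a i t * b i t) := by
  have hle : ∀ i, ∫⁻ t in Ioo 0 T, ‖a i t * b i t‖ₑ ≤
      (∫⁻ t in Ioo 0 T, ‖a i t‖ₑ ^ 2) + ∫⁻ t in Ioo 0 T, ‖b i t‖ₑ ^ 2 := by
    intro i
    rw [← lintegral_add_left' ((ha i).1.enorm.pow_const 2)]
    refine lintegral_mono fun t => ?_
    rw [enorm_real_sq, enorm_real_sq, ← ENNReal.ofReal_add (sq_nonneg _) (sq_nonneg _),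
      ← ofReal_norm, Real.norm_eq_abs, abs_mul]
    refine ENNReal.ofReal_le_ofReal ?_
    nlinarith [sq_abs (a i t), sq_abs (b i t), sq_nonneg (|a i t| - |b i t|),
      mul_nonneg (abs_nonneg (a i t)) (abs_nonneg (b i t))]
  have hfin : ∑' i, ∫⁻ t in Ioo 0 T, ‖a i t * b i t‖ₑ < ⊤ := by
    refine (ENNReal.tsum_le_tsum hle).trans_lt ?_
    rw [ENNReal.tsum_add]
    exact ENNReal.add_lt_top.2 ⟨has, hbs⟩
  have hint : ∀ i, IntegrableOn (fun t => a i t * b i t) (Ioo 0 T) := fun i =>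
    (ha i).integral_mul_integrable (hb i)
  refine hasSum_integral_of_summable_integral_norm hint ?_
  refine (ENNReal.summable_toReal hfin.ne).congr fun i => ?_
  rw [integral_norm_eq_lintegral_enorm (hint i).1]

theorem HasTimeDeriv.const_mul {T : ℝ} {u g : ℝ → ℝ} (h : HasTimeDeriv T u g) (c : ℝ) :
    HasTimeDeriv T (fun t => c * u t) fun t => c * g t := by
  refine ⟨h.1.const_mul c, h.2.1.const_mul c, fun ψ hψ => ?_⟩
  have := h.2.2 ψ hψ
  simp only [smul_eq_mul] at this ⊢
  simp_rw [mul_left_comm _ c]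
  rw [integral_const_mul, integral_const_mul, this]
  ring

theorem rlIntLeft_const_mul (γ c : ℝ) (u : ℝ → ℝ) (t : ℝ) :
    rlIntLeft γ (fun s => c * u s) t = c * rlIntLeft γ u t := by
  simp only [rlIntLeft, smul_eq_mul, mul_left_comm _ c]
  rw [integral_const_mul c, mul_left_comm]

theorem sobolevNormSq_const_mul {s T c : ℝ} (hs : s < 1) {u : ℝ → ℝ} :
    sobolevNormSq s T (fun t => c * u t) = ENNReal.ofReal (c ^ 2) * sobolevNormSq s T u := by
  rw [sobolevNormSq_of_lt hs, sobolevNormSq_of_lt hs, mul_add, gagliardo, gagliardo,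
    ← lintegral_const_mul' _ _ ENNReal.ofReal_ne_top, ← lintegral_const_mul' _ _
    ENNReal.ofReal_ne_top]
  congr 1
  · refine lintegral_congr fun t => ?_
    rw [enorm_mul, mul_pow, enorm_real_sq]
  · refine lintegral_congr fun t => ?_
    rw [← lintegral_const_mul' _ _ ENNReal.ofReal_ne_top]
    refine lintegral_congr fun r => ?_
    rw [← mul_sub, enorm_mul, mul_pow, enorm_real_sq c, mul_div_assoc]

/-- The case s = 1 is separate because its norm is an infimum over weak derivatives; these are
unaffected by null sets. -/
theorem sobolevNormSq_one_congr {T : ℝ} {u v : ℝ → ℝ}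
    (h : u =ᵐ[volume.restrict (Ioo 0 T)] v) : sobolevNormSq 1 T u = sobolevNormSq 1 T v := by
  simp only [sobolevNormSq, if_neg (lt_irrefl (1 : ℝ))]
  congr 1
  · refine lintegral_congr_ae ?_
    filter_upwards [h] with t ht
    rw [ht]
  · refine iInf_congr fun g => iInf_congr_Prop ⟨fun k => k.congr h (EventuallyEq.refl _ _),
      fun k => k.congr h.symm (EventuallyEq.refl _ _)⟩ fun _ => rfl

theorem lintegral_le_sobolevNormSq (s T : ℝ) (u : ℝ → ℝ) :
    ∫⁻ t in Ioo 0 T, ‖u t‖ₑ ^ 2 ≤ sobolevNormSq s T u := le_self_add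

theorem lintegral_const_mul_sq (T c : ℝ) (u : ℝ → ℝ) :
    ∫⁻ t in Ioo 0 T, ‖c * u t‖ₑ ^ 2 =
      ENNReal.ofReal (c ^ 2) * ∫⁻ t in Ioo 0 T, ‖u t‖ₑ ^ 2 := by
  rw [← lintegral_const_mul' _ _ ENNReal.ofReal_ne_top]
  refine lintegral_congr fun t => ?_
  rw [enorm_mul, mul_pow, enorm_real_sq]

theorem eLpNorm_two_eq {Z E : Type*} [MeasurableSpace Z] [NormedAddCommGroup E] (μ : Measure Z)
    (f : Z → E) : eLpNorm f 2 μ = (∫⁻ z, ‖f z‖ₑ ^ 2 ∂μ) ^ (1 / 2 : ℝ) := by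
  rw [eLpNorm_eq_lintegral_rpow_enorm_toReal (by norm_num) (by norm_num)]
  simp

/-! ## Weak gradients and the Dirichlet eigenbasis -/

theorem integrable_smul_of_memLp_two {Z E : Type*} [MeasurableSpace Z] {μ : Measure Z}
    [NormedAddCommGroup E] [NormedSpace ℝ E] {f : Z → ℝ} {g : Z → E} (hf : MemLp f 2 μ)
    (hg : MemLp g 2 μ) : Integrable (fun x => f x • g x) μ :=
  memLp_one_iff_integrable.1 (hg.smul (r := 1) hf)

theorem memLp_smul_const {Z E : Type*} [MeasurableSpace Z] {μ : Measure Z}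
    [NormedAddCommGroup E] [NormedSpace ℝ E] {f : Z → ℝ} {p : ℝ≥0∞} (hf : MemLp f p μ) (y : E) :
    MemLp (fun x => f x • y) p μ :=
  (ContinuousLinearMap.toSpanSingleton ℝ y).comp_memLp' hf

section TestFunctions

variable {d : ℕ} {Ω : Set (EuclideanSpace ℝ (Fin d))} {ψ : EuclideanSpace ℝ (Fin d) → ℝ}

theorem IsTestFun.memLp (hψ : IsTestFun Ω ψ) : MemLp ψ 2 (volume.restrict Ω) :=
  (hψ.1.continuous.memLp_of_hasCompactSupport hψ.2.1).restrict _

theorem IsTestFun.memLp_gradient (hψ : IsTestFun Ω ψ) :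
    MemLp (gradient ψ) 2 (volume.restrict Ω) := by
  refine MemLp.restrict _ (Continuous.memLp_of_hasCompactSupport ?_ ?_)
  · exact (InnerProductSpace.toDual ℝ _).symm.continuous.comp (hψ.1.continuous_fderiv (by simp))
  · exact (hψ.2.1.fderiv ℝ).comp_left (map_zero _)

theorem IsTestFun.directional (hψ : IsTestFun Ω ψ) (y : EuclideanSpace ℝ (Fin d)) :
    IsTestFun Ω fun x => fderiv ℝ ψ x y := by
  refine ⟨(hψ.1.fderiv_right (m := ∞) le_rfl).clm_apply contDiff_const,
    hψ.2.1.fderiv_apply ℝ y, ?_⟩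
  exact (tsupport_fderiv_apply_subset ℝ y).trans hψ.2.2

/-- Presents the Laplacian through gradients of the directional derivatives of ψ, which are
themselves test functions and can be inserted in the definition of the weak gradient. -/
theorem IsTestFun.laplacian_eq (hψ : IsTestFun Ω ψ) (x : EuclideanSpace ℝ (Fin d)) :
    Laplacian.laplacian ψ x = ∑ k, ⟪EuclideanSpace.basisFun (Fin d) ℝ k,
      gradient (fun z => fderiv ℝ ψ z (EuclideanSpace.basisFun (Fin d) ℝ k)) x⟫ := by
  rw [InnerProductSpace.laplacian_eq_iteratedFDeriv_orthonormalBasis ψ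
    (EuclideanSpace.basisFun (Fin d) ℝ)]
  refine Finset.sum_congr rfl fun k _ => ?_
  rw [iteratedFDeriv_two_apply, real_inner_comm, inner_gradient_left]
  have h : DifferentiableAt ℝ (fderiv ℝ ψ) x :=
    ((hψ.1.fderiv_right (m := ∞) le_rfl).differentiable (by simp)) x
  rw [fderiv_clm_apply h (differentiableAt_const _)]
  simp

theorem IsTestFun.memLp_laplacian (hψ : IsTestFun Ω ψ) :
    MemLp (Laplacian.laplacian ψ) 2 (volume.restrict Ω) := by
  have e : Laplacian.laplacian ψ = fun x => ∑ k, ⟪EuclideanSpace.basisFun (Fin d) ℝ k,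
      gradient (fun z => fderiv ℝ ψ z (EuclideanSpace.basisFun (Fin d) ℝ k)) x⟫ :=
    funext hψ.laplacian_eq
  rw [e]
  exact memLp_finsetSum _ fun k _ => MemLp.const_inner (𝕜 := ℝ) _ (hψ.directional _).memLp_gradient

end TestFunctions

section WeakGradient

variable {d : ℕ} {Ω : Set (EuclideanSpace ℝ (Fin d))}

theorem integral_mul_eq_inner {g : EuclideanSpace ℝ (Fin d) → ℝ}
    (hg : MemLp g 2 (volume.restrict Ω)) (w : L2 Ω) :
    ∫ x in Ω, w x * g x = ⟪hg.toLp g, w⟫ := by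
  rw [L2.inner_def]
  refine integral_congr_ae ?_
  filter_upwards [hg.coeFn_toLp] with x hx
  rw [hx]
  rfl

theorem integral_inner_eq_inner {g : EuclideanSpace ℝ (Fin d) → EuclideanSpace ℝ (Fin d)}
    (hg : MemLp g 2 (volume.restrict Ω)) (G : L2Vec Ω) :
    ∫ x in Ω, ⟪g x, G x⟫ = ⟪hg.toLp g, G⟫ := by
  rw [L2.inner_def]
  refine integral_congr_ae ?_
  filter_upwards [hg.coeFn_toLp] with x hx
  rw [hx]

/-- Tested componentwise, being a weak gradient is a family of identities between continuous linear
functionals of w and G, so it passes to convergent series. -/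
theorem hasWeakGrad_iff {w : L2 Ω} {G : L2Vec Ω} : HasWeakGrad Ω w G ↔
    ∀ ψ, ∀ hψ : IsTestFun Ω ψ, ∀ y : EuclideanSpace ℝ (Fin d),
      ⟪((hψ.memLp_gradient).const_inner (𝕜 := ℝ) y).toLp _, w⟫ =
        -⟪(memLp_smul_const hψ.memLp y).toLp _, G⟫ := by
  refine forall_congr' fun ψ => ⟨fun h hψ y => ?_, fun h hψ => ?_⟩
  all_goals
    have i1 : Integrable (fun x => w x • gradient ψ x) (volume.restrict Ω) :=
      integrable_smul_of_memLp_two (Lp.memLp w) hψ.memLp_gradient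
    have i2 : Integrable (fun x => ψ x • G x) (volume.restrict Ω) :=
      integrable_smul_of_memLp_two hψ.memLp (Lp.memLp G)
  · rw [← integral_mul_eq_inner, ← integral_inner_eq_inner]
    have := congrArg (fun z => ⟪y, z⟫) (h hψ)
    simp only [inner_neg_right] at this
    rw [← integral_inner i1, ← integral_inner i2] at this
    simpa only [inner_smul_right, inner_smul_left, conj_trivial] using this
  · refine ext_inner_left ℝ fun y => ?_
    have := h hψ y
    rw [← integral_mul_eq_inner, ← integral_inner_eq_inner] at this
    rw [inner_neg_right, ← integral_inner i1, ← integral_inner i2]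
    simpa only [inner_smul_right, inner_smul_left, conj_trivial] using this

theorem HasWeakGrad.unique (hΩ : IsOpen Ω) {w : L2 Ω} {G H : L2Vec Ω} (hG : HasWeakGrad Ω w G)
    (hH : HasWeakGrad Ω w H) : G = H := by
  have hz : ∀ᵐ x, x ∈ Ω → G x - H x = 0 := by
    refine hΩ.ae_eq_zero_of_integral_contDiff_smul_eq_zero ?_ ?_
    · exact locallyIntegrableOn_of_locallyIntegrable_restrict
        (((Lp.memLp G).sub (Lp.memLp H)).locallyIntegrable (by norm_num))
    · intro ψ h1 h2 h3
      have hψ : IsTestFun Ω ψ := ⟨h1, h2, h3⟩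
      have e := (hG ψ hψ).symm.trans (hH ψ hψ)
      rw [neg_inj] at e
      have h4 : ∫ x, ψ x • (G x - H x) = ∫ x in Ω, ψ x • (G x - H x) :=
        (setIntegral_eq_integral_of_forall_compl_eq_zero fun x hx => by
          rw [hψ.eq_zero hx, zero_smul]).symm
      rw [h4]
      simp_rw [smul_sub]
      rw [integral_sub (integrable_smul_of_memLp_two hψ.memLp (Lp.memLp G))
        (integrable_smul_of_memLp_two hψ.memLp (Lp.memLp H)), e, sub_self]
  refine Lp.ext ?_
  rw [Filter.EventuallyEq, ae_restrict_iff' hΩ.measurableSet]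
  filter_upwards [hz] with x hx hm
  exact sub_eq_zero.1 (hx hm)

theorem HasWeakGrad.weakGrad_eq (hΩ : IsOpen Ω) {w : L2 Ω} {G : L2Vec Ω}
    (hG : HasWeakGrad Ω w G) : weakGrad Ω w = G := by
  have h : ∃ G : L2Vec Ω, HasWeakGrad Ω w G := ⟨G, hG⟩
  rw [weakGrad, dif_pos h]
  exact h.choose_spec.unique hΩ hG

/-- Insert each partial derivative of ψ in the definition, take the matching component, and sum. -/
theorem HasWeakGrad.integral_inner_gradient {w : L2 Ω} {G : L2Vec Ω} (hG : HasWeakGrad Ω w G)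
    {ψ : EuclideanSpace ℝ (Fin d) → ℝ} (hψ : IsTestFun Ω ψ) :
    ∫ x in Ω, ⟪gradient ψ x, G x⟫ = -∫ x in Ω, w x * Laplacian.laplacian ψ x := by
  set b := EuclideanSpace.basisFun (Fin d) ℝ with hb
  have hk : ∀ k, ∫ x in Ω, w x * ⟪b k, gradient (fun z => fderiv ℝ ψ z (b k)) x⟫ =
      -∫ x in Ω, fderiv ℝ ψ x (b k) * ⟪b k, G x⟫ := by
    intro k
    have hψk := hψ.directional (b k)
    have := congrArg (fun z => ⟪b k, z⟫) (hG _ hψk)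
    simp only [inner_neg_right] at this
    rw [← integral_inner (integrable_smul_of_memLp_two (Lp.memLp w) hψk.memLp_gradient),
      ← integral_inner (integrable_smul_of_memLp_two hψk.memLp (Lp.memLp G))] at this
    simpa only [inner_smul_right] using this
  have i1 : ∀ k ∈ Finset.univ, Integrable
      (fun x => w x * ⟪b k, gradient (fun z => fderiv ℝ ψ z (b k)) x⟫) (volume.restrict Ω) :=
    fun k _ => MemLp.integrable_mul (Lp.memLp w)
      (MemLp.const_inner (𝕜 := ℝ) _ (hψ.directional (b k)).memLp_gradient)
  have i2 : ∀ k ∈ Finset.univ, Integrable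
      (fun x => fderiv ℝ ψ x (b k) * ⟪b k, G x⟫) (volume.restrict Ω) :=
    fun k _ => MemLp.integrable_mul (hψ.directional (b k)).memLp
      (MemLp.const_inner (𝕜 := ℝ) _ (Lp.memLp G))
  simp_rw [hψ.laplacian_eq, ← hb, Finset.mul_sum]
  rw [integral_finsetSum _ i1, Finset.sum_congr rfl fun k _ => hk k, Finset.sum_neg_distrib, neg_neg,
    ← integral_finsetSum _ i2]
  refine integral_congr_ae (ae_of_all _ fun x => ?_)
  simp only
  rw [← b.sum_inner_mul_inner]
  refine Finset.sum_congr rfl fun k _ => ?_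
  rw [inner_gradient_left]

theorem tendsto_toLp {Z E : Type*} [MeasurableSpace Z] {μ : Measure Z} [NormedAddCommGroup E]
    {g : ℕ → Z → E} (hg : ∀ n, MemLp (g n) 2 μ) (w : Lp E 2 μ)
    (h : Tendsto (fun n => eLpNorm (fun x => g n x - w x) 2 μ) atTop (𝓝 0)) :
    Tendsto (fun n => (hg n).toLp (g n)) atTop (𝓝 w) := by
  have := (Lp.tendsto_Lp_iff_tendsto_eLpNorm'' g hg w (Lp.memLp w)).2 h
  rwa [Lp.toLp_coeFn] at this

end WeakGradient

namespace DirichletEigenbasis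

variable {d : ℕ} {Ω : Set (EuclideanSpace ℝ (Fin d))} (B : DirichletEigenbasis Ω)

theorem hasWeakGrad_basis (hΩ : IsOpen Ω) (i : ℕ) : HasWeakGrad Ω (B.φ i) (weakGrad Ω (B.φ i)) := by
  obtain ⟨G, hG, -⟩ := B.memH10 i
  rwa [hG.weakGrad_eq hΩ]

/-- Green's formula. For a test function in place of w it is the distributional eigenvalue equation;
membership in H_0^1 allows the limit on both sides. -/
theorem inner_weakGrad_basis_of_memH10 (hΩ : IsOpen Ω) (i : ℕ) {w : L2 Ω} (hw : MemH10 Ω w) :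
    ⟪weakGrad Ω w, weakGrad Ω (B.φ i)⟫ = B.lam i * ⟪w, B.φ i⟫ := by
  obtain ⟨G, hG, ψ, hψ, h1, h2⟩ := hw
  rw [hG.weakGrad_eq hΩ]
  have t1 := (tendsto_toLp (fun n => (hψ n).memLp) w h1).inner (𝕜 := ℝ)
    (tendsto_const_nhds (x := B.φ i))
  have t2 := (tendsto_toLp (fun n => (hψ n).memLp_gradient) G h2).inner (𝕜 := ℝ)
    (tendsto_const_nhds (x := weakGrad Ω (B.φ i)))
  refine tendsto_nhds_unique t2 ((t1.const_mul (B.lam i)).congr fun n => ?_)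
  rw [← integral_inner_eq_inner, ← integral_mul_eq_inner,
    (B.hasWeakGrad_basis hΩ i).integral_inner_gradient (hψ n), B.eigen i _ (hψ n),
    ← integral_const_mul, ← integral_neg]
  refine integral_congr_ae ?_
  filter_upwards [Lp.coeFn_neg (B.lam i • B.φ i), Lp.coeFn_smul (B.lam i) (B.φ i)] with x hx hx2
  rw [hx, Pi.neg_apply, hx2, Pi.smul_apply, smul_eq_mul]
  ring

theorem inner_weakGrad_basis_basis (hΩ : IsOpen Ω) (i j : ℕ) :
    ⟪weakGrad Ω (B.φ i), weakGrad Ω (B.φ j)⟫ = if i = j then B.lam j else 0 := by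
  rw [B.inner_weakGrad_basis_of_memH10 hΩ j (B.memH10 i),
    orthonormal_iff_ite.1 B.φ.orthonormal i j]
  simp

/-- The gradients of the eigenfunctions divided by √λ_i are orthonormal, and a series in an
orthonormal system converges when its coefficients are square summable. -/
theorem summable_coef_smul_weakGrad (hΩ : IsOpen Ω) {c : ℕ → ℝ}
    (hc : Summable fun i => B.lam i * c i ^ 2) :
    Summable fun i => c i • weakGrad Ω (B.φ i) := by
  have hpos : ∀ i, 0 < Real.sqrt (B.lam i) := fun i => Real.sqrt_pos.2 (B.lam_pos i)
  have ho : Orthonormal ℝ fun i => (Real.sqrt (B.lam i))⁻¹ • weakGrad Ω (B.φ i) := by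
    rw [orthonormal_iff_ite]
    intro i j
    rw [inner_smul_left, inner_smul_right, B.inner_weakGrad_basis_basis hΩ]
    by_cases h : i = j
    · subst h
      have := hpos i
      have h2 := Real.mul_self_sqrt (B.lam_pos i).le
      simp only [if_true, conj_trivial]
      field_simp
      nlinarith
    · simp [h]
  have h := (ho.orthogonalFamily.summable_iff_norm_sq_summable
    (fun i => Real.sqrt (B.lam i) * c i)).2 ?_
  · refine h.congr fun i => ?_
    rw [LinearIsometry.toSpanSingleton_apply, smul_smul]
    congr 1
    have := hpos i
    field_simp
  · refine hc.congr fun i => ?_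
    rw [Real.norm_eq_abs, sq_abs, mul_pow, Real.sq_sqrt (B.lam_pos i).le]

/-- Closedness of the weak gradient: it holds for each eigenfunction and survives summation.
Together with uniqueness this identifies the chosen gradient with the series. -/
theorem hasWeakGrad_tsum (hΩ : IsOpen Ω) {w : L2 Ω}
    (hw : Summable fun i => B.lam i * B.coefL2 w i ^ 2) :
    HasWeakGrad Ω w (∑' i, B.coefL2 w i • weakGrad Ω (B.φ i)) := by
  rw [hasWeakGrad_iff]
  intro ψ hψ y
  have h1 := (B.φ.hasSum_repr w).mapL (innerSL ℝ
    (((hψ.memLp_gradient).const_inner (𝕜 := ℝ) y).toLp _))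
  have h2 := (B.summable_coef_smul_weakGrad hΩ hw).hasSum.mapL (innerSL ℝ
    ((memLp_smul_const hψ.memLp y).toLp _))
  simp only [innerSL_apply_apply, inner_smul_right] at h1 h2
  refine h1.unique ?_
  convert! h2.neg using 2 with i
  rw [B.φ.repr_apply_apply, hasWeakGrad_iff.1 (B.hasWeakGrad_basis hΩ i) ψ hψ y]
  simp only [coefL2]
  ring

theorem inner_weakGrad (hΩ : IsOpen Ω) {a b : L2 Ω}
    (ha : Summable fun i => B.lam i * B.coefL2 a i ^ 2)
    (hb : Summable fun i => B.lam i * B.coefL2 b i ^ 2) :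
    ⟪weakGrad Ω a, weakGrad Ω b⟫ = ∑' i, B.lam i * (B.coefL2 a i * B.coefL2 b i) := by
  have key : ∀ i, ⟪weakGrad Ω (B.φ i), weakGrad Ω b⟫ = B.lam i * B.coefL2 b i := by
    intro i
    rw [(B.hasWeakGrad_tsum hΩ hb).weakGrad_eq hΩ]
    have h := (B.summable_coef_smul_weakGrad hΩ hb).hasSum.mapL
      (innerSL ℝ (weakGrad Ω (B.φ i)))
    simp only [innerSL_apply_apply, inner_smul_right, B.inner_weakGrad_basis_basis hΩ] at h
    rw [← h.tsum_eq, tsum_eq_single i fun j hj => by simp [hj.symm]]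
    simp [mul_comm]
  rw [(B.hasWeakGrad_tsum hΩ ha).weakGrad_eq hΩ, real_inner_comm]
  have h := (B.summable_coef_smul_weakGrad hΩ ha).hasSum.mapL (innerSL ℝ (weakGrad Ω b))
  simp only [innerSL_apply_apply, inner_smul_right] at h
  rw [← h.tsum_eq]
  refine tsum_congr fun i => ?_
  rw [real_inner_comm, key]
  ring

theorem coefL2_basis (i j : ℕ) : B.coefL2 (B.φ i) j = if j = i then 1 else 0 :=
  orthonormal_iff_ite.1 B.φ.orthonormal j i

theorem summable_lam_coefL2_basis (i : ℕ) :
    Summable fun j => B.lam j * B.coefL2 (B.φ i) j ^ 2 := by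
  refine summable_of_ne_finset_zero (s := {i}) fun j hj => ?_
  rw [B.coefL2_basis, if_neg (by simpa using hj)]
  simp

theorem inner_weakGrad_basis (hΩ : IsOpen Ω) {a : L2 Ω}
    (ha : Summable fun i => B.lam i * B.coefL2 a i ^ 2) (i : ℕ) :
    ⟪weakGrad Ω a, weakGrad Ω (B.φ i)⟫ = B.lam i * B.coefL2 a i := by
  rw [B.inner_weakGrad hΩ ha (B.summable_lam_coefL2_basis i),
    tsum_eq_single i fun j hj => by rw [B.coefL2_basis, if_neg hj]; simp]
  rw [B.coefL2_basis]
  simp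

/-- Parseval on both sides of the distributional identity reduces it to the eigenvalue equation for
each basis function. -/
theorem hasWeakLaplacian_of_coefL2 {w g : L2 Ω}
    (h : ∀ i, B.coefL2 g i = -(B.lam i * B.coefL2 w i)) : HasWeakLaplacian Ω w g := by
  intro ψ hψ
  rw [integral_mul_eq_inner hψ.memLp_laplacian, integral_mul_eq_inner hψ.memLp,
    ← B.φ.tsum_inner_mul_inner, ← B.φ.tsum_inner_mul_inner]
  refine tsum_congr fun i => ?_
  have e := B.eigen i ψ hψ
  rw [integral_mul_eq_inner hψ.memLp_laplacian, integral_mul_eq_inner hψ.memLp, inner_neg_right,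
    inner_smul_right] at e
  have h2 := h i
  rw [coefL2, coefL2] at h2
  rw [e, h2]
  ring

/-- Lower powers of λ_i are dominated by higher ones because λ_i ≥ λ_0. The factor depends on the
domain; it is used only for finiteness and never enters the final constant. -/
theorem lam_rpow_le {a b : ℝ} (hab : a ≤ b) (i : ℕ) :
    B.lam i ^ a ≤ B.lam 0 ^ (a - b) * B.lam i ^ b := by
  have h0 := B.lam_pos 0
  have hi := B.lam_pos i
  calc B.lam i ^ a = B.lam i ^ (a - b) * B.lam i ^ b := by rw [← Real.rpow_add hi]; congr 1; ring
    _ ≤ _ := mul_le_mul_of_nonneg_right (Real.rpow_le_rpow_of_nonpos h0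
      (B.lam_mono (Nat.zero_le i)) (by linarith)) (by positivity)

variable {B}

theorem DotH.summable_of_le {γ δ : ℝ} (h : δ ≤ γ) (x : B.DotH γ) :
    Summable fun i => B.lam i ^ δ * x.coef i ^ 2 := by
  refine Summable.of_nonneg_of_le (fun i => ?_) (fun i => ?_)
    (x.hasSum_norm_sq.summable.mul_left (B.lam 0 ^ (δ - γ)))
  · have := B.lam_pos i
    positivity
  · rw [← mul_assoc]
    exact mul_le_mul_of_nonneg_right (B.lam_rpow_le h i) (sq_nonneg _)

theorem DotH.coefL2_toL2 {γ : ℝ} (hγ : 0 ≤ γ) (x : B.DotH γ) : B.coefL2 x.toL2 = x.coef := by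
  have hs : Memℓp x.coef 2 := by
    apply memℓp_gen
    refine (x.summable_of_le hγ).congr fun i => ?_
    simp
  have h := B.φ.hasSum_repr_symm ⟨x.coef, hs⟩
  funext i
  rw [DotH.toL2, coefL2, h.tsum_eq, ← B.φ.repr_apply_apply, LinearIsometryEquiv.apply_symm_apply]

theorem DotH.summable_lam_toL2 {γ : ℝ} (hγ : 1 ≤ γ) (x : B.DotH γ) :
    Summable fun i => B.lam i * B.coefL2 x.toL2 i ^ 2 := by
  rw [DotH.coefL2_toL2 (by linarith)]
  simpa using x.summable_of_le hγ

end DirichletEigenbasis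

theorem IsOpenConvexPolytope.isOpen {d : ℕ} {Ω : Set (EuclideanSpace ℝ (Fin d))}
    (h : IsOpenConvexPolytope Ω) : IsOpen Ω := by
  obtain ⟨-, s, rfl⟩ := h
  exact isOpen_interior

/-! ## Weak solutions in coordinates -/

theorem ennreal_rpow_half_sq (a : ℝ≥0∞) : (a ^ (1 / 2 : ℝ)) ^ 2 = a := by
  rw [← ENNReal.rpow_natCast, ← ENNReal.rpow_mul]
  norm_num

theorem ennreal_le_rpow_half {a b : ℝ≥0∞} (h : a ^ 2 ≤ b) : a ≤ b ^ (1 / 2 : ℝ) := by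
  have := ENNReal.rpow_le_rpow h (by norm_num : (0 : ℝ) ≤ 1 / 2)
  rwa [← ENNReal.rpow_natCast, ← ENNReal.rpow_mul, show ((2 : ℕ) : ℝ) * (1 / 2) = 1 by norm_num,
    ENNReal.rpow_one] at this

theorem sobolevNorm_lt_top_iff {X : Type*} [NormedAddCommGroup X] [InnerProductSpace ℝ X]
    (e : HilbertBasis ℕ ℝ X) (s T : ℝ) (v : ℝ → X) :
    sobolevNorm e s T v < ⊤ ↔ ∑' i, sobolevNormSq s T (fun t => ⟪e i, v t⟫) < ⊤ :=
  ENNReal.rpow_lt_top_iff_of_pos (by norm_num)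

theorem MemSobolev.coord_lt_top {X : Type*} [NormedAddCommGroup X] [InnerProductSpace ℝ X]
    {e : HilbertBasis ℕ ℝ X} {s T : ℝ} {v : ℝ → X} (h : MemSobolev e s T v) (i : ℕ) :
    sobolevNormSq s T (fun t => ⟪e i, v t⟫) < ⊤ :=
  (ENNReal.le_tsum i).trans_lt ((sobolevNorm_lt_top_iff e s T v).1 h.2)

theorem memSobolev_smul {X : Type*} [NormedAddCommGroup X] [InnerProductSpace ℝ X]
    (e : HilbertBasis ℕ ℝ X) {s T : ℝ} (h0 : 0 < s) (h1 : s < 1) (hT : 0 < T) {ψ : ℝ → ℝ}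
    (hψ : IsTestFun (Ioo 0 T) ψ) (x : X) : MemSobolev e s T fun t => ψ t • x := by
  refine ⟨memLp_smul_const hψ.memL2 x, (sobolevNorm_lt_top_iff e s T _).2 ?_⟩
  have h : ∀ i, sobolevNormSq s T (fun t => ⟪e i, ψ t • x⟫) =
      ‖⟪e i, x⟫‖ₑ ^ 2 * sobolevNormSq s T ψ := fun i => by
    rw [enorm_real_sq, ← sobolevNormSq_const_mul h1]
    simp only [inner_smul_right, mul_comm]
  simp_rw [h]
  rw [ENNReal.tsum_mul_right, ← e.enorm_sq_eq_tsum]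
  exact ENNReal.mul_lt_top (by finiteness) (hψ.sobolevNormSq_lt_top h0 h1 hT)

theorem SolvesMode.const_mul {α T lam : ℝ} {f w : ℝ → ℝ} (h : SolvesMode α T lam f w) (c : ℝ) :
    SolvesMode α T lam (fun t => c * f t) fun t => c * w t := by
  refine ⟨MemLp.const_mul h.f_mem c, MemLp.const_mul h.w_mem c, ?_⟩
  filter_upwards [h.eq] with t ht
  rw [rlIntLeft_const_mul, ← ht]
  ring

theorem rlIntRight_smul_const {X : Type*} [NormedAddCommGroup X] [NormedSpace ℝ X] [CompleteSpace X]
    (γ T : ℝ) (ψ : ℝ → ℝ) (x : X) (t : ℝ) :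
    rlIntRight γ T (fun s => ψ s • x) t = rlIntRight γ T ψ t • x := by
  simp only [rlIntRight, smul_smul, smul_eq_mul]
  rw [integral_smul_const, smul_smul]

namespace DirichletEigenbasis

variable {d : ℕ} {Ω : Set (EuclideanSpace ℝ (Fin d))} {B : DirichletEigenbasis Ω}

theorem lam_rpow_mul_rpow (B : DirichletEigenbasis Ω) (i : ℕ) (a b : ℝ) :
    B.lam i ^ a * B.lam i ^ b = B.lam i ^ (a + b) := (Real.rpow_add (B.lam_pos i) a b).symm

theorem ofReal_sq_rpow (B : DirichletEigenbasis Ω) (i : ℕ) (a : ℝ) :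
    ENNReal.ofReal ((B.lam i ^ a) ^ 2) = ENNReal.ofReal (B.lam i ^ (2 * a)) := by
  rw [← Real.rpow_natCast, ← Real.rpow_mul (B.lam_pos i).le]
  congr 2
  push_cast
  ring

theorem DotH.coef_eq {γ : ℝ} (x : B.DotH γ) (i : ℕ) :
    x.coef i = B.lam i ^ (-γ / 2) * ⟪B.dotBasis γ i, x⟫ := by
  rw [DotH.coef, HilbertBasis.repr_apply_apply]

theorem DotH.inner_dotBasis {γ : ℝ} (x : B.DotH γ) (i : ℕ) :
    ⟪B.dotBasis γ i, x⟫ = B.lam i ^ (γ / 2) * x.coef i := by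
  rw [DotH.coef_eq, ← mul_assoc, lam_rpow_mul_rpow]
  rw [show γ / 2 + -γ / 2 = 0 by ring, Real.rpow_zero, one_mul]

theorem DotH.coef_smul {γ : ℝ} (c : ℝ) (x : B.DotH γ) (i : ℕ) : (c • x).coef i = c * x.coef i := by
  rw [DotH.coef_eq, DotH.coef_eq, inner_smul_right]
  ring

theorem coefL2_smul (c : ℝ) (x : L2 Ω) (i : ℕ) : B.coefL2 (c • x) i = c * B.coefL2 x i :=
  inner_smul_right _ _ _

end DirichletEigenbasis

open DirichletEigenbasis

section Modes

variable {d : ℕ} {Ω : Set (EuclideanSpace ℝ (Fin d))} {B : DirichletEigenbasis Ω} {α T β : ℝ}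
  {f : ℝ → B.DotH (-β)} {w : ℕ → ℝ → ℝ}

/-- The functions `w_i` solve the modes of the problem with the right-hand side `f`. -/
def SolvesModes (B : DirichletEigenbasis Ω) (α T : ℝ) {β : ℝ} (f : ℝ → B.DotH (-β))
    (w : ℕ → ℝ → ℝ) : Prop :=
  ∀ i, SolvesMode α T (B.lam i) (fun t => ⟪B.dotBasis (-β) i, f t⟫) (w i)

theorem exists_solvesModes (h0 : 0 < α) (h1 : α ≤ 1) (hf : MemL2 T f) :
    ∃ w, SolvesModes B α T f w := by
  have h : ∀ i, ∃ w, SolvesMode α T (B.lam i) (fun t => ⟪B.dotBasis (-β) i, f t⟫) w := by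
    intro i
    have hfi := hf.inner (B.dotBasis (-β) i)
    obtain ⟨w, hw, he⟩ := exists_rlIntLeft_solution h0 h1 (B.lam_pos i).le hfi
    exact ⟨w, hfi, hw, he⟩
  choose w hw using h
  exact ⟨w, hw⟩

/-- The coefficients of `u` are the solutions of the modes. -/
def HasModes (B : DirichletEigenbasis Ω) (T β : ℝ) (w : ℕ → ℝ → ℝ) (u : ℝ → L2 Ω) : Prop :=
  ∀ᵐ t ∂volume.restrict (Ioo 0 T), ∀ i, B.coefL2 (u t) i = B.lam i ^ (β / 2) * rlIntLeft 1 (w i) t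

theorem tsum_le_mul_lintegral (hf : MemL2 T f) {a : ℕ → ℝ≥0∞} {C : ℝ≥0∞}
    (h : ∀ i, a i ≤ C * ∫⁻ t in Ioo 0 T, ‖⟪B.dotBasis (-β) i, f t⟫‖ₑ ^ 2) :
    ∑' i, a i ≤ C * ∫⁻ t in Ioo 0 T, ‖f t‖ₑ ^ 2 := by
  rw [hf.lintegral_enorm_sq_eq (B.dotBasis (-β)), ← ENNReal.tsum_mul_left]
  exact ENNReal.tsum_le_tsum h

theorem tsum_lt_top_of_le (hf : MemL2 T f) {a : ℕ → ℝ≥0∞} {C : ℝ≥0∞} (hC : C < ⊤)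
    (h : ∀ i, a i ≤ C * ∫⁻ t in Ioo 0 T, ‖⟪B.dotBasis (-β) i, f t⟫‖ₑ ^ 2) : ∑' i, a i < ⊤ :=
  (tsum_le_mul_lintegral hf h).trans_lt
    (ENNReal.mul_lt_top hC (lintegral_lt_top_of_memLp_two hf))

theorem Represents.summable {u : ℝ → L2 Ω} {v : ℝ → B.DotH 1} (h : Represents B T v u) :
    ∀ᵐ t ∂volume.restrict (Ioo 0 T), Summable fun i => B.lam i * B.coefL2 (u t) i ^ 2 := by
  filter_upwards [h] with t ht
  rw [← ht]
  simpa using (v t).hasSum_norm_sq.summable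

theorem memW_smul_basis (h0 : 0 < α) (h1 : α < 1) (hT : 0 < T) {ψ : ℝ → ℝ}
    (hψ : IsTestFun (Ioo 0 T) ψ) (i : ℕ) : MemW B α T fun t => ψ t • B.φ i := by
  refine ⟨memSobolev_smul B.φ (by linarith) (by linarith) hT hψ _,
    fun t => ψ t • (B.lam i ^ (1 / 2 : ℝ) • B.dotBasis 1 i), memLp_smul_const hψ.memL2 _,
    ae_of_all _ fun t => funext fun j => ?_⟩
  rw [DotH.coef_smul, DotH.coef_smul, DotH.coef_dotBasis, coefL2_smul, B.coefL2_basis]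
  by_cases h : j = i
  · rw [if_pos h, if_pos h, B.lam_rpow_mul_rpow]
    norm_num
  · rw [if_neg h, if_neg h, mul_zero]

/-- Testing with ψ φ_i decouples the equation. On such functions the functional D^α u is prescribed
by the distribution it extends, so the i-th coefficient of u satisfies the scalar weak equation, and
scalar uniqueness identifies it. -/
theorem IsWeakSolution.hasModes (hΩ : IsOpen Ω) (h0 : 0 < α) (h1 : α < 1) (hT : 0 < T)
    (hw : SolvesModes B α T f w) {u : ℝ → L2 Ω} (hu : IsWeakSolution B α T f u) :
    HasModes B T β w u := by
  obtain ⟨⟨hS, v, hv, hrep⟩, ℓ, hℓ, heq⟩ := hu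
  refine ae_all_iff.2 fun i => ?_
  have hsc := (hw i).const_mul (B.lam i ^ (β / 2))
  have hα : 0 < 1 - α := by linarith
  -- The mode is rescaled by λ_i^{β/2} because the formal coefficient of f is that multiple of its
  -- coordinate in the orthonormal basis of Ḣ^{-β}.
  have huniq := hsc.unique h0 h1 hT (B.lam_pos i).le (hS.1.inner (B.φ i)) (hS.coord_lt_top i)
    fun ψ hψ => ?_
  · filter_upwards [huniq] with t ht
    rw [coefL2, ht, rlIntLeft_const_mul]
  have e := heq _ (memW_smul_basis h0 h1 hT hψ i)
  rw [hℓ.extends_distribution ψ (B.φ i) hψ] at e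
  have e1 : ∫ t in Ioo 0 T, deriv ψ t * ⟪rlIntLeft (1 - α) u t, B.φ i⟫ =
      ∫ t in Ioo 0 T, deriv ψ t * rlIntLeft (1 - α) (fun t => ⟪B.φ i, u t⟫) t := by
    refine integral_congr_ae ?_
    filter_upwards [inner_rlIntLeft hα hS.1.integrableOn] with t ht
    rw [real_inner_comm, ht]
  have e2 : ∫ t in Ioo 0 T, ⟪weakGrad Ω (u t), weakGrad Ω (ψ t • B.φ i)⟫ =
      B.lam i * ∫ t in Ioo 0 T, ⟪B.φ i, u t⟫ * ψ t := by
    rw [← integral_const_mul]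
    refine integral_congr_ae ?_
    filter_upwards [hrep.summable] with t ht
    have hs : Summable fun j => B.lam j * B.coefL2 (ψ t • B.φ i) j ^ 2 := by
      refine ((B.summable_lam_coefL2_basis i).mul_left (ψ t ^ 2)).congr fun j => ?_
      rw [coefL2_smul]
      ring
    rw [B.inner_weakGrad hΩ ht hs, tsum_eq_single i fun j hj => by
      rw [coefL2_smul, B.coefL2_basis, if_neg hj]; ring]
    rw [coefL2_smul, B.coefL2_basis, if_pos rfl, coefL2]
    ring
  have e3 : ∫ t in Ioo 0 T, seriesPairing (f t).coef
      (B.coefL2 (rlIntRight (1 - α) T (fun t => ψ t • B.φ i) t)) =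
      ∫ t in Ioo 0 T, (B.lam i ^ (β / 2) * ⟪B.dotBasis (-β) i, f t⟫) *
        rlIntRight (1 - α) T ψ t := by
    refine integral_congr_ae (ae_of_all _ fun t => ?_)
    simp only [seriesPairing]
    rw [tsum_eq_single i fun j hj => by
      rw [rlIntRight_smul_const, coefL2_smul, B.coefL2_basis, if_neg hj]; ring]
    rw [rlIntRight_smul_const, coefL2_smul, B.coefL2_basis, if_pos rfl, DotH.coef_eq, neg_neg]
    ring
  rw [e1, e2, e3] at e
  exact e

/-- The functional `D_{0+}^α u` in coordinates. -/
def modeFunctional (B : DirichletEigenbasis Ω) (α T β : ℝ) (w : ℕ → ℝ → ℝ) (v : ℝ → L2 Ω) : ℝ :=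
  ∑' i, B.lam i ^ (β / 2) * ∫ t in Ioo 0 T, rlIntLeft (1 - α) (w i) t * ⟪B.φ i, v t⟫

/-- The dual estimate for one mode has a spare factor λ_i, which dominates λ_i^β up to a constant
since β ≤ 1. Cauchy–Schwarz over the modes then splits the norms of f and v. -/
theorem SolvesModes.tsum_enorm_le (hw : SolvesModes B α T f w) (h0 : 0 < α) (h1 : α < 1)
    (hT : 0 < T) (hβ : β ≤ 1) (hf : MemL2 T f) :
    ∃ K : ℝ≥0, ∀ v : ℝ → L2 Ω, MemL2 T v →
      ∑' i, ‖B.lam i ^ (β / 2) * ∫ t in Ioo 0 T, rlIntLeft (1 - α) (w i) t * ⟪B.φ i, v t⟫‖ₑ ≤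
        K * sobolevNorm B.φ (α / 2) T v := by
  set F := ∫⁻ t in Ioo 0 T, ‖f t‖ₑ ^ 2 with hF
  have hFt : F < ⊤ := lintegral_lt_top_of_memLp_two hf
  set M := ENNReal.ofReal (B.lam 0 ^ (β - 1)) *
    (ENNReal.ofReal (Real.cos (α * (Real.pi / 2)))⁻¹ * dualConst α T) with hM
  have hMt : M < ⊤ := ENNReal.mul_lt_top ENNReal.ofReal_lt_top
    (ENNReal.mul_lt_top ENNReal.ofReal_lt_top (dualConst_lt_top h1 hT))
  have hKt : (M * F) ^ (1 / 2 : ℝ) ≠ ⊤ :=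
    ENNReal.rpow_ne_top_of_nonneg (by norm_num) (ENNReal.mul_lt_top hMt hFt).ne
  refine ⟨((M * F) ^ (1 / 2 : ℝ)).toNNReal, fun v hv => ?_⟩
  rw [ENNReal.coe_toNNReal hKt, sobolevNorm, ← ENNReal.mul_rpow_of_nonneg _ _ (by norm_num)]
  refine ennreal_le_rpow_half ?_
  set b := fun i => ∫⁻ t in Ioo 0 T, ‖⟪B.dotBasis (-β) i, f t⟫‖ₑ ^ 2 with hb
  set S := fun i => sobolevNormSq (α / 2) T (fun t => ⟪B.φ i, v t⟫) with hS
  have hterm : ∀ i, ‖B.lam i ^ (β / 2) *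
      ∫ t in Ioo 0 T, rlIntLeft (1 - α) (w i) t * ⟪B.φ i, v t⟫‖ₑ ≤
      M ^ (1 / 2 : ℝ) * (b i ^ (1 / 2 : ℝ) * S i ^ (1 / 2 : ℝ)) := by
    intro i
    rw [← ENNReal.mul_rpow_of_nonneg _ _ (by norm_num), ← ENNReal.mul_rpow_of_nonneg _ _
      (by norm_num)]
    refine ennreal_le_rpow_half ?_
    rw [enorm_mul, mul_pow, enorm_real_sq, B.ofReal_sq_rpow, show 2 * (β / 2) = β by ring]
    have hl : ENNReal.ofReal (B.lam i ^ β) ≤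
        ENNReal.ofReal (B.lam 0 ^ (β - 1)) * ENNReal.ofReal (B.lam i) := by
      rw [← ENNReal.ofReal_mul (Real.rpow_nonneg (B.lam_pos 0).le _)]
      refine ENNReal.ofReal_le_ofReal ?_
      simpa using B.lam_rpow_le hβ i
    refine (mul_le_mul_left hl _).trans ?_
    rw [mul_assoc, hM, mul_assoc (ENNReal.ofReal (B.lam 0 ^ (β - 1)))]
    exact mul_le_mul_right ((hw i).lam_mul_sq_integral_le h0 h1 hT (B.lam_pos i).le
      (hv.inner (B.φ i))) _
  calc _ ≤ (M ^ (1 / 2 : ℝ) * ∑' i, b i ^ (1 / 2 : ℝ) * S i ^ (1 / 2 : ℝ)) ^ 2 := by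
        rw [← ENNReal.tsum_mul_left]
        exact pow_le_pow_left' (ENNReal.tsum_le_tsum hterm) 2
    _ ≤ M * ((∑' i, b i) * ∑' i, S i) := by
        rw [mul_pow, ennreal_rpow_half_sq]
        refine mul_le_mul_right ((ennreal_sq_tsum_mul_le _ _).trans (le_of_eq ?_)) _
        simp_rw [ennreal_rpow_half_sq]
    _ = _ := by
        rw [hF, hf.lintegral_enorm_sq_eq (B.dotBasis (-β))]
        exact (mul_assoc M _ _).symm

theorem SolvesModes.summable (hw : SolvesModes B α T f w) (h0 : 0 < α) (h1 : α < 1)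
    (hT : 0 < T) (hβ : β ≤ 1) (hf : MemL2 T f) {v : ℝ → L2 Ω}
    (hv : MemSobolev B.φ (α / 2) T v) : Summable fun i =>
      B.lam i ^ (β / 2) * ∫ t in Ioo 0 T, rlIntLeft (1 - α) (w i) t * ⟪B.φ i, v t⟫ := by
  obtain ⟨K, hK⟩ := hw.tsum_enorm_le h0 h1 hT hβ hf
  have h := (hK v hv.1).trans_lt (ENNReal.mul_lt_top ENNReal.coe_lt_top hv.2)
  refine Summable.of_norm ((ENNReal.summable_toReal h.ne).congr fun i => ?_)
  rw [toReal_enorm]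

/-- For each mode I^{1-α} I^1 w has derivative I^{1-α} w; integration by parts against ψ and
Parseval in space give the distributional identity. Boundedness is the summed dual estimate. -/
theorem SolvesModes.isDualRLDeriv (hw : SolvesModes B α T f w) (h0 : 0 < α) (h1 : α < 1)
    (hT : 0 < T) (hβ : β ≤ 1) (hf : MemL2 T f) {u : ℝ → L2 Ω} (hu : MemL2 T u)
    (hm : HasModes B T β w u) :
    IsDualRLDeriv B.φ α T u (modeFunctional B α T β w) := by
  have hα : 0 < 1 - α := by linarith
  have hW : ∀ i, MemL2 T (rlIntLeft (1 - α) (w i)) := fun i => (hw i).w_mem.rlIntLeft hα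
  refine ⟨fun v z hv hz a b => ?_, ?_, fun ψ x hψ => ?_⟩
  · have s1 := (hw.summable h0 h1 hT hβ hf hv).mul_left a
    have s2 := (hw.summable h0 h1 hT hβ hf hz).mul_left b
    rw [modeFunctional, modeFunctional, modeFunctional, ← tsum_mul_left, ← tsum_mul_left,
      ← s1.tsum_add s2]
    refine tsum_congr fun i => ?_
    have i1 := (hW i).integral_mul_integrable (hv.1.inner (B.φ i))
    have i2 := (hW i).integral_mul_integrable (hz.1.inner (B.φ i))
    have e : ∫ t in Ioo 0 T, rlIntLeft (1 - α) (w i) t * ⟪B.φ i, a • v t + b • z t⟫ =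
        a * (∫ t in Ioo 0 T, rlIntLeft (1 - α) (w i) t * ⟪B.φ i, v t⟫) +
          b * ∫ t in Ioo 0 T, rlIntLeft (1 - α) (w i) t * ⟪B.φ i, z t⟫ := by
      rw [← integral_const_mul, ← integral_const_mul, ← integral_add (i1.const_mul a)
        (i2.const_mul b)]
      refine integral_congr_ae (ae_of_all _ fun t => ?_)
      simp only [inner_add_right, inner_smul_right]
      ring
    rw [e]
    ring
  · obtain ⟨K, hK⟩ := hw.tsum_enorm_le h0 h1 hT hβ hf
    refine ⟨K, fun v hv => le_trans ?_ (hK v hv.1)⟩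
    rw [← Real.enorm_eq_ofReal_abs, modeFunctional]
    exact enorm_tsum_le_tsum_enorm
  · have iI : IntegrableOn (fun t => deriv ψ t • rlIntLeft (1 - α) u t) (Ioo 0 T) :=
      integrable_smul_of_memLp_two hψ.memL2_deriv (hu.rlIntLeft hα)
    have e1 : ∫ t in Ioo 0 T, deriv ψ t * ⟪rlIntLeft (1 - α) u t, x⟫ =
        ⟪x, ∫ t in Ioo 0 T, deriv ψ t • rlIntLeft (1 - α) u t⟫ := by
      rw [← integral_inner iI]
      refine integral_congr_ae (ae_of_all _ fun t => ?_)
      simp only [inner_smul_right, real_inner_comm]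
    rw [e1, ← B.φ.tsum_inner_mul_inner, modeFunctional, ← tsum_neg]
    refine tsum_congr fun i => ?_
    rw [← integral_inner iI]
    have e2 : ∫ t in Ioo 0 T, ⟪B.φ i, deriv ψ t • rlIntLeft (1 - α) u t⟫ =
        B.lam i ^ (β / 2) *
          ∫ t in Ioo 0 T, deriv ψ t * rlIntLeft (1 - α) (rlIntLeft 1 (w i)) t := by
      rw [← integral_const_mul]
      refine integral_congr_ae ?_
      have hmi : (fun t => ⟪B.φ i, u t⟫) =ᵐ[volume.restrict (Ioo 0 T)]
          fun t => B.lam i ^ (β / 2) * rlIntLeft 1 (w i) t := by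
        filter_upwards [hm] with t ht using ht i
      filter_upwards [inner_rlIntLeft hα hu.integrableOn, ae_restrict_mem measurableSet_Ioo]
        with t ht hmem
      rw [inner_smul_right, ht, rlIntLeft_congr hmi hmem, rlIntLeft_const_mul]
      ring
    have e3 := (hasTimeDeriv_rlIntLeft hα (hw i).w_mem).2.2 ψ hψ
    simp only [smul_eq_mul] at e3
    have e4 : ∫ t in Ioo 0 T, rlIntLeft (1 - α) (w i) t * ⟪B.φ i, ψ t • x⟫ =
        ⟪B.φ i, x⟫ * ∫ t in Ioo 0 T, ψ t * rlIntLeft (1 - α) (w i) t := by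
      rw [← integral_const_mul]
      refine integral_congr_ae (ae_of_all _ fun t => ?_)
      simp only [inner_smul_right]
      ring
    rw [e2, e3, e4, real_inner_comm]
    ring

end Modes

/-! ## Existence and uniqueness of the weak solution -/

open DirichletEigenbasis

section Modes

variable {d : ℕ} {Ω : Set (EuclideanSpace ℝ (Fin d))} {B : DirichletEigenbasis Ω} {α T β : ℝ}
  {f : ℝ → B.DotH (-β)} {w : ℕ → ℝ → ℝ}

theorem HasModes.ae_eq {u v : ℝ → L2 Ω} (hu : HasModes B T β w u) (hv : HasModes B T β w v) :
    u =ᵐ[volume.restrict (Ioo 0 T)] v := by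
  filter_upwards [hu, hv] with t h1 h2
  refine B.φ.ext_inner fun i => ?_
  exact (h1 i).trans (h2 i).symm

theorem exists_memL2_of_le (hf : MemL2 T f) {X : Type*} [NormedAddCommGroup X] [InnerProductSpace ℝ X] (e : HilbertBasis ℕ ℝ X)
    (k : ℕ → ℝ) {c : ℕ → ℝ → ℝ} (hc : ∀ i, MemL2 T (c i)) {C : ℝ≥0∞} (hC : C < ⊤)
    (h : ∀ i, ENNReal.ofReal (k i ^ 2) * ∫⁻ t in Ioo 0 T, ‖c i t‖ₑ ^ 2 ≤
      C * ∫⁻ t in Ioo 0 T, ‖⟪B.dotBasis (-β) i, f t⟫‖ₑ ^ 2) :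
    ∃ U : ℝ → X, MemL2 T U ∧
      ∀ᵐ t ∂volume.restrict (Ioo 0 T), ∀ i, ⟪e i, U t⟫ = k i * c i t := by
  refine exists_memL2_of_coordinates e (fun i => MemLp.const_mul (hc i) (k i))
    (tsum_lt_top_of_le hf hC fun i => ?_)
  rw [lintegral_const_mul_sq]
  exact h i

theorem ofReal_lam_rpow_le (B : DirichletEigenbasis Ω) {a b : ℝ} (hab : a ≤ b) (i : ℕ) :
    ENNReal.ofReal (B.lam i ^ a) ≤
      ENNReal.ofReal (B.lam 0 ^ (a - b)) * ENNReal.ofReal (B.lam i ^ b) := by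
  rw [← ENNReal.ofReal_mul (Real.rpow_nonneg (B.lam_pos 0).le _)]
  exact ENNReal.ofReal_le_ofReal (B.lam_rpow_le hab i)

theorem SolvesModes.lam_rpow_mul_sobolevNormSq_le (hw : SolvesModes B α T f w) (h0 : 0 < α)
    (h1 : α < 1) {γ : ℝ} (hγ : γ ≤ 1) {s : ℝ} (hs0 : 0 < s) (hs : s ≤ 1 - α / 2) (i : ℕ) :
    ENNReal.ofReal (B.lam i ^ γ) * sobolevNormSq s T (rlIntLeft 1 (w i)) ≤
      (ENNReal.ofReal (B.lam 0 ^ (γ - 1)) *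
        (energyConst s T * ENNReal.ofReal (Real.cos (α * (Real.pi / 2)))⁻¹)) *
        ∫⁻ t in Ioo 0 T, ‖⟪B.dotBasis (-β) i, f t⟫‖ₑ ^ 2 := by
  refine (mul_le_mul_left (ofReal_lam_rpow_le B hγ i) _).trans ?_
  rw [Real.rpow_one, mul_assoc, mul_assoc (ENNReal.ofReal (B.lam 0 ^ (γ - 1)))]
  exact mul_le_mul_right ((hw i).lam_mul_sobolevNormSq_le h0 h1 (B.lam_pos i).le hs0 hs) _

/-- The strongest available bound, with λ_i², weakened to a lower power; it serves only to show that
series converge in the spaces needed. -/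
theorem SolvesModes.lam_rpow_mul_lintegral_le (hw : SolvesModes B α T f w) (h0 : 0 < α)
    (h1 : α < 1) {γ : ℝ} (hγ : γ ≤ 2) (i : ℕ) :
    ENNReal.ofReal (B.lam i ^ γ) * ∫⁻ t in Ioo 0 T, ‖rlIntLeft 1 (w i) t‖ₑ ^ 2 ≤
      (ENNReal.ofReal (B.lam 0 ^ (γ - 2)) * (energyConst (1 - α) T * 4)) *
        ∫⁻ t in Ioo 0 T, ‖⟪B.dotBasis (-β) i, f t⟫‖ₑ ^ 2 := by
  refine (mul_le_mul_left (ofReal_lam_rpow_le B hγ i) _).trans ?_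
  rw [Real.rpow_two, ENNReal.ofReal_pow (B.lam_pos i).le, mul_assoc,
    mul_assoc (ENNReal.ofReal (B.lam 0 ^ (γ - 2)))]
  refine mul_le_mul_right (le_trans (mul_le_mul_right ?_ _)
    ((hw i).lam_sq_mul_sobolevNormSq_le h0 h1 (B.lam_pos i).le)) _
  exact lintegral_le_sobolevNormSq _ _ _

theorem SolvesModes.exists_hasModes (hw : SolvesModes B α T f w) (h0 : 0 < α) (h1 : α < 1)
    (hT : 0 < T) (hβ : β ≤ 1) (hf : MemL2 T f) :
    ∃ u : ℝ → L2 Ω, MemL2 T u ∧ HasModes B T β w u := by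
  have hC : energyConst (1 - α) T < ⊤ := energyConst_lt_top (by linarith) (by linarith) hT
  refine exists_memL2_of_le hf B.φ (fun i => B.lam i ^ (β / 2))
    (fun i => (hw i).w_mem.rlIntLeft one_pos)
    (C := ENNReal.ofReal (B.lam 0 ^ (β - 2)) * (energyConst (1 - α) T * 4)) ?_ fun i => ?_
  · exact ENNReal.mul_lt_top ENNReal.ofReal_lt_top (ENNReal.mul_lt_top hC (by simp))
  · rw [B.ofReal_sq_rpow, show 2 * (β / 2) = β by ring]
    exact hw.lam_rpow_mul_lintegral_le h0 h1 (by linarith) i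

theorem HasModes.coord {u : ℝ → L2 Ω} (hm : HasModes B T β w u) (i : ℕ) :
    (fun t => ⟪B.φ i, u t⟫) =ᵐ[volume.restrict (Ioo 0 T)]
      fun t => B.lam i ^ (β / 2) * rlIntLeft 1 (w i) t := by
  filter_upwards [hm] with t ht using ht i

theorem SolvesModes.exists_represents_one (hw : SolvesModes B α T f w) (h0 : 0 < α) (h1 : α < 1)
    (hT : 0 < T) (hβ : β ≤ 1) (hf : MemL2 T f) {u : ℝ → L2 Ω} (hm : HasModes B T β w u) :
    ∃ v : ℝ → B.DotH 1, MemL2 T v ∧ Represents B T v u := by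
  have hC : energyConst (1 - α) T < ⊤ := energyConst_lt_top (by linarith) (by linarith) hT
  obtain ⟨v, hv, hc⟩ := exists_memL2_of_le hf (B.dotBasis 1) (fun i => B.lam i ^ ((1 + β) / 2))
    (fun i => (hw i).w_mem.rlIntLeft one_pos)
    (C := ENNReal.ofReal (B.lam 0 ^ ((1 + β) - 2)) * (energyConst (1 - α) T * 4))
    (ENNReal.mul_lt_top ENNReal.ofReal_lt_top (ENNReal.mul_lt_top hC (by simp))) fun i => by
      rw [B.ofReal_sq_rpow, show 2 * ((1 + β) / 2) = 1 + β by ring]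
      exact hw.lam_rpow_mul_lintegral_le h0 h1 (by linarith) i
  refine ⟨v, hv, ?_⟩
  filter_upwards [hc, hm] with t h2 h3
  funext i
  rw [h3 i, DotH.coef_eq, h2 i, ← mul_assoc, B.lam_rpow_mul_rpow]
  congr 2
  ring

theorem SolvesModes.memW (hw : SolvesModes B α T f w) (h0 : 0 < α) (h1 : α < 1)
    (hT : 0 < T) (hβ : β ≤ 1) (hf : MemL2 T f) {u : ℝ → L2 Ω} (hu : MemL2 T u)
    (hm : HasModes B T β w u) : MemW B α T u := by
  refine ⟨⟨hu, (sobolevNorm_lt_top_iff _ _ _ _).2 ?_⟩,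
    hw.exists_represents_one h0 h1 hT hβ hf hm⟩
  refine tsum_lt_top_of_le hf (C := ENNReal.ofReal (B.lam 0 ^ (β - 1)) *
    (energyConst (α / 2) T * ENNReal.ofReal (Real.cos (α * (Real.pi / 2)))⁻¹)) ?_ fun i => ?_
  · exact ENNReal.mul_lt_top ENNReal.ofReal_lt_top (ENNReal.mul_lt_top
      (energyConst_lt_top (by linarith) (by linarith) hT) ENNReal.ofReal_lt_top)
  · rw [sobolevNormSq_congr (by linarith) (hm.coord i), sobolevNormSq_const_mul (by linarith),
      B.ofReal_sq_rpow, show 2 * (β / 2) = β by ring]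
    exact hw.lam_rpow_mul_sobolevNormSq_le h0 h1 hβ (by linarith) (by linarith) i

theorem Represents.inner_dotBasis {γ : ℝ} {v : ℝ → B.DotH γ} {u : ℝ → L2 Ω}
    (h : Represents B T v u) : ∀ᵐ t ∂volume.restrict (Ioo 0 T), ∀ i,
      ⟪B.dotBasis γ i, v t⟫ = B.lam i ^ (γ / 2) * ⟪B.φ i, u t⟫ := by
  filter_upwards [h] with t ht i
  rw [DotH.inner_dotBasis, ht, coefL2]

/-- Each of the three terms of the weak equation is a convergent sum over modes, and the summands
satisfy the scalar weak form; sums of equal series agree. -/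
theorem SolvesModes.isWeakSolution (hΩ : IsOpen Ω) (hw : SolvesModes B α T f w) (h0 : 0 < α)
    (h1 : α < 1) (hT : 0 < T) (hβ : β ≤ 1) (hf : MemL2 T f) {u : ℝ → L2 Ω} (hu : MemL2 T u)
    (hm : HasModes B T β w u) : IsWeakSolution B α T f u := by
  have hα : 0 < 1 - α := by linarith
  refine ⟨hw.memW h0 h1 hT hβ hf hu hm, modeFunctional B α T β w,
    hw.isDualRLDeriv h0 h1 hT hβ hf hu hm, fun v hv => ?_⟩
  obtain ⟨hvS, V, hV, hVr⟩ := hv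
  obtain ⟨U, hU, hUr⟩ := hw.exists_represents_one h0 h1 hT hβ hf hm
  have s1 := (hw.summable h0 h1 hT hβ hf hvS).hasSum
  have s2 := hasSum_integral_mul (fun i => hU.inner (B.dotBasis 1 i))
    (fun i => hV.inner (B.dotBasis 1 i))
    (by rw [← hU.lintegral_enorm_sq_eq]; exact lintegral_lt_top_of_memLp_two hU)
    (by rw [← hV.lintegral_enorm_sq_eq]; exact lintegral_lt_top_of_memLp_two hV)
  -- The factor λ_i^{β/2} is placed on the test function, where it is controlled because v takes
  -- values in Ḣ^1 and β ≤ 1.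
  have s3 := hasSum_integral_mul (a := fun i t => ⟪B.dotBasis (-β) i, f t⟫)
    (b := fun i t => B.lam i ^ (β / 2) * rlIntRight (1 - α) T (fun t => ⟪B.φ i, v t⟫) t)
    (fun i => hf.inner (B.dotBasis (-β) i))
    (fun i => MemLp.const_mul ((hvS.1.inner (B.φ i)).rlIntRight hα) _)
    (by rw [← hf.lintegral_enorm_sq_eq]; exact lintegral_lt_top_of_memLp_two hf) (by
      have hle : ∀ i, ∫⁻ t in Ioo 0 T, ‖B.lam i ^ (β / 2) *
          rlIntRight (1 - α) T (fun t => ⟪B.φ i, v t⟫) t‖ₑ ^ 2 ≤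
          (ENNReal.ofReal (B.lam 0 ^ (β - 1)) * ENNReal.ofReal (Real.exp T ^ 2)) *
            ∫⁻ t in Ioo 0 T, ‖⟪B.dotBasis 1 i, V t⟫‖ₑ ^ 2 := by
        intro i
        have e : ∫⁻ t in Ioo 0 T, ‖⟪B.dotBasis 1 i, V t⟫‖ₑ ^ 2 =
            ENNReal.ofReal (B.lam i ^ (1 : ℝ)) * ∫⁻ t in Ioo 0 T, ‖⟪B.φ i, v t⟫‖ₑ ^ 2 := by
          have e1 : ENNReal.ofReal (B.lam i ^ (1 : ℝ)) =
              ENNReal.ofReal ((B.lam i ^ (1 / 2 : ℝ)) ^ 2) := by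
            rw [B.ofReal_sq_rpow]
            norm_num
          rw [e1, ← lintegral_const_mul_sq]
          refine lintegral_congr_ae ?_
          filter_upwards [hVr.inner_dotBasis] with t ht
          rw [← ht i]
        rw [lintegral_const_mul_sq, e, B.ofReal_sq_rpow, show 2 * (β / 2) = β by ring]
        calc _ ≤ (ENNReal.ofReal (B.lam 0 ^ (β - 1)) * ENNReal.ofReal (B.lam i ^ (1 : ℝ))) *
              (ENNReal.ofReal (Real.exp T ^ 2) * ∫⁻ t in Ioo 0 T, ‖⟪B.φ i, v t⟫‖ₑ ^ 2) :=
              mul_le_mul' (ofReal_lam_rpow_le B hβ i)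
                (lintegral_rlIntRight_sq_le hα (hvS.1.inner (B.φ i)))
          _ = _ := by ring
      refine (ENNReal.tsum_le_tsum hle).trans_lt ?_
      rw [ENNReal.tsum_mul_left, ← hV.lintegral_enorm_sq_eq]
      exact ENNReal.mul_lt_top (ENNReal.mul_lt_top ENNReal.ofReal_lt_top ENNReal.ofReal_lt_top)
        (lintegral_lt_top_of_memLp_two hV))
  have e2 : ∫ t in Ioo 0 T, ⟪weakGrad Ω (u t), weakGrad Ω (v t)⟫ =
      ∫ t in Ioo 0 T, ∑' i, ⟪B.dotBasis 1 i, U t⟫ * ⟪B.dotBasis 1 i, V t⟫ := by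
    refine integral_congr_ae ?_
    filter_upwards [hUr.summable, hVr.summable, hUr.inner_dotBasis, hVr.inner_dotBasis]
      with t a1 a2 a3 a4
    rw [B.inner_weakGrad hΩ a1 a2]
    refine tsum_congr fun i => ?_
    rw [a3, a4, mul_mul_mul_comm, B.lam_rpow_mul_rpow, coefL2, coefL2]
    norm_num
  have e3 : ∫ t in Ioo 0 T, seriesPairing (f t).coef (B.coefL2 (rlIntRight (1 - α) T v t)) =
      ∫ t in Ioo 0 T, ∑' i, ⟪B.dotBasis (-β) i, f t⟫ *
        (B.lam i ^ (β / 2) * rlIntRight (1 - α) T (fun t => ⟪B.φ i, v t⟫) t) := by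
    refine integral_congr_ae ?_
    filter_upwards [inner_rlIntRight hα hvS.1] with t ht
    refine tsum_congr fun i => ?_
    rw [DotH.coef_eq, coefL2, ht, neg_neg]
    ring
  rw [e2, e3]
  refine (s1.add s2).unique ?_
  convert! s3 using 2 with i
  have hwf := ((hw i).const_mul (B.lam i ^ (β / 2))).weak_form h0 h1 (hvS.1.inner (B.φ i))
  have c1 : ∫ t in Ioo 0 T, rlIntLeft (1 - α) (fun t => B.lam i ^ (β / 2) * w i t) t *
      ⟪B.φ i, v t⟫ = B.lam i ^ (β / 2) *
        ∫ t in Ioo 0 T, rlIntLeft (1 - α) (w i) t * ⟪B.φ i, v t⟫ := by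
    rw [← integral_const_mul]
    refine integral_congr_ae (ae_of_all _ fun t => ?_)
    simp only [rlIntLeft_const_mul]
    ring
  have c2 : B.lam i * ∫ t in Ioo 0 T, rlIntLeft 1 (fun t => B.lam i ^ (β / 2) * w i t) t *
      ⟪B.φ i, v t⟫ = ∫ t in Ioo 0 T, ⟪B.dotBasis 1 i, U t⟫ * ⟪B.dotBasis 1 i, V t⟫ := by
    rw [← integral_const_mul]
    refine integral_congr_ae ?_
    filter_upwards [hUr.inner_dotBasis, hVr.inner_dotBasis, hm.coord i] with t a3 a4 a5
    rw [a3, a4, a5, rlIntLeft_const_mul, mul_mul_mul_comm, B.lam_rpow_mul_rpow]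
    norm_num
  have c3 : ∫ t in Ioo 0 T, B.lam i ^ (β / 2) * ⟪B.dotBasis (-β) i, f t⟫ *
      rlIntRight (1 - α) T (fun t => ⟪B.φ i, v t⟫) t =
      ∫ t in Ioo 0 T, ⟪B.dotBasis (-β) i, f t⟫ *
        (B.lam i ^ (β / 2) * rlIntRight (1 - α) T (fun t => ⟪B.φ i, v t⟫) t) := by
    refine integral_congr_ae (ae_of_all _ fun t => ?_)
    simp only
    ring
  rw [← c3, ← hwf, c1, c2]

end Modes

/-! ## Regularity of the weak solution -/

open DirichletEigenbasis

theorem rlIntLeft_one_eq {X : Type*} [NormedAddCommGroup X] [NormedSpace ℝ X] (v : ℝ → X) :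
    rlIntLeft 1 v = fun t => ∫ s in Ioo 0 t, v s := by
  funext t
  simp [rlIntLeft]

theorem continuousOn_rlIntLeft_one {X : Type*} [NormedAddCommGroup X] [NormedSpace ℝ X]
    {T : ℝ} {v : ℝ → X} (hv : IntegrableOn v (Ioo 0 T)) :
    ContinuousOn (rlIntLeft 1 v) (Icc 0 T) := by
  rw [rlIntLeft_one_eq]
  simp_rw [← integral_Ioc_eq_integral_Ioo]
  exact intervalIntegral.continuousOn_primitive
    ((integrableOn_Icc_iff_integrableOn_Ioo (by finiteness) (by finiteness)).2 hv)

section Pairing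

variable {d : ℕ} {Ω : Set (EuclideanSpace ℝ (Fin d))} {B : DirichletEigenbasis Ω} {γ δ : ℝ}

theorem summable_inner_mul_inner (x : B.DotH γ) (y : B.DotH δ) :
    Summable fun i => ⟪B.dotBasis γ i, x⟫ * ⟪B.dotBasis δ i, y⟫ := by
  refine (lp.summable_inner (𝕜 := ℝ) ((B.dotBasis γ).repr x) ((B.dotBasis δ).repr y)).congr
    fun i => ?_
  rw [HilbertBasis.repr_apply_apply, HilbertBasis.repr_apply_apply]
  exact mul_comm _ _

/-- The sum is the ℓ² inner product of the two coordinate sequences, so integrability follows from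
Cauchy–Schwarz in space and time. -/
theorem integrable_tsum_inner_mul_inner {T : ℝ} {x : ℝ → B.DotH γ} {y : ℝ → B.DotH δ}
    (hx : MemL2 T x) (hy : MemL2 T y) : IntegrableOn
      (fun t => ∑' i, ⟪B.dotBasis γ i, x t⟫ * ⟪B.dotBasis δ i, y t⟫) (Ioo 0 T) := by
  have h1 : MemL2 T fun t => (B.dotBasis γ).repr (x t) :=
    (B.dotBasis γ).repr.toContinuousLinearEquiv.toContinuousLinearMap.comp_memLp' hx
  have h2 : MemL2 T fun t => (B.dotBasis δ).repr (y t) :=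
    (B.dotBasis δ).repr.toContinuousLinearEquiv.toContinuousLinearMap.comp_memLp' hy
  have h3 : IntegrableOn (fun t => ‖(B.dotBasis γ).repr (x t)‖ * ‖(B.dotBasis δ).repr (y t)‖)
      (Ioo 0 T) := h1.norm.integrable_mul h2.norm
  have h4 : IntegrableOn (fun t => ⟪(B.dotBasis γ).repr (x t), (B.dotBasis δ).repr (y t)⟫)
      (Ioo 0 T) :=
    Integrable.mono' h3 (h1.1.inner h2.1) (ae_of_all _ fun t => norm_inner_le_norm _ _)
  refine h4.congr (ae_of_all _ fun t => ?_)
  simp only [lp.inner_eq_tsum]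
  refine tsum_congr fun i => ?_
  rw [HilbertBasis.repr_apply_apply, HilbertBasis.repr_apply_apply]
  exact mul_comm _ _

theorem seriesPairing_coef {β : ℝ} (x : B.DotH (-β)) (y : B.DotH β) :
    seriesPairing x.coef y.coef = ∑' i, ⟪B.dotBasis (-β) i, x⟫ * ⟪B.dotBasis β i, y⟫ := by
  refine tsum_congr fun i => ?_
  rw [DotH.inner_dotBasis, DotH.inner_dotBasis, mul_mul_mul_comm, B.lam_rpow_mul_rpow,
    show -β / 2 + β / 2 = 0 by ring, Real.rpow_zero, one_mul]

theorem gradPairing_eq_tsum (hΩ : IsOpen Ω) (hγ : 1 ≤ γ) (x : B.DotH γ) (y : B.DotH δ) :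
    gradPairing x y = ∑' i, B.lam i * (x.coef i * y.coef i) := by
  refine tsum_congr fun i => ?_
  rw [B.inner_weakGrad_basis hΩ (x.summable_lam_toL2 hγ), DotH.coefL2_toL2 (by linarith)]
  ring

/-- The weights of Ḣ^{2-β} and Ḣ^β multiply to λ_i, so the gradient pairing is bounded on this pair
of spaces. -/
theorem gradPairing_eq_inner (hΩ : IsOpen Ω) {β : ℝ} (hβ : β ≤ 1) (x : B.DotH (2 - β))
    (y : B.DotH β) :
    gradPairing x y = ∑' i, ⟪B.dotBasis (2 - β) i, x⟫ * ⟪B.dotBasis β i, y⟫ := by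
  rw [gradPairing_eq_tsum hΩ (by linarith)]
  refine tsum_congr fun i => ?_
  rw [DotH.inner_dotBasis, DotH.inner_dotBasis, mul_mul_mul_comm, B.lam_rpow_mul_rpow,
    show (2 - β) / 2 + β / 2 = 1 by ring, Real.rpow_one]

theorem inner_weakGrad_toL2 (hΩ : IsOpen Ω) (hγ : 1 ≤ γ) (hδ : 1 ≤ δ) (x : B.DotH γ)
    (y : B.DotH δ) : ⟪weakGrad Ω x.toL2, weakGrad Ω y.toL2⟫ = gradPairing x y := by
  rw [gradPairing_eq_tsum hΩ hγ, B.inner_weakGrad hΩ (x.summable_lam_toL2 hγ)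
    (y.summable_lam_toL2 hδ), DotH.coefL2_toL2 (by linarith), DotH.coefL2_toL2 (by linarith)]

/-- The embedding of `L²(0,T;Ḣ^γ)` into `L²(0,T;Ḣ^δ)` for `δ ≤ γ`. -/
theorem MemL2.exists_coef_eq {T : ℝ} (h : δ ≤ γ) {v : ℝ → B.DotH γ} (hv : MemL2 T v) :
    ∃ z : ℝ → B.DotH δ, MemL2 T z ∧
      ∀ᵐ t ∂volume.restrict (Ioo 0 T), (z t).coef = (v t).coef := by
  obtain ⟨z, hz, hc⟩ := exists_memL2_of_coordinates (B.dotBasis δ)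
    (c := fun i t => B.lam i ^ ((δ - γ) / 2) * ⟪B.dotBasis γ i, v t⟫)
    (fun i => MemLp.const_mul (hv.inner _) _) (by
      have hle : ∀ i, ∫⁻ t in Ioo 0 T, ‖B.lam i ^ ((δ - γ) / 2) * ⟪B.dotBasis γ i, v t⟫‖ₑ ^ 2 ≤
          ENNReal.ofReal (B.lam 0 ^ (δ - γ)) *
            ∫⁻ t in Ioo 0 T, ‖⟪B.dotBasis γ i, v t⟫‖ₑ ^ 2 := by
        intro i
        rw [lintegral_const_mul_sq, B.ofReal_sq_rpow, show 2 * ((δ - γ) / 2) = δ - γ by ring]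
        refine mul_le_mul_left (ENNReal.ofReal_le_ofReal ?_) _
        exact Real.rpow_le_rpow_of_nonpos (B.lam_pos 0) (B.lam_mono (Nat.zero_le i)) (by linarith)
      refine (ENNReal.tsum_le_tsum hle).trans_lt ?_
      rw [ENNReal.tsum_mul_left, ← hv.lintegral_enorm_sq_eq]
      exact ENNReal.mul_lt_top ENNReal.ofReal_lt_top (lintegral_lt_top_of_memLp_two hv))
  refine ⟨z, hz, ?_⟩
  filter_upwards [hc] with t ht
  funext i
  rw [DotH.coef_eq, DotH.coef_eq, ht, ← mul_assoc, B.lam_rpow_mul_rpow]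
  congr 2
  ring

end Pairing

section Regularity

variable {d : ℕ} {Ω : Set (EuclideanSpace ℝ (Fin d))} {B : DirichletEigenbasis Ω} {α T β : ℝ}
  {f : ℝ → B.DotH (-β)} {w : ℕ → ℝ → ℝ}

theorem sobolevNorm_le_eLpNorm (hf : MemL2 T f) {X : Type*} [NormedAddCommGroup X]
    [InnerProductSpace ℝ X] {e : HilbertBasis ℕ ℝ X} {s : ℝ} {U : ℝ → X} {C : ℝ≥0∞}
    (h : ∀ i, sobolevNormSq s T (fun t => ⟪e i, U t⟫) ≤
      C * ∫⁻ t in Ioo 0 T, ‖⟪B.dotBasis (-β) i, f t⟫‖ₑ ^ 2) :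
    sobolevNorm e s T U ≤ C ^ (1 / 2 : ℝ) * eLpNorm f 2 (volume.restrict (Ioo 0 T)) := by
  rw [sobolevNorm, eLpNorm_two_eq, ← ENNReal.mul_rpow_of_nonneg _ _ (by norm_num)]
  exact ENNReal.rpow_le_rpow (tsum_le_mul_lintegral hf h) (by norm_num)

/-- The constant in the estimate of the `H¹(0,T;Ḣ^{-β})` norm. -/
def timeConst (T : ℝ) : ℝ≥0∞ :=
  (ENNReal.ofReal (Real.exp T ^ 2) + 1) * ENNReal.ofReal (Real.exp T ^ 2)

/-- The constant in the estimate of the `H^{1-α/2}(0,T;Ḣ^{1-β})` norm. -/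
def mixedConst (α T : ℝ) : ℝ≥0∞ :=
  energyConst (1 - α / 2) T * ENNReal.ofReal (Real.cos (α * (Real.pi / 2)))⁻¹

/-- The constant in the estimate of the `H^{1-α}(0,T;Ḣ^{2-β})` norm. -/
def spaceConst (α T : ℝ) : ℝ≥0∞ := energyConst (1 - α) T * 4

theorem timeConst_lt_top (T : ℝ) : timeConst T < ⊤ := by
  unfold timeConst
  finiteness

theorem mixedConst_lt_top (h0 : 0 < α) (h1 : α < 1) (hT : 0 < T) : mixedConst α T < ⊤ :=
  ENNReal.mul_lt_top (energyConst_lt_top (by linarith) (by linarith) hT) ENNReal.ofReal_lt_top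

theorem spaceConst_lt_top (h0 : 0 < α) (h1 : α < 1) (hT : 0 < T) : spaceConst α T < ⊤ :=
  ENNReal.mul_lt_top (energyConst_lt_top (by linarith) (by linarith) hT) (by simp)

theorem memSobolev_of_le (hf : MemL2 T f) {X : Type*} [NormedAddCommGroup X]
    [InnerProductSpace ℝ X] {e : HilbertBasis ℕ ℝ X} {s : ℝ} {U : ℝ → X} (hU : MemL2 T U)
    {C : ℝ≥0∞} (hC : C < ⊤)
    (h : sobolevNorm e s T U ≤ C ^ (1 / 2 : ℝ) * eLpNorm f 2 (volume.restrict (Ioo 0 T))) :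
    MemSobolev e s T U :=
  ⟨hU, h.trans_lt (ENNReal.mul_lt_top (ENNReal.rpow_lt_top_of_nonneg (by norm_num) hC.ne) hf.2)⟩

/-- The exponent combines λ_i^{β/2} from the coefficient of u with λ_i^{γ/2} from the normalization
of the basis of Ḣ^γ. -/
theorem represents_of_coordinates {γ : ℝ} {u : ℝ → L2 Ω} (hm : HasModes B T β w u)
    {U : ℝ → B.DotH γ} (h : ∀ᵐ t ∂volume.restrict (Ioo 0 T), ∀ i,
      ⟪B.dotBasis γ i, U t⟫ = B.lam i ^ ((β + γ) / 2) * rlIntLeft 1 (w i) t) :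
    Represents B T U u := by
  filter_upwards [h, hm] with t h2 h3
  funext i
  rw [h3 i, DotH.coef_eq, h2 i, ← mul_assoc, B.lam_rpow_mul_rpow]
  congr 2
  ring

namespace SolvesModes

theorem exists_timeDeriv (hw : SolvesModes B α T f w) (h0 : 0 < α) (h1 : α < 1)
    (hf : MemL2 T f) {X : Type*} [NormedAddCommGroup X] [InnerProductSpace ℝ X]
    (e : HilbertBasis ℕ ℝ X) : ∃ D : ℝ → X, MemL2 T D ∧
      ∀ᵐ t ∂volume.restrict (Ioo 0 T), ∀ i, ⟪e i, D t⟫ = w i t :=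
  exists_memL2_of_coordinates e (fun i => (hw i).w_mem)
    (tsum_lt_top_of_le hf ENNReal.ofReal_lt_top fun i =>
      (hw i).lintegral_w_le h0 h1.le (B.lam_pos i).le)

theorem exists_space (hw : SolvesModes B α T f w) (h0 : 0 < α) (h1 : α < 1) (hT : 0 < T)
    (hf : MemL2 T f) {X : Type*} [NormedAddCommGroup X] [InnerProductSpace ℝ X]
    (e : HilbertBasis ℕ ℝ X) : ∃ U : ℝ → X, MemL2 T U ∧
      ∀ᵐ t ∂volume.restrict (Ioo 0 T), ∀ i, ⟪e i, U t⟫ = B.lam i * rlIntLeft 1 (w i) t := by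
  refine exists_memL2_of_le hf e B.lam (fun i => (hw i).w_mem.rlIntLeft one_pos)
    (spaceConst_lt_top h0 h1 hT) fun i => ?_
  rw [ENNReal.ofReal_pow (B.lam_pos i).le]
  exact (mul_le_mul_right (lintegral_le_sobolevNormSq _ _ _) _).trans
    ((hw i).lam_sq_mul_sobolevNormSq_le h0 h1 (B.lam_pos i).le)

theorem exists_space_deriv (hw : SolvesModes B α T f w) (h0 : 0 < α) (h1 : α < 1)
    (hf : MemL2 T f) {X : Type*} [NormedAddCommGroup X] [InnerProductSpace ℝ X]
    (e : HilbertBasis ℕ ℝ X) : ∃ D : ℝ → X, MemL2 T D ∧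
      ∀ᵐ t ∂volume.restrict (Ioo 0 T), ∀ i, ⟪e i, D t⟫ = B.lam i * rlIntLeft α (w i) t := by
  refine exists_memL2_of_le hf e B.lam (fun i => (hw i).w_mem.rlIntLeft h0)
    (C := ENNReal.ofReal (Real.exp T ^ 2) * 4)
    (ENNReal.mul_lt_top ENNReal.ofReal_lt_top (by simp)) fun i => ?_
  rw [ENNReal.ofReal_pow (B.lam_pos i).le]
  exact (hw i).lam_sq_mul_lintegral_rlIntLeft_le h0 h1.le (B.lam_pos i).le

/-- In each coordinate, D^{1-α} is the derivative of I^α, and I^α I^1 w = I^1 I^α w has derivative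
I^α w. -/
theorem hasRLDeriv (hw : SolvesModes B α T f w) (h0 : 0 < α) {X : Type*}
    [NormedAddCommGroup X] [InnerProductSpace ℝ X] [CompleteSpace X] (e : HilbertBasis ℕ ℝ X)
    {U D : ℝ → X} (hU : MemL2 T U) (hD : MemL2 T D) (k : ℕ → ℝ)
    (hUc : ∀ᵐ t ∂volume.restrict (Ioo 0 T), ∀ i, ⟪e i, U t⟫ = k i * rlIntLeft 1 (w i) t)
    (hDc : ∀ᵐ t ∂volume.restrict (Ioo 0 T), ∀ i, ⟪e i, D t⟫ = k i * rlIntLeft α (w i) t) :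
    HasRLDeriv (1 - α) T U D := by
  rw [HasRLDeriv, sub_sub_cancel]
  refine hasTimeDeriv_of_coordinates e (hU.rlIntLeft h0).integrableOn hD.integrableOn fun i => ?_
  refine ((hasTimeDeriv_rlIntLeft h0 (hw i).w_mem).const_mul (k i)).congr ?_ ?_
  · have hUi : (fun t => ⟪e i, U t⟫) =ᵐ[volume.restrict (Ioo 0 T)]
        fun t => k i * rlIntLeft 1 (w i) t := by
      filter_upwards [hUc] with t ht using ht i
    filter_upwards [inner_rlIntLeft h0 hU.integrableOn, ae_restrict_mem measurableSet_Ioo]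
      with t ht hm
    rw [ht, rlIntLeft_congr hUi hm, rlIntLeft_const_mul]
  · filter_upwards [hDc] with t ht
    rw [ht]

theorem eq_coordinates (hw : SolvesModes B α T f w) : ∀ᵐ t ∂volume.restrict (Ioo 0 T), ∀ i,
    w i t + B.lam i * rlIntLeft α (w i) t = ⟪B.dotBasis (-β) i, f t⟫ :=
  ae_all_iff.2 fun i => (hw i).eq

/-- The variational equation, from the equation for the coordinates. -/
theorem variational (hΩ : IsOpen Ω) (hw : SolvesModes B α T f w) (hβ : β ≤ 1)
    {du : ℝ → B.DotH (-β)} {Du : ℝ → B.DotH (2 - β)} (hdu : MemL2 T du) (hDu : MemL2 T Du)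
    (hdc : ∀ᵐ t ∂volume.restrict (Ioo 0 T), ∀ i, ⟪B.dotBasis (-β) i, du t⟫ = w i t)
    (hDc : ∀ᵐ t ∂volume.restrict (Ioo 0 T), ∀ i,
      ⟪B.dotBasis (2 - β) i, Du t⟫ = B.lam i * rlIntLeft α (w i) t)
    {v : ℝ → B.DotH β} (hv : MemL2 T v) :
    (∫ t in Ioo 0 T, seriesPairing (du t).coef (v t).coef) +
      (∫ t in Ioo 0 T, gradPairing (Du t) (v t)) =
      ∫ t in Ioo 0 T, seriesPairing (f t).coef (v t).coef := by
  simp_rw [seriesPairing_coef, gradPairing_eq_inner hΩ hβ]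
  rw [← integral_add (integrable_tsum_inner_mul_inner hdu hv)
    (integrable_tsum_inner_mul_inner hDu hv)]
  refine integral_congr_ae ?_
  filter_upwards [hdc, hDc, hw.eq_coordinates] with t a1 a2 a3
  rw [← (summable_inner_mul_inner (du t) (v t)).tsum_add (summable_inner_mul_inner (Du t) (v t))]
  refine tsum_congr fun i => ?_
  rw [a1, a2, ← a3]
  ring

/-- In Ḣ^{-β}, Ḣ^{1-β}, Ḣ^{2-β} the coordinates of u are I^1 w_i with weights 1, λ_i^{1/2}, λ_i.
These are exactly the weights in the three scalar Sobolev bounds, so summation gives constants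
depending on α and T only. -/
theorem regularity (hΩ : IsOpen Ω) (hw : SolvesModes B α T f w) (h0 : 0 < α) (h1 : α < 1)
    (hT : 0 < T) (hβ : β ≤ 1) (hf : MemL2 T f) {u : ℝ → L2 Ω} (hm : HasModes B T β w u) :
    ∃ (U₀ du : ℝ → B.DotH (-β)) (U₁ : ℝ → B.DotH (1 - β)) (U₂ Du : ℝ → B.DotH (2 - β)),
      Represents B T U₀ u ∧ Represents B T U₁ u ∧ Represents B T U₂ u ∧
      ContinuousOn U₀ (Icc 0 T) ∧ U₀ 0 = 0 ∧
      MemL2 T du ∧ HasTimeDeriv T U₀ du ∧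
      MemL2 T Du ∧ HasRLDeriv (1 - α) T U₂ Du ∧
      (∀ v : ℝ → B.DotH β, MemL2 T v →
        (∫ t in Ioo 0 T, seriesPairing (du t).coef (v t).coef) +
          (∫ t in Ioo 0 T, gradPairing (Du t) (v t)) =
        ∫ t in Ioo 0 T, seriesPairing (f t).coef (v t).coef) ∧
      (∀ v : ℝ → B.DotH 1, MemL2 T v →
        (∫ t in Ioo 0 T, seriesPairing (du t).coef (v t).coef) +
          (∫ t in Ioo 0 T, ⟪weakGrad Ω (Du t).toL2, weakGrad Ω (v t).toL2⟫) =
        ∫ t in Ioo 0 T, seriesPairing (f t).coef (v t).coef) ∧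
      MemSobolev (B.dotBasis (-β)) 1 T U₀ ∧
      MemSobolev (B.dotBasis (1 - β)) (1 - α / 2) T U₁ ∧
      MemSobolev (B.dotBasis (2 - β)) (1 - α) T U₂ ∧
      sobolevNorm (B.dotBasis (-β)) 1 T U₀ +
          sobolevNorm (B.dotBasis (1 - β)) (1 - α / 2) T U₁ +
          sobolevNorm (B.dotBasis (2 - β)) (1 - α) T U₂ ≤
        (timeConst T ^ (1 / 2 : ℝ) + mixedConst α T ^ (1 / 2 : ℝ) +
          spaceConst α T ^ (1 / 2 : ℝ)) * eLpNorm f 2 (volume.restrict (Ioo 0 T)) := by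
  obtain ⟨du, hdu, hdc⟩ := hw.exists_timeDeriv h0 h1 hf (B.dotBasis (-β))
  obtain ⟨Du, hDu, hDc⟩ := hw.exists_space_deriv h0 h1 hf (B.dotBasis (2 - β))
  obtain ⟨U₂, hU₂, hc₂⟩ := hw.exists_space h0 h1 hT hf (B.dotBasis (2 - β))
  have hb₁ : ∀ i, ENNReal.ofReal ((B.lam i ^ (1 / 2 : ℝ)) ^ 2) *
      sobolevNormSq (1 - α / 2) T (rlIntLeft 1 (w i)) ≤
      mixedConst α T * ∫⁻ t in Ioo 0 T, ‖⟪B.dotBasis (-β) i, f t⟫‖ₑ ^ 2 := fun i => by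
    rw [B.ofReal_sq_rpow, show (2 : ℝ) * (1 / 2) = 1 by norm_num, Real.rpow_one]
    exact (hw i).lam_mul_sobolevNormSq_le h0 h1 (B.lam_pos i).le (by linarith) le_rfl
  obtain ⟨U₁, hU₁, hc₁⟩ := exists_memL2_of_le hf (B.dotBasis (1 - β))
    (fun i => B.lam i ^ (1 / 2 : ℝ)) (fun i => (hw i).w_mem.rlIntLeft one_pos)
    (mixedConst_lt_top h0 h1 hT)
    fun i => (mul_le_mul_right (lintegral_le_sobolevNormSq _ _ _) _).trans (hb₁ i)
  -- Taking this version as the primitive of u' gives continuity on the closed interval and the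
  -- value 0 at time 0 directly.
  set U₀ := rlIntLeft 1 du with hU₀def
  have hU₀ : MemL2 T U₀ := hdu.rlIntLeft one_pos
  have hc₀ : ∀ᵐ t ∂volume.restrict (Ioo 0 T), ∀ i,
      ⟪B.dotBasis (-β) i, U₀ t⟫ = rlIntLeft 1 (w i) t := by
    filter_upwards [inner_rlIntLeft one_pos hdu.integrableOn, ae_restrict_mem measurableSet_Ioo]
      with t ht hmem i
    have hdi : (fun t => ⟪B.dotBasis (-β) i, du t⟫) =ᵐ[volume.restrict (Ioo 0 T)] w i := by
      filter_upwards [hdc] with s hs using hs i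
    rw [ht, rlIntLeft_congr hdi hmem]
  have n₀ : sobolevNorm (B.dotBasis (-β)) 1 T U₀ ≤
      timeConst T ^ (1 / 2 : ℝ) * eLpNorm f 2 (volume.restrict (Ioo 0 T)) := by
    refine sobolevNorm_le_eLpNorm hf fun i => ?_
    have hi : (fun t => ⟪B.dotBasis (-β) i, U₀ t⟫) =ᵐ[volume.restrict (Ioo 0 T)]
        rlIntLeft 1 (w i) := by
      filter_upwards [hc₀] with s hs using hs i
    rw [sobolevNormSq_one_congr hi]
    exact (hw i).sobolevNormSq_one_le h0 h1.le (B.lam_pos i).le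
  have n₁ : sobolevNorm (B.dotBasis (1 - β)) (1 - α / 2) T U₁ ≤
      mixedConst α T ^ (1 / 2 : ℝ) * eLpNorm f 2 (volume.restrict (Ioo 0 T)) := by
    refine sobolevNorm_le_eLpNorm hf fun i => ?_
    have hi : (fun t => ⟪B.dotBasis (1 - β) i, U₁ t⟫) =ᵐ[volume.restrict (Ioo 0 T)]
        fun t => B.lam i ^ (1 / 2 : ℝ) * rlIntLeft 1 (w i) t := by
      filter_upwards [hc₁] with s hs using hs i
    rw [sobolevNormSq_congr (by linarith) hi, sobolevNormSq_const_mul (by linarith)]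
    exact hb₁ i
  have n₂ : sobolevNorm (B.dotBasis (2 - β)) (1 - α) T U₂ ≤
      spaceConst α T ^ (1 / 2 : ℝ) * eLpNorm f 2 (volume.restrict (Ioo 0 T)) := by
    refine sobolevNorm_le_eLpNorm hf fun i => ?_
    have hi : (fun t => ⟪B.dotBasis (2 - β) i, U₂ t⟫) =ᵐ[volume.restrict (Ioo 0 T)]
        fun t => B.lam i * rlIntLeft 1 (w i) t := by
      filter_upwards [hc₂] with s hs using hs i
    rw [sobolevNormSq_congr (by linarith) hi, sobolevNormSq_const_mul (by linarith),
      ENNReal.ofReal_pow (B.lam_pos i).le]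
    exact (hw i).lam_sq_mul_sobolevNormSq_le h0 h1 (B.lam_pos i).le
  have hvar : ∀ v : ℝ → B.DotH β, MemL2 T v →
      (∫ t in Ioo 0 T, seriesPairing (du t).coef (v t).coef) +
        (∫ t in Ioo 0 T, gradPairing (Du t) (v t)) =
      ∫ t in Ioo 0 T, seriesPairing (f t).coef (v t).coef :=
    fun v hv => hw.variational hΩ hβ hdu hDu hdc hDc hv
  refine ⟨U₀, du, U₁, U₂, Du, represents_of_coordinates hm ?_, represents_of_coordinates hm ?_,
    represents_of_coordinates hm ?_, continuousOn_rlIntLeft_one hdu.integrableOn, ?_, hdu, ?_, hDu,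
    hw.hasRLDeriv h0 _ hU₂ hDu B.lam hc₂ hDc, hvar, fun v hv => ?_,
    memSobolev_of_le hf hU₀ (timeConst_lt_top T) n₀,
    memSobolev_of_le hf hU₁ (mixedConst_lt_top h0 h1 hT) n₁,
    memSobolev_of_le hf hU₂ (spaceConst_lt_top h0 h1 hT) n₂, ?_⟩
  · filter_upwards [hc₀] with t ht i
    rw [ht, show (β + -β) / 2 = 0 by ring, Real.rpow_zero, one_mul]
  · filter_upwards [hc₁] with t ht i
    rw [ht, show (β + (1 - β)) / 2 = 1 / 2 by ring]
  · filter_upwards [hc₂] with t ht i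
    rw [ht, show (β + (2 - β)) / 2 = 1 by ring, Real.rpow_one]
  · simp [hU₀def, rlIntLeft_one_eq]
  · refine hasTimeDeriv_of_coordinates (B.dotBasis (-β)) hU₀.integrableOn hdu.integrableOn
      fun i => (hasTimeDeriv_rlIntLeft_one (hw i).w_mem).congr ?_ ?_
    · filter_upwards [hc₀] with t ht using (ht i).symm
    · filter_upwards [hdc] with t ht using (ht i).symm
  -- A test function in Ḣ^1 is read as an element of Ḣ^β with the same coefficients; both pairings
  -- see only coefficients.
  · obtain ⟨z, hz, hzc⟩ := hv.exists_coef_eq hβ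
    have e1 : ∀ g : ℝ → B.DotH (-β), ∫ t in Ioo 0 T, seriesPairing (g t).coef (v t).coef =
        ∫ t in Ioo 0 T, seriesPairing (g t).coef (z t).coef := fun g => by
      refine integral_congr_ae ?_
      filter_upwards [hzc] with t ht
      rw [ht]
    have e2 : ∫ t in Ioo 0 T, ⟪weakGrad Ω (Du t).toL2, weakGrad Ω (v t).toL2⟫ =
        ∫ t in Ioo 0 T, gradPairing (Du t) (z t) := by
      refine integral_congr_ae ?_
      filter_upwards [hzc] with t ht
      rw [inner_weakGrad_toL2 hΩ (by linarith) le_rfl, gradPairing, gradPairing, ht]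
    rw [e1, e1, e2]
    exact hvar z hz
  · rw [add_mul, add_mul]
    exact add_le_add (add_le_add n₀ n₁) n₂

/-- For β = 0 the modes of f are its L² coefficients, so the equations of the modes are the
coordinates of the claim. The Laplacian has coefficients -λ_i I^1 w_i, whence the minus signs in the
witnesses. -/
theorem strong_equation (hw : SolvesModes B α T f w) (h0 : 0 < α) (h1 : α < 1)
    (hT : 0 < T) (hβ : β = 0) (hf : MemL2 T f) {u : ℝ → L2 Ω} (hu : MemL2 T u)
    (hm : HasModes B T β w u) :
    ∃ du Lu DLu : ℝ → L2 Ω,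
      MemL2 T du ∧ HasTimeDeriv T u du ∧
      MemL2 T Lu ∧ (∀ᵐ t ∂(volume.restrict (Ioo 0 T)), HasWeakLaplacian Ω (u t) (Lu t)) ∧
      MemL2 T DLu ∧ HasRLDeriv (1 - α) T Lu DLu ∧
      ∀ᵐ t ∂(volume.restrict (Ioo 0 T)), du t - DLu t = (f t).toL2 := by
  obtain ⟨du, hdu, hdc⟩ := hw.exists_timeDeriv h0 h1 hf B.φ
  obtain ⟨V, hV, hVc⟩ := hw.exists_space h0 h1 hT hf B.φ
  obtain ⟨D, hD, hDc⟩ := hw.exists_space_deriv h0 h1 hf B.φ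
  have hm' : ∀ᵐ t ∂volume.restrict (Ioo 0 T), ∀ i, ⟪B.φ i, u t⟫ = rlIntLeft 1 (w i) t := by
    filter_upwards [hm] with t ht i
    have := ht i
    rwa [hβ, zero_div, Real.rpow_zero, one_mul] at this
  refine ⟨du, fun t => -V t, fun t => -D t, hdu, ?_, MemLp.neg hV, ?_, MemLp.neg hD, ?_, ?_⟩
  · refine hasTimeDeriv_of_coordinates B.φ hu.integrableOn hdu.integrableOn
      fun i => (hasTimeDeriv_rlIntLeft_one (hw i).w_mem).congr ?_ ?_
    · filter_upwards [hm'] with t ht using (ht i).symm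
    · filter_upwards [hdc] with t ht using (ht i).symm
  · filter_upwards [hVc, hm'] with t a1 a2
    refine B.hasWeakLaplacian_of_coefL2 fun i => ?_
    rw [coefL2, coefL2, inner_neg_right, a1, a2]
  · refine hw.hasRLDeriv h0 B.φ (MemLp.neg hV) (MemLp.neg hD) (fun i => -B.lam i) ?_ ?_
    · filter_upwards [hVc] with t ht i
      rw [inner_neg_right, ht, neg_mul]
    · filter_upwards [hDc] with t ht i
      rw [inner_neg_right, ht, neg_mul]
  · filter_upwards [hdc, hDc, hw.eq_coordinates] with t a1 a2 a3
    refine B.φ.ext_inner fun i => ?_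
    have e : ⟪B.φ i, (f t).toL2⟫ = ⟪B.dotBasis (-β) i, f t⟫ := by
      have := congrFun (DotH.coefL2_toL2 (by linarith : 0 ≤ -β) (f t)) i
      rw [coefL2] at this
      rw [this, DotH.coef_eq, hβ, neg_neg, zero_div, Real.rpow_zero, one_mul]
    rw [e, sub_neg_eq_add, inner_add_right, a1, a2, a3]

end SolvesModes

end Regularity

end

/-! ### The theorem, with a constant independent of the domain -/

theorem mainTheorem6 (α T : ℝ) (hα₀ : 0 < α) (hα₁ : α < 1) (hT : 0 < T) :
    ∃ C : ℝ, 0 < C ∧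
      ∀ (d : ℕ), 1 ≤ d → d ≤ 3 →
      ∀ (Ω : Set (EuclideanSpace ℝ (Fin d))), IsOpenConvexPolytope Ω →
      ∀ (B : DirichletEigenbasis Ω) (β : ℝ), 0 ≤ β → β ≤ 1 →
      ∀ f : ℝ → B.DotH (-β), MemL2 T f →
        -- there is exactly one weak solution
        (∃ u : ℝ → L2 Ω, IsWeakSolution B α T f u ∧
          ∀ u' : ℝ → L2 Ω, IsWeakSolution B α T f u' →
            u' =ᵐ[volume.restrict (Ioo 0 T)] u) ∧
        ∀ u : ℝ → L2 Ω, IsWeakSolution B α T f u →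
          (∃ (U₀ du : ℝ → B.DotH (-β)) (U₁ : ℝ → B.DotH (1 - β)) (U₂ Du : ℝ → B.DotH (2 - β)),
            -- `U₀`, `U₁`, `U₂` are `u`, with values in the three spaces
            Represents B T U₀ u ∧ Represents B T U₁ u ∧ Represents B T U₂ u ∧
            -- `u(0) = 0`
            ContinuousOn U₀ (Icc 0 T) ∧ U₀ 0 = 0 ∧
            -- `du = u'` and `Du = D_{0+}^{1-α} u`
            MemL2 T du ∧ HasTimeDeriv T U₀ du ∧
            MemL2 T Du ∧ HasRLDeriv (1 - α) T U₂ Du ∧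
            -- the variational equation
            (∀ v : ℝ → B.DotH β, MemL2 T v →
              (∫ t in Ioo 0 T, seriesPairing (du t).coef (v t).coef) +
                (∫ t in Ioo 0 T, gradPairing (Du t) (v t)) =
              ∫ t in Ioo 0 T, seriesPairing (f t).coef (v t).coef) ∧
            (∀ v : ℝ → B.DotH 1, MemL2 T v →
              (∫ t in Ioo 0 T, seriesPairing (du t).coef (v t).coef) +
                (∫ t in Ioo 0 T, ⟪weakGrad Ω (Du t).toL2, weakGrad Ω (v t).toL2⟫) =
              ∫ t in Ioo 0 T, seriesPairing (f t).coef (v t).coef) ∧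
            -- the regularity estimate
            MemSobolev (B.dotBasis (-β)) 1 T U₀ ∧
            MemSobolev (B.dotBasis (1 - β)) (1 - α / 2) T U₁ ∧
            MemSobolev (B.dotBasis (2 - β)) (1 - α) T U₂ ∧
            sobolevNorm (B.dotBasis (-β)) 1 T U₀ +
                sobolevNorm (B.dotBasis (1 - β)) (1 - α / 2) T U₁ +
                sobolevNorm (B.dotBasis (2 - β)) (1 - α) T U₂ ≤
              ENNReal.ofReal C * eLpNorm f 2 (volume.restrict (Ioo 0 T))) ∧
          -- for `β = 0`, the equation `u' - D_{0+}^{1-α} Δu = f` in `L²(0,T;L²(Ω))`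
          (β = 0 → ∃ du Lu DLu : ℝ → L2 Ω,
            MemL2 T du ∧ HasTimeDeriv T u du ∧
            MemL2 T Lu ∧ (∀ᵐ t ∂(volume.restrict (Ioo 0 T)), HasWeakLaplacian Ω (u t) (Lu t)) ∧
            MemL2 T DLu ∧ HasRLDeriv (1 - α) T Lu DLu ∧
            ∀ᵐ t ∂(volume.restrict (Ioo 0 T)), du t - DLu t = (f t).toL2) := by
  set K := timeConst T ^ (1 / 2 : ℝ) + mixedConst α T ^ (1 / 2 : ℝ) + spaceConst α T ^ (1 / 2 : ℝ)
    with hK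
  have hKt : K ≠ ⊤ := by
    have hr : ∀ {x : ℝ≥0∞}, x < ⊤ → x ^ (1 / 2 : ℝ) < ⊤ := fun hx =>
      ENNReal.rpow_lt_top_of_nonneg (by norm_num) hx.ne
    exact (ENNReal.add_lt_top.2 ⟨ENNReal.add_lt_top.2 ⟨hr (timeConst_lt_top T),
      hr (mixedConst_lt_top hα₀ hα₁ hT)⟩, hr (spaceConst_lt_top hα₀ hα₁ hT)⟩).ne
  -- Adding 1 only guarantees positivity. The constant is fixed before the dimension, domain,
  -- eigenbasis, β and f are introduced.
  refine ⟨K.toReal + 1, by positivity, fun d _ _ Ω hΩ B β _ hβ f hf => ?_⟩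
  obtain ⟨w, hw⟩ := exists_solvesModes (B := B) hα₀ hα₁.le hf
  obtain ⟨u, hu, hm⟩ := hw.exists_hasModes hα₀ hα₁ hT hβ hf
  refine ⟨⟨u, hw.isWeakSolution hΩ.isOpen hα₀ hα₁ hT hβ hf hu hm, fun u' hu' =>
    (hu'.hasModes hΩ.isOpen hα₀ hα₁ hT hw).ae_eq hm⟩, fun u' hu' => ?_⟩
  -- An arbitrary weak solution has the same modes as the constructed one, so the regularity
  -- statements apply to it directly.
  have hm' := hu'.hasModes hΩ.isOpen hα₀ hα₁ hT hw
  refine ⟨?_, fun hβ0 => hw.strong_equation hα₀ hα₁ hT hβ0 hf hu'.1.1.1 hm'⟩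
  obtain ⟨U₀, du, U₁, U₂, Du, r₀, r₁, r₂, hc, hz, m1, d1, m2, d2, v1, v2, s0, s1, s2, hle⟩ :=
    hw.regularity hΩ.isOpen hα₀ hα₁ hT hβ hf hm'
  refine ⟨U₀, du, U₁, U₂, Du, r₀, r₁, r₂, hc, hz, m1, d1, m2, d2, v1, v2, s0, s1, s2,
    hle.trans (mul_le_mul_left ?_ _)⟩
  rw [ENNReal.le_ofReal_iff_toReal_le hKt (by positivity)]
  linarith
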